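/- Let $n\ge 4$ and let $\pi$ be the permutation of $n$ intervals whose domain order is $1,2,\dots,n$ and whose image order is $n,3,2,5,4,\dots,n-1,n-2,1$ if $n$ is even, and $n,3,2,5,4,\dots,n-2,n-3,n-1,1$ if $n$ is odd (the first and the last letter are exchanged, the other letters are exchanged with their neighbours). In right Rauzy induction, a move of type $0$ (resp. $1$) is performed when the last letter of the domain order (resp. of the image order) is strictly longer than the last letter of the other order; the shorter letter (the loser) is put right after the longer one (the winner) in its own order, and its length is subtracted from that of the winner. The transition matrix $\Theta$ of a finite Rauzy path is the matrix with (old lengths) $=\Theta\cdot$(new lengths). For positive integers $a,c$ let $\dot\gamma_{k,a}=1^{\,n-1-k}\,0^a\,1\,0^2$ and let $\gamma^{a,c}$ be Fickenscher's cycle at $\pi$, $$\gamma^{a,c}=0\,\dot\gamma_{n-2,a}\dot\gamma_{n-4,a}\cdots\dot\gamma_{2,a}\,1^{c(n-1)}\ (n \text{ even}),\qquad \gamma^{a,c}=0\,(10)\,\dot\gamma_{n-3,a}\dot\gamma_{n-5,a}\cdots\dot\gamma_{2,a}\,1^{c(n-1)}\ (n\text{ odd}),$$ with transition matrix $\Theta_{c,a}$.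 For a nonzero vector $v$ with nonnegative entries write $\overline{\Theta}_{c,a}v=\Theta_{c,a}v/|\Theta_{c,a}v|$, where $|\cdot|$ is the sum of the entries. Let $p\ge n+1$ be an integer and let $(a_i)_{i\ge1},(c_i)_{i\ge1}$ be positive integers with $c_{i+1}=p\,a_i=p^2c_i$ for all $i\ge 1$. Put $J=\{3,5,\dots,2\lfloor n/2\rfloor-1,\,n\}$, a set with $\lfloor n/2\rfloor$ elements. Then: 1. There are positive probability vectors $\alpha$ such that the Rauzy induction of the interval exchange transformation $(\alpha,\pi)$ of $[0,1)$ follows the infinite path $\gamma^{a_1,c_1}\gamma^{a_2,c_2}\gamma^{a_3,c_3}\cdots$. 2. For every $j\in J$ the limit $v_j=\lim_{m\to\infty}\overline{\Theta}_{c_1,a_1}\overline{\Theta}_{c_2,a_2}\cdots\overline{\Theta}_{c_m,a_m}e_j$ exists. 3. Let $T$ be any interval exchange transformation $(\alpha,\pi)$ as in 1, with intervals $X_1,\dots,X_n$. Then $T$ is non-uniquely ergodic: it has more than one invariant Borel probability measure on $[0,1)$. More precisely, there are $\lfloor n/2\rfloor$ pairwise distinct ergodic $T$-invariant Borel probability measures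 $\lambda_j$, $j\in J$, where $\lambda_j$ is the measure given by the limit $v_j$, that is, the unique $T$-invariant Borel probability measure on $[0,1)$ with $\lambda_j(X_i)=(v_j)_i$ for $1\le i\le n$. -/

import Mathlib

open MeasureTheory Filter Topology

/-! ## Interval exchange transformations

The intervals are numbered `0, …, n - 1`, so the `k`-th interval of the usual numbering
`1, …, n` has index `k - 1`. -/

/-- Left endpoint of the `i`-th interval when `[0, ∑ α)` is cut into consecutive intervals of
lengths `α 0, α 1, …`. -/
noncomputable def leftEnd {n : ℕ} (α : Fin n → ℝ) (i : Fin n) : ℝ :=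
  ∑ j ∈ Finset.univ.filter (fun j => j < i), α j

/-- The `i`-th half-open interval of the partition with lengths `α`. -/
noncomputable def ietInterval {n : ℕ} (α : Fin n → ℝ) (i : Fin n) : Set ℝ :=
  Set.Ico (leftEnd α i) (leftEnd α i + α i)

/-- The interval exchange transformation `(α, τ)`: the `i`-th interval is translated so that it
becomes the `τ i`-th interval of the partition with lengths `α ∘ τ⁻¹`. The map is extended by the
identity outside the union `[0, ∑ α)` of the intervals. -/
noncomputable def iet {n : ℕ} (α : Fin n → ℝ) (τ : Equiv.Perm (Fin n)) (x : ℝ) : ℝ :=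
  x + ∑ i, (ietInterval α i).indicator
    (fun _ => leftEnd (fun k => α (τ.symm k)) (τ i) - leftEnd α i) x

/-- `μ` is a `T`-invariant Borel probability measure on `[0, 1)`. -/
def IsInvariantProb (T : ℝ → ℝ) (μ : Measure ℝ) : Prop :=
  IsProbabilityMeasure μ ∧ μ (Set.Ico (0 : ℝ) 1)ᶜ = 0 ∧ MeasurePreserving T μ μ

/-- `T` has more than one invariant Borel probability measure on `[0, 1)`. -/
def NonUniquelyErgodic (T : ℝ → ℝ) : Prop :=
  ∃ μ ν : Measure ℝ, IsInvariantProb T μ ∧ IsInvariantProb T ν ∧ μ ≠ ν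

/-! ## Rauzy induction -/

/-- A labelled permutation: the order of the letters in the domain (`top`) and in the image
(`bot`). -/
structure RauzyTable (n : ℕ) where
  top : List (Fin n)
  bot : List (Fin n)

/-- Insert `l` immediately to the right of `w`. -/
def insertAfter {n : ℕ} (w l : Fin n) : List (Fin n) → List (Fin n)
  | [] => []
  | x :: xs => if x = w then x :: l :: xs else x :: insertAfter w l xs

namespace RauzyTable

/-- The two-row table of `τ`: the top row is `0, 1, …, n - 1`, and the bottom row lists
`τ⁻¹ 0, τ⁻¹ 1, …, τ⁻¹ (n - 1)`. -/
def ofPerm {n : ℕ} (τ : Equiv.Perm (Fin n)) : RauzyTable n where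
  top := List.finRange n
  bot := (List.finRange n).map τ.symm

/-- The winner of a move of the given type: `false` is type `0` (the last letter of the top row
wins), `true` is type `1` (the last letter of the bottom row wins). -/
def winner {n : ℕ} (t : Bool) (π : RauzyTable n) : Option (Fin n) :=
  if t then π.bot.getLast? else π.top.getLast?

/-- The loser of a move of the given type. -/
def loser {n : ℕ} (t : Bool) (π : RauzyTable n) : Option (Fin n) :=
  if t then π.top.getLast? else π.bot.getLast?

/-- The table after a move: the loser leaves the end of its row and is put right after the winner
in that row. -/
def move {n : ℕ} (t : Bool) (π : RauzyTable n) : RauzyTable n :=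
  match π.winner t, π.loser t with
  | some w, some l =>
    if t then ⟨insertAfter w l π.top.dropLast, π.bot⟩
    else ⟨π.top, insertAfter w l π.bot.dropLast⟩
  | _, _ => π

/-- The transition matrix of a move: (old lengths) = matrix * (new lengths). -/
noncomputable def moveMatrix {n : ℕ} (t : Bool) (π : RauzyTable n) : Matrix (Fin n) (Fin n) ℝ :=
  match π.winner t, π.loser t with
  | some w, some l => 1 + Matrix.single w l 1
  | _, _ => 1

/-- The transition matrix of a finite Rauzy path starting at `π`. -/
noncomputable def pathMatrix {n : ℕ} : List Bool → RauzyTable n → Matrix (Fin n) (Fin n) ℝ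
  | [], _ => 1
  | t :: ts, π => π.moveMatrix t * pathMatrix ts (π.move t)

/-- The interval exchange with table `π` and lengths `ℓ` undergoes a Rauzy induction of type
`t`: the winner is strictly longer than the loser. -/
def Admits {n : ℕ} (t : Bool) (π : RauzyTable n) (ℓ : Fin n → ℝ) : Prop :=
  ∃ w l, π.winner t = some w ∧ π.loser t = some l ∧ ℓ l < ℓ w

/-- The lengths after a move: the length of the loser is subtracted from that of the winner. -/
def newLengths {n : ℕ} (t : Bool) (π : RauzyTable n) (ℓ : Fin n → ℝ) : Fin n → ℝ :=
  match π.winner t, π.loser t with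
  | some w, some l => Function.update ℓ w (ℓ w - ℓ l)
  | _, _ => ℓ

/-- Iterated Rauzy induction of the interval exchange with table `π` and lengths `ℓ` begins with
the given finite sequence of types. -/
def Follows {n : ℕ} : List Bool → RauzyTable n → (Fin n → ℝ) → Prop
  | [], _, _ => True
  | t :: ts, π, ℓ => π.Admits t ℓ ∧ Follows ts (π.move t) (π.newLengths t ℓ)

end RauzyTable

/-! ## Fickenscher's cycle -/

/-- The underlying map of the permutation with bottom row `n, 3, 2, 5, 4, …, n-1, n-2, 1` for even
`n`, and `n, 3, 2, 5, 4, …, n-2, n-3, n-1, 1` for odd `n` (in the numbering `1, …, n`): the first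
and the last letter are exchanged, the other letters are exchanged with their neighbours. -/
def pairSwapVal (n i : ℕ) : ℕ :=
  if i = 0 then n - 1
  else if i = n - 1 then 0
  else if i % 2 = 1 then (if i + 1 = n - 1 then i else i + 1)
  else i - 1

theorem pairSwapVal_lt {n i : ℕ} (h : i < n) : pairSwapVal n i < n := by
  unfold pairSwapVal
  split_ifs <;> omega

theorem pairSwapVal_pairSwapVal {n i : ℕ} (h : i < n) :
    pairSwapVal n (pairSwapVal n i) = i := by
  generalize hj : pairSwapVal n i = j
  unfold pairSwapVal at hj ⊢
  split_ifs at hj <;> split_ifs <;> omega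

/-- The permutation at which Fickenscher's cycle is based. -/
def fickPerm (n : ℕ) : Equiv.Perm (Fin n) :=
  Function.Involutive.toPerm (fun i => ⟨pairSwapVal n i.val, pairSwapVal_lt i.isLt⟩)
    (fun i => Fin.ext (pairSwapVal_pairSwapVal i.isLt))

/-- The path `1^{n-1-k} 0^a 1 0^2`. -/
def fickBlock (n a k : ℕ) : List Bool :=
  List.replicate (n - 1 - k) true ++ List.replicate a false ++ [true] ++ [false, false]

/-- Fickenscher's cycle, with blocks `B k = 1^{n-1-k} 0^a 1 0^2`. For even `n` it is
`0 (B (n-2)) (B (n-4)) ⋯ (B 2) 1^{c(n-1)}`; for odd `n` it is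
`0 (1 0) (B (n-3)) (B (n-5)) ⋯ (B 2) 1^{c(n-1)}`. -/
def fickCycle (n c a : ℕ) : List Bool :=
  [false] ++ (if n % 2 = 0 then [] else [true, false]) ++
    (List.range (n / 2 - 1)).reverse.flatMap (fun i => fickBlock n a (2 * (i + 1))) ++
    List.replicate (c * (n - 1)) true

/-- The transition matrix `Θ_{c,a}` of Fickenscher's cycle. -/
noncomputable def fickTheta (n c a : ℕ) : Matrix (Fin n) (Fin n) ℝ :=
  (RauzyTable.ofPerm (fickPerm n)).pathMatrix (fickCycle n c a)

/-- The normalized action `v ↦ Θ_{c,a} v / |Θ_{c,a} v|`, where `|v|` is the sum of the entries. -/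
noncomputable def fickThetaBar (n c a : ℕ) (v : Fin n → ℝ) : Fin n → ℝ :=
  (∑ i, (fickTheta n c a).mulVec v i)⁻¹ • (fickTheta n c a).mulVec v

/-- The normalized product of the first `m` cycles applied to `v`; the parameters
`(c_1, a_1), (c_2, a_2), …` are `(c 0, a 0), (c 1, a 1), …`. -/
noncomputable def fickBarProd (n : ℕ) : ℕ → (ℕ → ℕ) → (ℕ → ℕ) → (Fin n → ℝ) → (Fin n → ℝ)
  | 0, _, _, v => v
  | m + 1, c, a, v => fickThetaBar n (c 0) (a 0)
      (fickBarProd n m (fun i => c (i + 1)) (fun i => a (i + 1)) v)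

/-- The interval exchange with permutation `fickPerm n` and lengths `α` is the one defined by the
parameters `c, a`: its Rauzy induction follows the infinite concatenation of the cycles with
parameters `(c 0, a 0), (c 1, a 1), …`. -/
def FollowsFickCycles (n : ℕ) (c a : ℕ → ℕ) (α : Fin n → ℝ) : Prop :=
  ∀ m : ℕ, (RauzyTable.ofPerm (fickPerm n)).Follows
    ((List.range m).flatMap (fun i => fickCycle n (c i) (a i))) α

/-- The indices `{3, 5, …, 2⌊n/2⌋ - 1, n}`, shifted to the numbering `0, …, n - 1`. -/
def fickIndices (n : ℕ) : Finset (Fin n) :=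
  Finset.univ.filter (fun j =>
    ((j.val + 1) % 2 = 1 ∧ 3 ≤ j.val + 1 ∧ j.val + 1 ≤ 2 * (n / 2) - 1) ∨ j.val + 1 = n)

/-! With `a = p c` the matrix of one cycle is `c (B + c⁻¹ E)`, where `B = fickMain n p` and `E =
fickRest n` are the same for all cycles. Since `c_m = c_0 p^(2m)`, the product of the first `m`
matrices is, up to a positive scalar, a product `P_m` of factors `B + ε_i E` with `ε_i` decaying
like `p^(-2i)`. The identity `B (B - 1) (B - p) = 0` bounds the powers of `B`, and then `P_m` as
well, by a constant times `p^m`, so the perturbations are summable. Hence for an eigenvector `w` of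
`B` with eigenvalue `l` equal to `1` or `p` the vectors `l^(-m) P_m w` converge, to a limit close to
`w` if `c_0` is large (`exists_tendsto_perturbedProd_eigenvector`). There are `⌊n/2⌋` independent
eigenvectors, and independence is an open condition. Every column of the product is asymptotic to
one of these limits (`exists_tendsto_perturbedProd_fick`).

Consequently the cone `fickCone` of the vectors that stay nonnegative under all inductions is
simplicial, with the `v_j` on its extreme rays (`exists_eq_sum_of_mem_fickCone`,
`eq_of_add_eq_limit`).

Invariant probability measures correspond to the probability vectors `u` of this cone. The
distribution function `F` of such a measure is monotone and conjugates the exchange with lengths `α`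
to the one with lengths `u`, the measures of the intervals. Rauzy induction, run on `α` and `u`
together, restricts `F` to shorter intervals; as `F` is monotone, `u` stays nonnegative. Conversely
`F` on the whole interval is rebuilt from its restriction by translations, and the restriction is
known up to the remaining sum of `u`, which at least halves in each cycle
(`two_mul_sum_le_sum_fickAct`). This gives uniqueness of `F` (`isConj_unique`) and its existence as
a uniform limit of extended piecewise linear functions (`exists_isConj`).

For ergodicity, an invariant set of intermediate measure would write `v_j` as a sum of two vectors
of the cone. Extremality makes them proportional to `v_j`, and uniqueness makes the conditional
measure equal to the whole measure, a contradiction. -/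

theorem insertAfter_append {n : ℕ} {w l : Fin n} {A D : List (Fin n)} (h : w ∉ A) :
    insertAfter w l (A ++ w :: D) = A ++ w :: l :: D := by
  induction A with
  | nil => simp [insertAfter]
  | cons x A ih =>
    simp only [List.mem_cons, not_or] at h
    simp [insertAfter, Ne.symm h.1, ih h.2]

/-! ### Rauzy paths: tables, lengths and matrices along a path. -/

namespace RauzyTable

/-- Along the path the winner and the loser exist and are different. -/
def GoodPath {n : ℕ} : List Bool → RauzyTable n → Prop
  | [], _ => True
  | t :: ts, π => (∃ w l, π.winner t = some w ∧ π.loser t = some l ∧ w ≠ l) ∧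
      GoodPath ts (π.move t)

/-- The table at the end of a path. -/
def tableAfter {n : ℕ} : List Bool → RauzyTable n → RauzyTable n
  | [], π => π
  | t :: ts, π => tableAfter ts (π.move t)

/-- The lengths at the end of a path. -/
noncomputable def lengthsAfter {n : ℕ} : List Bool → RauzyTable n → (Fin n → ℝ) → (Fin n → ℝ)
  | [], _, ℓ => ℓ
  | t :: ts, π, ℓ => lengthsAfter ts (π.move t) (π.newLengths t ℓ)

variable {n : ℕ}

theorem goodPath_append (xs ys : List Bool) (π : RauzyTable n) :
    GoodPath (xs ++ ys) π ↔ GoodPath xs π ∧ GoodPath ys (tableAfter xs π) := by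
  induction xs generalizing π with
  | nil => simp [GoodPath, tableAfter]
  | cons t xs ih => simp [GoodPath, tableAfter, ih, and_assoc]

theorem tableAfter_append (xs ys : List Bool) (π : RauzyTable n) :
    tableAfter (xs ++ ys) π = tableAfter ys (tableAfter xs π) := by
  induction xs generalizing π with
  | nil => simp [tableAfter]
  | cons t xs ih => simp [tableAfter, ih]

theorem lengthsAfter_append (xs ys : List Bool) (π : RauzyTable n) (ℓ : Fin n → ℝ) :
    lengthsAfter (xs ++ ys) π ℓ = lengthsAfter ys (tableAfter xs π) (lengthsAfter xs π ℓ) := by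
  induction xs generalizing π ℓ with
  | nil => simp [tableAfter, lengthsAfter]
  | cons t xs ih => simp [tableAfter, lengthsAfter, ih]

theorem pathMatrix_append (xs ys : List Bool) (π : RauzyTable n) :
    pathMatrix (xs ++ ys) π = pathMatrix xs π * pathMatrix ys (tableAfter xs π) := by
  induction xs generalizing π with
  | nil => simp [tableAfter, pathMatrix]
  | cons t xs ih => simp [tableAfter, pathMatrix, ih, mul_assoc]

theorem follows_append (xs ys : List Bool) (π : RauzyTable n) (ℓ : Fin n → ℝ) :
    Follows (xs ++ ys) π ℓ ↔
      Follows xs π ℓ ∧ Follows ys (tableAfter xs π) (lengthsAfter xs π ℓ) := by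
  induction xs generalizing π ℓ with
  | nil => simp [tableAfter, lengthsAfter, Follows]
  | cons t xs ih => simp [tableAfter, lengthsAfter, Follows, ih, and_assoc]

theorem moveMatrix_mulVec {t : Bool} {π : RauzyTable n} {w l : Fin n} (hw : π.winner t = some w)
    (hl : π.loser t = some l) (x : Fin n → ℝ) :
    (π.moveMatrix t).mulVec x = Function.update x w (x w + x l) := by
  ext i
  simp only [moveMatrix, hw, hl, Matrix.add_mulVec, Matrix.one_mulVec, Pi.add_apply,
    Matrix.single_mulVec]
  by_cases h : i = w
  · subst h; simp
  · simp [h, Function.update]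

theorem newLengths_eq {t : Bool} {π : RauzyTable n} {w l : Fin n} (hw : π.winner t = some w)
    (hl : π.loser t = some l) (x : Fin n → ℝ) :
    π.newLengths t x = Function.update x w (x w - x l) := by
  simp [newLengths, hw, hl]

theorem newLengths_moveMatrix_mulVec {t : Bool} {π : RauzyTable n} {w l : Fin n}
    (hw : π.winner t = some w) (hl : π.loser t = some l) (hwl : w ≠ l) (x : Fin n → ℝ) :
    π.newLengths t ((π.moveMatrix t).mulVec x) = x := by
  rw [moveMatrix_mulVec hw hl, newLengths_eq hw hl]
  ext i
  by_cases h : i = w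
  · subst h; simp [Ne.symm hwl]
  · simp [h]

theorem moveMatrix_mulVec_newLengths {t : Bool} {π : RauzyTable n} {w l : Fin n}
    (hw : π.winner t = some w) (hl : π.loser t = some l) (hwl : w ≠ l) (x : Fin n → ℝ) :
    (π.moveMatrix t).mulVec (π.newLengths t x) = x := by
  rw [moveMatrix_mulVec hw hl, newLengths_eq hw hl]
  ext i
  by_cases h : i = w
  · subst h; simp [Ne.symm hwl]
  · simp [h]

/-- Each move subtracts exactly what its elementary matrix adds, because winner and loser differ. So
the induction and the matrix are inverse to each other on all real vectors; signs matter only in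
`Follows`. -/
theorem GoodPath.lengthsAfter_mulVec {ts : List Bool} {π : RauzyTable n} (h : GoodPath ts π)
    (x : Fin n → ℝ) : lengthsAfter ts π ((pathMatrix ts π).mulVec x) = x := by
  induction ts generalizing π x with
  | nil => simp [lengthsAfter, pathMatrix]
  | cons t ts ih =>
    obtain ⟨⟨w, l, hw, hl, hwl⟩, h⟩ := h
    simp only [lengthsAfter, pathMatrix, ← Matrix.mulVec_mulVec]
    rw [newLengths_moveMatrix_mulVec hw hl hwl, ih h]

theorem GoodPath.mulVec_lengthsAfter {ts : List Bool} {π : RauzyTable n} (h : GoodPath ts π)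
    (x : Fin n → ℝ) : (pathMatrix ts π).mulVec (lengthsAfter ts π x) = x := by
  induction ts generalizing π x with
  | nil => simp [lengthsAfter, pathMatrix]
  | cons t ts ih =>
    obtain ⟨⟨w, l, hw, hl, hwl⟩, h⟩ := h
    simp only [lengthsAfter, pathMatrix, ← Matrix.mulVec_mulVec]
    rw [ih h, moveMatrix_mulVec_newLengths hw hl hwl]

theorem Follows.lengthsAfter_pos {ts : List Bool} {π : RauzyTable n} {ℓ : Fin n → ℝ}
    (h : Follows ts π ℓ) (hℓ : ∀ i, 0 < ℓ i) : ∀ i, 0 < lengthsAfter ts π ℓ i := by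
  induction ts generalizing π ℓ with
  | nil => exact hℓ
  | cons t ts ih =>
    obtain ⟨⟨w, l, hw, hl, hlt⟩, h⟩ := h
    refine ih h fun i => ?_
    rw [newLengths_eq hw hl]
    by_cases e : i = w
    · subst e; simpa using hlt
    · simpa [e] using hℓ i

theorem pathMatrix_mulVec_nonneg (ts : List Bool) (π : RauzyTable n) {x : Fin n → ℝ}
    (hx : ∀ i, 0 ≤ x i) : ∀ i, 0 ≤ (pathMatrix ts π).mulVec x i := by
  induction ts generalizing π with
  | nil => simpa [pathMatrix] using hx
  | cons t ts ih =>
    simp only [pathMatrix, ← Matrix.mulVec_mulVec]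
    have h1 := ih (π.move t)
    set y := (pathMatrix ts (π.move t)).mulVec x
    intro i
    unfold moveMatrix
    split
    · rename_i w l hw hl
      simp only [Matrix.add_mulVec, Matrix.one_mulVec, Pi.add_apply, Matrix.single_mulVec]
      refine add_nonneg (h1 i) ?_
      by_cases e : i = w
      · subst e; simpa using h1 l
      · simp [e]
    · simpa using h1 i

theorem GoodPath.follows_mulVec {ts : List Bool} {π : RauzyTable n} (h : GoodPath ts π)
    {x : Fin n → ℝ} (hx : ∀ i, 0 < x i) :
    Follows ts π ((pathMatrix ts π).mulVec x) ∧ ∀ i, 0 < (pathMatrix ts π).mulVec x i := by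
  induction ts generalizing π with
  | nil => simpa [pathMatrix, Follows] using hx
  | cons t ts ih =>
    obtain ⟨⟨w, l, hw, hl, hwl⟩, h⟩ := h
    simp only [pathMatrix, ← Matrix.mulVec_mulVec, Follows]
    obtain ⟨h1, h2⟩ := ih h
    rw [newLengths_moveMatrix_mulVec hw hl hwl]
    refine ⟨⟨⟨w, l, hw, hl, ?_⟩, h1⟩, fun i => ?_⟩
    -- The old winner has length `x w + x l` for the new lengths `x`, so it beats the loser as soon
    -- as `x w` is positive.
    · rw [moveMatrix_mulVec hw hl]; simp [Ne.symm hwl, h2 w]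
    · rw [moveMatrix_mulVec hw hl]
      by_cases e : i = w
      · subst e; simpa using add_pos (h2 i) (h2 l)
      · simpa [e] using h2 i

/-- The path `ts` leads from `π` to `π'`, and its matrix acts by `f`. -/
def Leads (ts : List Bool) (π π' : RauzyTable n) (f : (Fin n → ℝ) → (Fin n → ℝ)) : Prop :=
  GoodPath ts π ∧ tableAfter ts π = π' ∧ ∀ x, (pathMatrix ts π).mulVec x = f x

theorem Leads.nil (π : RauzyTable n) : Leads [] π π id :=
  ⟨trivial, rfl, fun x => by simp [pathMatrix]⟩

theorem Leads.append {xs ys : List Bool} {π π' π'' : RauzyTable n} {f g : (Fin n → ℝ) → (Fin n → ℝ)}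
    (h : Leads xs π π' f) (h' : Leads ys π' π'' g) : Leads (xs ++ ys) π π'' (f ∘ g) := by
  obtain ⟨h1, rfl, h3⟩ := h
  obtain ⟨h4, rfl, h6⟩ := h'
  refine ⟨(goodPath_append ..).2 ⟨h1, h4⟩, tableAfter_append .., fun x => ?_⟩
  rw [pathMatrix_append, ← Matrix.mulVec_mulVec, h6, h3]; rfl

theorem Leads.congr {ts : List Bool} {π π' : RauzyTable n} {f g : (Fin n → ℝ) → (Fin n → ℝ)}
    (h : Leads ts π π' f) (e : ∀ x, f x = g x) : Leads ts π π' g :=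
  ⟨h.1, h.2.1, fun x => (h.2.2 x).trans (e x)⟩

/-- The rows are split so that both letters are visible; `w ∉ B₁` guarantees that `insertAfter` acts
at the displayed occurrence of `w`. -/
theorem leads_false {T B₁ B₂ : List (Fin n)} {w l : Fin n} (hw : w ∉ B₁) (hwl : w ≠ l) :
    Leads [false] ⟨T ++ [w], B₁ ++ w :: (B₂ ++ [l])⟩ ⟨T ++ [w], B₁ ++ w :: l :: B₂⟩
      (fun x => Function.update x w (x w + x l)) := by
  have h1 : winner false ⟨T ++ [w], B₁ ++ w :: (B₂ ++ [l])⟩ = some w := by simp [winner]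
  have e : B₁ ++ w :: (B₂ ++ [l]) = (B₁ ++ w :: B₂) ++ [l] := by simp
  have h2 : loser false ⟨T ++ [w], B₁ ++ w :: (B₂ ++ [l])⟩ = some l := by
    change List.getLast? _ = _
    rw [e, List.getLast?_concat]
  refine ⟨⟨⟨w, l, h1, h2, hwl⟩, trivial⟩, ?_, fun x => ?_⟩
  · simp only [tableAfter, move, h1, h2]
    simp only [e, List.dropLast_concat]
    simp [insertAfter_append hw]
  · simp only [pathMatrix, mul_one]
    exact moveMatrix_mulVec h1 h2 x

theorem leads_true {T₁ T₂ B : List (Fin n)} {w l : Fin n} (hw : w ∉ T₁) (hwl : w ≠ l) :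
    Leads [true] ⟨T₁ ++ w :: (T₂ ++ [l]), B ++ [w]⟩ ⟨T₁ ++ w :: l :: T₂, B ++ [w]⟩
      (fun x => Function.update x w (x w + x l)) := by
  have h1 : winner true ⟨T₁ ++ w :: (T₂ ++ [l]), B ++ [w]⟩ = some w := by simp [winner]
  have e : T₁ ++ w :: (T₂ ++ [l]) = (T₁ ++ w :: T₂) ++ [l] := by simp
  have h2 : loser true ⟨T₁ ++ w :: (T₂ ++ [l]), B ++ [w]⟩ = some l := by
    change List.getLast? _ = _
    rw [e, List.getLast?_concat]
  refine ⟨⟨⟨w, l, h1, h2, hwl⟩, trivial⟩, ?_, fun x => ?_⟩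
  · simp only [tableAfter, move, h1, h2]
    simp only [e, List.dropLast_concat]
    simp [insertAfter_append hw]
  · simp only [pathMatrix, mul_one]
    exact moveMatrix_mulVec h1 h2 x

/-- Each move carries the last top letter to the place right after `w`. Repeating it `D₂.length`
times rotates `D₂` past `D₁`, while `w` collects the lengths of `D₂`. -/
theorem leads_replicate_true {T D₁ D₂ B : List (Fin n)} {w : Fin n} (hw : w ∉ T)
    (h₂ : w ∉ D₂) :
    Leads (List.replicate D₂.length true) ⟨T ++ w :: (D₁ ++ D₂), B ++ [w]⟩
      ⟨T ++ w :: (D₂ ++ D₁), B ++ [w]⟩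
      (fun x => Function.update x w (x w + (D₂.map x).sum)) := by
  induction D₂ using List.reverseRecOn generalizing D₁ with
  | nil => simpa using (Leads.nil _).congr (fun x => by simp)
  | append_singleton D d ih =>
    simp only [List.mem_append, List.mem_singleton, not_or] at h₂
    have h1 := leads_true (T₁ := T) (T₂ := D₁ ++ D) (B := B) hw h₂.2
    have h2 := ih (D₁ := d :: D₁) h₂.1
    have h3 := h1.append h2
    simp only [List.length_append, List.length_singleton, Nat.add_comm D.length 1,
      List.replicate_add]
    simp only [List.append_assoc, List.cons_append, List.nil_append] at h3 ⊢
    refine h3.congr fun x => ?_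
    have hd : (d : Fin n) ≠ w := Ne.symm h₂.2
    ext i
    by_cases e : i = w
    · subst e; simp [hd]; ring
    · simp [e]

/-- `D.length` moves are a full rotation, so the table returns to itself. With the first letter as
`w` this is the final `1^{c(n-1)}` of the cycle. -/
theorem leads_replicate_mul_true {T D B : List (Fin n)} {w : Fin n} (hw : w ∉ T) (hD : w ∉ D)
    (c : ℕ) :
    Leads (List.replicate (c * D.length) true) ⟨T ++ w :: D, B ++ [w]⟩
      ⟨T ++ w :: D, B ++ [w]⟩
      (fun x => Function.update x w (x w + c * (D.map x).sum)) := by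
  induction c with
  | zero => simpa using (Leads.nil _).congr (fun x => by simp)
  | succ c ih =>
    have h := leads_replicate_true (T := T) (D₁ := []) (D₂ := D) (B := B) hw hD
    simp only [List.nil_append, List.append_nil] at h
    rw [Nat.add_mul, one_mul, List.replicate_add]
    refine (ih.append h).congr fun x => ?_
    have hm : D.map (Function.update x w (x w + (D.map x).sum)) = D.map x := by
      apply List.map_congr_left
      intro d hd
      rw [Function.update_of_ne]
      rintro rfl; exact hD hd
    ext i
    by_cases e : i = w
    · subst e; simp [hm]; ring
    · simp [e]

/-- The loser already stands right after the winner, so the table is fixed and the move can be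
repeated. -/
theorem leads_replicate_false {T B : List (Fin n)} {w l : Fin n} (hw : w ∉ B) (hwl : w ≠ l)
    (a : ℕ) :
    Leads (List.replicate a false) ⟨T ++ [w], B ++ [w, l]⟩ ⟨T ++ [w], B ++ [w, l]⟩
      (fun x => Function.update x w (x w + a * x l)) := by
  induction a with
  | zero => simpa using (Leads.nil _).congr (fun x => by simp)
  | succ a ih =>
    have h := leads_false (T := T) (B₁ := B) (B₂ := []) hw hwl
    simp only [List.nil_append] at h
    rw [List.replicate_add]
    refine (ih.append h).congr fun x => ?_
    ext i
    by_cases e : i = w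
    · subst e; simp [hwl.symm]; ring
    · simp [e]

end RauzyTable

/-! ### The matrix of Fickenscher's cycle. -/

namespace RauzyTable
variable {n : ℕ}

/-- The stages of the block: `j` beats all that is to the right of `k` on top, which leaves `k` last
on top and `k, j` last at the bottom; `k` beats `j` `a` times without changing the table; `j` beats
`k`, which restores the top row; the last letter `z` beats `j` and then `k`, which brings the pair
`k, j` right behind `z`. -/
theorem leads_fickBlock {A D Q : List (Fin n)} {j k z : Fin n} {m a : ℕ}
    (hnd : (A ++ j :: k :: (D ++ [z])).Nodup) (hQ : ∀ q ∈ Q, q ≠ z ∧ q ≠ k ∧ q ≠ j)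
    (hm : n - 1 - m = D.length + 1) :
    Leads (fickBlock n a m) ⟨A ++ j :: k :: (D ++ [z]), z :: (Q ++ [k, j])⟩
      ⟨A ++ j :: k :: (D ++ [z]), z :: k :: j :: Q⟩
      (fun x => Function.update (Function.update (Function.update x k (x k + a * (x j + x k))) j
        (x j + x k + ((D.map x).sum + (x z + x k + x j)))) z (x z + x k + x j)) := by
  simp only [List.nodup_append, List.nodup_cons, List.mem_cons, List.mem_append, List.not_mem_nil, or_false, not_false_eq_true,
    not_or] at hnd
  obtain ⟨hA, ⟨⟨hjk, hjD, hjz⟩, ⟨hkD, hkz⟩, hD, -, hDz⟩, hAd⟩ := hnd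
  have hjA : j ∉ A := fun h => (hAd j h j (Or.inl rfl)) rfl
  have hkA : k ∉ A := fun h => (hAd k h k (Or.inr (Or.inl rfl))) rfl
  have hzD : z ∉ D := fun h => hDz z h z rfl rfl
  have hjQ : j ∉ Q := fun h => (hQ j h).2.2 rfl
  have hkQ : k ∉ Q := fun h => (hQ k h).2.1 rfl
  have l1 := leads_replicate_true (T := A) (D₁ := [k]) (D₂ := D ++ [z]) (B := z :: (Q ++ [k]))
    (w := j) hjA (by simp [hjD, hjz])
  have l2 := leads_replicate_false (T := A ++ j :: (D ++ [z])) (B := z :: Q) (w := k) (l := j)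
    (by simp [hkQ, hkz]) (Ne.symm hjk) a
  have l3 := leads_true (T₁ := A) (T₂ := D ++ [z]) (B := z :: (Q ++ [k])) (w := j) (l := k) hjA hjk
  have l4 := leads_false (T := A ++ j :: k :: D) (B₁ := []) (B₂ := Q ++ [k]) (w := z) (l := j)
    (by simp) (Ne.symm hjz)
  have l5 := leads_false (T := A ++ j :: k :: D) (B₁ := []) (B₂ := j :: Q) (w := z) (l := k)
    (by simp) (Ne.symm hkz)
  have hlen : n - 1 - m = (D ++ [z]).length := by simpa using hm
  simp only [List.append_assoc, List.cons_append, List.nil_append] at l1 l2 l3 l4 l5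
  have l := (((l1.append l2).append l3).append l4).append l5
  have e : fickBlock n a m = (((List.replicate (D ++ [z]).length true ++ List.replicate a false) ++
      [true]) ++ [false]) ++ [false] := by
    simp [fickBlock, hlen]
  rw [e]
  refine l.congr fun x => ?_
  have hmap : ∀ (y : Fin n → ℝ), (∀ d, d ≠ j → d ≠ k → d ≠ z → y d = x d) →
      D.map y = D.map x := by
    intro y hy
    apply List.map_congr_left
    intro d hd
    apply hy <;> rintro rfl <;> contradiction
  have hzk := Ne.symm hkz
  have hzj := Ne.symm hjz
  have hkj := Ne.symm hjk
  simp only [Function.comp]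
  rw [List.map_append, List.sum_append, hmap]
  · ext i
    by_cases ez : i = z
    · subst ez; simp [hzk, hzj, hjz, hkz]
    by_cases ej : i = j
    · subst ej; simp [hjk, hjz, hkz, hkj, hzk, hzj]
    by_cases ek : i = k
    · subst ek; simp [hjk, hjz, hkz, hkj, hzk, hzj]
    · simp [ez, ej, ek]
  · intro d h1 h2 h3
    simp [h1, h2, h3]

end RauzyTable

/-- The pairs `(2i+2, 2i+1), (2i+4, 2i+3), …` (`j` of them), flattened. -/
def pairSeg (n : ℕ) [NeZero n] (i j : ℕ) : List (Fin n) :=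
  (List.range' i j).flatMap fun t => [Fin.ofNat n (2 * t + 2), Fin.ofNat n (2 * t + 1)]

/-- The letter without a partner, for odd `n`. -/
def oddLetter (n : ℕ) [NeZero n] : List (Fin n) :=
  if n % 2 = 0 then [] else [Fin.ofNat n (n - 2)]

theorem pairSeg_succ_right (n : ℕ) [NeZero n] (i j : ℕ) : pairSeg n i (j + 1) = pairSeg n i j ++
    [Fin.ofNat n (2 * (i + j) + 2), Fin.ofNat n (2 * (i + j) + 1)] := by
  simp [pairSeg, List.range'_concat]

theorem pairSeg_succ_left (n : ℕ) [NeZero n] (i j : ℕ) : pairSeg n i (j + 1) =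
    Fin.ofNat n (2 * i + 2) :: Fin.ofNat n (2 * i + 1) :: pairSeg n (i + 1) j := by
  simp [pairSeg, List.range'_succ]

theorem map_fickPerm_range' (n : ℕ) [NeZero n] (j : ℕ) (hj : 2 * j + 2 ≤ n) :
    (List.range' 1 (2 * j)).map (fun t => Fin.ofNat n (pairSwapVal n t)) = pairSeg n 0 j := by
  induction j with
  | zero => simp [pairSeg]
  | succ j ih =>
    rw [pairSeg_succ_right, ← ih (by omega), show 2 * (j + 1) = 2 * j + 1 + 1 by ring,
      List.range'_concat, List.range'_concat]
    simp only [List.map_append, List.map_cons, List.map_nil, List.append_assoc, List.cons_append,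
      List.nil_append, List.append_cancel_left_eq]
    have h1 : pairSwapVal n (1 + 1 * (2 * j)) = 2 * (0 + j) + 2 := by
      unfold pairSwapVal; split_ifs <;> omega
    have h2 : pairSwapVal n (1 + 1 * (2 * j + 1)) = 2 * (0 + j) + 1 := by
      rw [show 1 + 1 * (2 * j + 1) = 2 * j + 2 by ring]
      unfold pairSwapVal; split_ifs <;> first | contradiction | omega
    rw [h1, h2]

theorem fickPerm_bot (n : ℕ) [NeZero n] (hn : 4 ≤ n) :
    (RauzyTable.ofPerm (fickPerm n)).bot =
      Fin.ofNat n (n - 1) :: (pairSeg n 0 (n / 2 - 1) ++ oddLetter n ++ [Fin.ofNat n 0]) := by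
  have h0 : (RauzyTable.ofPerm (fickPerm n)).bot =
      (List.range n).map (fun t => Fin.ofNat n (pairSwapVal n t)) := by
    apply List.ext_getElem
    · simp [RauzyTable.ofPerm]
    · intro i h1 h2
      simp only [List.length_map, List.length_range] at h2
      simp [RauzyTable.ofPerm, fickPerm, Function.Involutive.toPerm, Fin.ext_iff,
        Nat.mod_eq_of_lt (pairSwapVal_lt h2)]
  have h1 : List.range n = 0 :: (List.range' 1 (2 * (n / 2 - 1)) ++
      ((if n % 2 = 0 then [] else [n - 2]) ++ [n - 1])) := by
    have e : List.range n = List.range' 0 (1 + (2 * (n / 2 - 1) + ((n % 2) + 1))) := by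
      rw [List.range_eq_range']; congr 1; omega
    rw [e, ← List.range'_append, ← List.range'_append, ← List.range'_append]
    rcases Nat.mod_two_eq_zero_or_one n with h | h
    · simp [h]; omega
    · simp [h]; omega
  rw [h0, h1, List.map_cons, List.map_append, List.map_append, map_fickPerm_range' n _ (by omega)]
  have e1 : pairSwapVal n 0 = n - 1 := by simp [pairSwapVal]
  have e2 : pairSwapVal n (n - 1) = 0 := by unfold pairSwapVal; split_ifs <;> omega
  rcases Nat.mod_two_eq_zero_or_one n with h | h
  · simp [h, oddLetter, e1, e2]
  · have e3 : pairSwapVal n (n - 2) = n - 2 := by unfold pairSwapVal; split_ifs <;> omega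
    simp [h, oddLetter, e1, e2, e3]

/-- The sum of the entries of `x` other than the first one. -/
noncomputable def tailSum {n : ℕ} [NeZero n] (x : Fin n → ℝ) : ℝ :=
  ∑ t ∈ Finset.Ico 1 n, x (Fin.ofNat n t)

/-- The action of the matrix of the end of Fickenscher's cycle, from the last `i` blocks on. -/
noncomputable def fickEndAct {n : ℕ} [NeZero n] (c a : ℝ) (i : ℕ) (x : Fin n → ℝ) (j : Fin n) : ℝ :=
  if j.val = 0 then x 0 + c * tailSum x
  else if j.val = n - 1 then x j + ∑ t ∈ Finset.Ico 1 (2 * i + 1), x (Fin.ofNat n t)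
  else if j.val ≤ 2 * i then
    if j.val % 2 = 1 then tailSum x + x j + x (Fin.ofNat n (j.val + 1))
    else a * x (Fin.ofNat n (j.val - 1)) + (a + 1) * x j
  else x j

/-- The action of the matrix of Fickenscher's cycle. -/
noncomputable def fickAct {n : ℕ} [NeZero n] (c a : ℝ) (x : Fin n → ℝ) (j : Fin n) : ℝ :=
  if j.val = 0 then x 0 + c * tailSum x
  else if j.val = n - 1 then x 0 + (c + 1) * tailSum x
  else if j.val % 2 = 1 then
    tailSum x + x j + if j.val + 1 < n - 1 then x (Fin.ofNat n (j.val + 1)) else 0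
  else a * x (Fin.ofNat n (j.val - 1)) + (a + 1) * x j

theorem sum_map_range' {M : Type*} [AddCommMonoid M] (f : ℕ → M) (s l : ℕ) :
    ((List.range' s l).map f).sum = ∑ t ∈ Finset.Ico s (s + l), f t := by
  induction l with
  | zero => simp
  | succ l ih =>
    rw [List.range'_concat, List.map_append, List.sum_append, ih, ← Nat.add_assoc,
      Finset.sum_Ico_succ_top (by omega)]
    simp

theorem finRange_eq_map_ofNat (n : ℕ) [NeZero n] :
    List.finRange n = (List.range' 0 n).map (Fin.ofNat n) := by
  apply List.ext_getElem
  · simp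
  · intro i h1 h2
    simp only [List.length_finRange] at h1
    simp [Fin.ext_iff, Nat.mod_eq_of_lt h1]

theorem ofNat_ne {n : ℕ} [NeZero n] {i j : ℕ} (hi : i < n) (hj : j < n) (h : i ≠ j) :
    Fin.ofNat n i ≠ Fin.ofNat n j := by
  simpa [Fin.ext_iff, Nat.mod_eq_of_lt hi, Nat.mod_eq_of_lt hj] using h

theorem mem_pairSeg {n : ℕ} [NeZero n] {i j : ℕ} {q : Fin n} (hn : 2 * (i + j) < n)
    (h : q ∈ pairSeg n i j) : 2 * i < q.val ∧ q.val ≤ 2 * (i + j) := by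
  simp only [pairSeg, List.mem_flatMap, List.mem_range'_1, List.mem_cons, List.not_mem_nil,
    or_false] at h
  obtain ⟨t, ⟨h1, h2⟩, rfl | rfl⟩ := h
  · simp only [Fin.val_ofNat]; rw [Nat.mod_eq_of_lt (by omega)]; omega
  · simp only [Fin.val_ofNat]; rw [Nat.mod_eq_of_lt (by omega)]; omega

theorem mem_oddLetter {n : ℕ} [NeZero n] {q : Fin n} (hn : 2 ≤ n)
    (h : q ∈ oddLetter n) : n % 2 = 1 ∧ q.val = n - 2 := by
  unfold oddLetter at h
  split_ifs at h with h'
  · simp at h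
  · simp only [List.mem_singleton] at h
    subst h
    exact ⟨by omega, by simp only [Fin.val_ofNat]; rw [Nat.mod_eq_of_lt (by omega)]⟩

/-- The tables between the blocks of Fickenscher's cycle. -/
def fickTable (n : ℕ) [NeZero n] (i : ℕ) : RauzyTable n :=
  ⟨List.finRange n, Fin.ofNat n (n - 1) :: (pairSeg n i (n / 2 - 1 - i) ++ oddLetter n ++
    Fin.ofNat n 0 :: pairSeg n 0 i)⟩

theorem fickTable_zero (n : ℕ) [NeZero n] (hn : 4 ≤ n) :
    fickTable n 0 = RauzyTable.ofPerm (fickPerm n) := by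
  have h := fickPerm_bot n hn
  have e : RauzyTable.ofPerm (fickPerm n) =
    ⟨List.finRange n, (RauzyTable.ofPerm (fickPerm n)).bot⟩ := rfl
  rw [e, h]
  simp [fickTable, pairSeg]

namespace RauzyTable

theorem leads_fickEnd_zero (n : ℕ) [NeZero n] (hn : 4 ≤ n) (c : ℕ) (a : ℝ) :
    Leads (List.replicate (c * (n - 1)) true) (fickTable n 0) (fickTable n 0)
      (fickEndAct c a 0) := by
  have h := leads_replicate_mul_true (T := []) (D := (List.range' 1 (n - 1)).map (Fin.ofNat n))
    (B := Fin.ofNat n (n - 1) :: (pairSeg n 0 (n / 2 - 1) ++ oddLetter n)) (w := Fin.ofNat n 0)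
    (by simp) (by
      simp only [List.mem_map, List.mem_range'_1, not_exists, not_and]
      intro t ht
      exact ofNat_ne (by omega) (by omega) (by omega)) c
  have e : (List.finRange n) = Fin.ofNat n 0 :: (List.range' 1 (n - 1)).map (Fin.ofNat n) := by
    have e0 : List.range' 0 n = 0 :: List.range' 1 (n - 1) :=
      (show List.range' 0 n = List.range' 0 ((n - 1) + 1) by congr 1; omega).trans
        (by rw [List.range'_succ])
    rw [finRange_eq_map_ofNat, e0, List.map_cons]
  simp only [List.nil_append, ← e, List.length_map, List.length_range'] at h
  have e2 : (⟨List.finRange n, Fin.ofNat n (n - 1) :: (pairSeg n 0 (n / 2 - 1) ++ oddLetter n) ++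
      [Fin.ofNat n 0]⟩ : RauzyTable n) = fickTable n 0 := by
    simp [fickTable, pairSeg]
  rw [e2] at h
  refine h.congr fun x => ?_
  ext j
  rw [List.map_map, sum_map_range', show 1 + (n - 1) = n by omega]
  by_cases hj : j.val = 0
  · have : j = Fin.ofNat n 0 := by ext; simpa using hj
    subst this
    simp [fickEndAct, tailSum]
  · have : j ≠ Fin.ofNat n 0 := by intro h; apply hj; simp [h]
    rw [Function.update_of_ne this]
    simp [fickEndAct, hj]

/-- A block put in front of the remaining path acts after it on vectors. One action `f` serves all
`c`: the parameter `c` occurs only in the entry of index `0`, which the block neither reads nor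
changes. -/
theorem leads_fickEnd_block (n : ℕ) [NeZero n] (hn : 4 ≤ n) (i : ℕ) (hi : i + 1 ≤ n / 2 - 1)
    (a : ℕ) : ∃ f, Leads (fickBlock n a (2 * (i + 1))) (fickTable n (i + 1)) (fickTable n i) f ∧
      ∀ (c : ℝ) x, f (fickEndAct c a i x) = fickEndAct c a (i + 1) x := by
  have htop : List.finRange n = (List.range' 0 (2 * i + 1)).map (Fin.ofNat n) ++
      Fin.ofNat n (2 * i + 1) :: Fin.ofNat n (2 * i + 2) ::
      ((List.range' (2 * i + 3) (n - 1 - (2 * i + 3))).map (Fin.ofNat n) ++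
        [Fin.ofNat n (n - 1)]) := by
    have e0 : List.range' 0 n = List.range' 0 (2 * i + 1) ++ ([2 * i + 1, 2 * i + 2] ++
        (List.range' (2 * i + 3) (n - 1 - (2 * i + 3)) ++ [n - 1])) :=
      (show List.range' 0 n = List.range' 0 ((2 * i + 1) + (2 + ((n - 1 - (2 * i + 3)) + 1))) by
        congr 1; omega).trans (by
        rw [← List.range'_append (m := 2 * i + 1), ← List.range'_append (m := 2),
          ← List.range'_append (m := n - 1 - (2 * i + 3))]
        simp only [Nat.zero_add, Nat.one_mul]
        rw [show 2 * i + 1 + 2 + (n - 1 - (2 * i + 3)) = n - 1 by omega]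
        rfl)
    rw [finRange_eq_map_ofNat, e0]
    simp only [List.map_append, List.map_cons, List.map_nil, List.cons_append, List.nil_append]
  have hnd := htop ▸ List.nodup_finRange n
  have hv : ∀ t < n, (Fin.ofNat n t).val = t := fun t ht => by simp [Nat.mod_eq_of_lt ht]
  have h := leads_fickBlock (a := a) (m := 2 * (i + 1)) hnd
    (Q := pairSeg n (i + 1) (n / 2 - 1 - (i + 1)) ++ oddLetter n ++ Fin.ofNat n 0 :: pairSeg n 0 i)
    (by
      intro q hq
      simp only [ne_eq, Fin.ext_iff, hv _ (show n - 1 < n by omega),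
        hv _ (show 2 * i + 1 < n by omega), hv _ (show 2 * i + 2 < n by omega)]
      simp only [List.mem_append, List.mem_cons] at hq
      rcases hq with (hq | hq) | rfl | hq
      · have := mem_pairSeg (by omega) hq; omega
      · have := mem_oddLetter (by omega) hq; omega
      · simp only [hv 0 (by omega)]; omega
      · have := mem_pairSeg (by omega) hq; omega)
    (by simp; omega)
  rw [← htop] at h
  have e1 : (⟨List.finRange n, Fin.ofNat n (n - 1) :: ((pairSeg n (i + 1) (n / 2 - 1 - (i + 1)) ++
      oddLetter n ++ Fin.ofNat n 0 :: pairSeg n 0 i) ++ [Fin.ofNat n (2 * i + 2),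
      Fin.ofNat n (2 * i + 1)])⟩ : RauzyTable n) = fickTable n (i + 1) := by
    simp [fickTable, pairSeg_succ_right]
  have e2 : (⟨List.finRange n, Fin.ofNat n (n - 1) :: Fin.ofNat n (2 * i + 2) ::
      Fin.ofNat n (2 * i + 1) :: (pairSeg n (i + 1) (n / 2 - 1 - (i + 1)) ++
      oddLetter n ++ Fin.ofNat n 0 :: pairSeg n 0 i)⟩ : RauzyTable n) = fickTable n i := by
    rw [fickTable, show n / 2 - 1 - i = n / 2 - 1 - (i + 1) + 1 by omega, pairSeg_succ_left]
    simp
  rw [e1, e2] at h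
  refine ⟨_, h, fun c x => ?_⟩
  set X : ℕ → ℝ := fun t => x (Fin.ofNat n t) with hX
  have hj : fickEndAct c a i x (Fin.ofNat n (2 * i + 1)) = X (2 * i + 1) := by
    unfold fickEndAct
    simp only [hv _ (show 2 * i + 1 < n by omega)]
    split_ifs <;> first | contradiction | omega | rfl
  have hk : fickEndAct c a i x (Fin.ofNat n (2 * i + 2)) = X (2 * i + 2) := by
    unfold fickEndAct
    simp only [hv _ (show 2 * i + 2 < n by omega)]
    split_ifs <;> first | contradiction | omega | rfl
  have hz : fickEndAct c a i x (Fin.ofNat n (n - 1)) = X (n - 1) +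
      ∑ t ∈ Finset.Ico 1 (2 * i + 1), X t := by
    unfold fickEndAct
    simp only [hv _ (show n - 1 < n by omega)]
    split_ifs <;> first | contradiction | omega | rfl
  have hD : (((List.range' (2 * i + 3) (n - 1 - (2 * i + 3))).map (Fin.ofNat n)).map
      (fickEndAct c a i x)).sum = ∑ t ∈ Finset.Ico (2 * i + 3) (n - 1), X t := by
    rw [List.map_map, sum_map_range', show 2 * i + 3 + (n - 1 - (2 * i + 3)) = n - 1 by omega]
    refine Finset.sum_congr rfl fun t ht => ?_
    rw [Finset.mem_Ico] at ht
    simp only [Function.comp, fickEndAct, hv t (by omega)]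
    split_ifs <;> first | contradiction | omega | rfl
  -- The last letter has already collected the entries `1, …, 2i` from the blocks that follow;
  -- together with the letters that `j` meets in this block they make up the full `tailSum`.
  have hS : tailSum x = ∑ t ∈ Finset.Ico 1 (2 * i + 1), X t + X (2 * i + 1) + X (2 * i + 2) +
      ∑ t ∈ Finset.Ico (2 * i + 3) (n - 1), X t + X (n - 1) := by
    rw [← Finset.sum_Ico_succ_top (by omega), ← Finset.sum_Ico_succ_top (by omega),
      Finset.sum_Ico_consecutive _ (by omega) (by omega), ← Finset.sum_Ico_succ_top (by omega),
      show n - 1 + 1 = n by omega]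
    rfl
  have hS2 : ∑ t ∈ Finset.Ico 1 (2 * (i + 1) + 1), X t = ∑ t ∈ Finset.Ico 1 (2 * i + 1), X t +
      X (2 * i + 1) + X (2 * i + 2) := by
    rw [← Finset.sum_Ico_succ_top (by omega), ← Finset.sum_Ico_succ_top (by omega)]
    rfl
  rw [hj, hk, hz, hD]
  ext q
  have hq : Fin.ofNat n q.val = q := by ext; simp
  by_cases qz : q.val = n - 1
  · have : q = Fin.ofNat n (n - 1) := by rw [← qz, hq]
    subst this
    rw [Function.update_self]
    unfold fickEndAct
    rw [if_neg (by omega), if_pos qz, hS2]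
    ring
  have qz' : q ≠ Fin.ofNat n (n - 1) := by
    intro h; apply qz; rw [h, hv _ (by omega)]
  rw [Function.update_of_ne qz']
  by_cases qj : q.val = 2 * i + 1
  · have e : q = Fin.ofNat n (2 * i + 1) := by rw [← qj, hq]
    rw [e, Function.update_self, ← e]
    unfold fickEndAct
    rw [if_neg (by omega), if_neg qz, if_pos (by omega), if_pos (by omega), hS, qj, e]
    ring
  have qj' : q ≠ Fin.ofNat n (2 * i + 1) := by
    intro h; apply qj; rw [h, hv _ (by omega)]
  rw [Function.update_of_ne qj']
  by_cases qk : q.val = 2 * i + 2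
  · have e : q = Fin.ofNat n (2 * i + 2) := by rw [← qk, hq]
    rw [e, Function.update_self, ← e]
    unfold fickEndAct
    rw [if_neg (by omega), if_neg qz, if_pos (by omega), if_neg (by omega), qk, e]
    simp only [hX, show 2 * i + 2 - 1 = 2 * i + 1 by omega]
    ring
  have qk' : q ≠ Fin.ofNat n (2 * i + 2) := by
    intro h; apply qk; rw [h, hv _ (by omega)]
  rw [Function.update_of_ne qk']
  unfold fickEndAct
  split_ifs <;> first | contradiction | omega | rfl

theorem leads_fickEnd (n : ℕ) [NeZero n] (hn : 4 ≤ n) (c a : ℕ) (i : ℕ) (hi : i ≤ n / 2 - 1) :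
    Leads ((List.range i).reverse.flatMap (fun i => fickBlock n a (2 * (i + 1))) ++
      List.replicate (c * (n - 1)) true) (fickTable n i) (fickTable n 0) (fickEndAct c a i) := by
  induction i with
  | zero => simpa using leads_fickEnd_zero n hn c a
  | succ i ih =>
    obtain ⟨f, hf, hf'⟩ := leads_fickEnd_block n hn i hi a
    have := hf.append (ih (by omega))
    rw [List.range_succ, List.reverse_append]
    simp only [List.reverse_singleton, List.singleton_append, List.flatMap_cons, List.append_assoc]
    exact this.congr fun x => hf' c x

/-- The initial `0` puts the letter of index `0` right behind the last letter, which for even `n` is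
the table where the blocks start. For odd `n` the additional `10` does the same to the unpaired
letter `n - 2` and leaves the top row unchanged. -/
theorem leads_fickCycle (n : ℕ) [NeZero n] (hn : 4 ≤ n) (c a : ℕ) :
    Leads (fickCycle n c a) (ofPerm (fickPerm n)) (ofPerm (fickPerm n)) (fickAct c a) := by
  have hv : ∀ t < n, (Fin.ofNat n t).val = t := fun t ht => by simp [Nat.mod_eq_of_lt ht]
  have hend := leads_fickEnd n hn c a (n / 2 - 1) le_rfl
  have htop : List.finRange n = (List.range' 0 (n - 2)).map (Fin.ofNat n) ++
      Fin.ofNat n (n - 2) :: ([] ++ [Fin.ofNat n (n - 1)]) := by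
    have e0 : List.range' 0 n = List.range' 0 (n - 2) ++ [n - 2, n - 1] :=
      (show List.range' 0 n = List.range' 0 ((n - 2) + 2) by congr 1; omega).trans (by
        rw [← List.range'_append]
        simp only [Nat.zero_add, Nat.one_mul, List.range'_succ, List.range'_zero]
        rw [show n - 2 + 1 = n - 1 by omega])
    rw [finRange_eq_map_ofNat, e0]
    simp
  have htop' : List.finRange n = ((List.range' 0 (n - 2)).map (Fin.ofNat n) ++
      [Fin.ofNat n (n - 2)]) ++ [Fin.ofNat n (n - 1)] := by rw [htop]; simp
  have h1 := leads_false (T := (List.range' 0 (n - 2)).map (Fin.ofNat n) ++ [Fin.ofNat n (n - 2)])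
    (B₁ := []) (B₂ := pairSeg n 0 (n / 2 - 1) ++ oddLetter n) (w := Fin.ofNat n (n - 1))
    (l := Fin.ofNat n 0) (by simp) (ofNat_ne (by omega) (by omega) (by omega))
  rw [← htop'] at h1
  have e1 : (⟨List.finRange n, [] ++ Fin.ofNat n (n - 1) :: (pairSeg n 0 (n / 2 - 1) ++
      oddLetter n ++ [Fin.ofNat n 0])⟩ : RauzyTable n) = fickTable n 0 := by
    simp [fickTable, pairSeg]
  rw [e1] at h1
  rw [← fickTable_zero n hn]
  have n0 : Fin.ofNat n 0 = (0 : Fin n) := rfl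
  have l0 : ∀ x : Fin n → ℝ, fickEndAct c a (n / 2 - 1) x (Fin.ofNat n 0) =
      x 0 + c * tailSum x := fun x => by
    unfold fickEndAct; rw [hv 0 (by omega)]; simp
  have l1 : ∀ x : Fin n → ℝ, fickEndAct c a (n / 2 - 1) x (Fin.ofNat n (n - 1)) =
      x (Fin.ofNat n (n - 1)) + ∑ t ∈ Finset.Ico 1 (2 * (n / 2 - 1) + 1), x (Fin.ofNat n t) :=
    fun x => by
      unfold fickEndAct; rw [hv _ (by omega), if_neg (by omega), if_pos rfl]
  rcases Nat.mod_two_eq_zero_or_one n with hpar | hpar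
  · have e2 : (⟨List.finRange n, [] ++ Fin.ofNat n (n - 1) :: Fin.ofNat n 0 ::
        (pairSeg n 0 (n / 2 - 1) ++ oddLetter n)⟩ : RauzyTable n) = fickTable n (n / 2 - 1) := by
      simp [fickTable, pairSeg, oddLetter, hpar]
    rw [e2] at h1
    have h := h1.append hend
    have e3 : fickCycle n c a = [false] ++ ((List.range (n / 2 - 1)).reverse.flatMap
        (fun i => fickBlock n a (2 * (i + 1))) ++ List.replicate (c * (n - 1)) true) := by
      simp [fickCycle, hpar]
    rw [e3]
    refine h.congr fun x => ?_
    have hS : tailSum x = ∑ t ∈ Finset.Ico 1 (2 * (n / 2 - 1) + 1), x (Fin.ofNat n t) +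
        x (Fin.ofNat n (n - 1)) := by
      rw [show 2 * (n / 2 - 1) + 1 = n - 1 by omega, ← Finset.sum_Ico_succ_top (by omega),
        show n - 1 + 1 = n by omega]
      rfl
    ext q
    have hq : Fin.ofNat n q.val = q := by ext; simp
    simp only [Function.comp]
    by_cases qz : q.val = n - 1
    · have e : q = Fin.ofNat n (n - 1) := by rw [← qz, hq]
      subst e
      rw [Function.update_self, l0, l1]
      unfold fickAct
      rw [if_neg (by omega), if_pos qz]
      linear_combination -hS
    · rw [Function.update_of_ne (by intro h; apply qz; rw [h, hv _ (by omega)])]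
      have := q.isLt
      unfold fickEndAct fickAct
      split_ifs <;> first | contradiction | omega | rfl
  · have e2 : (⟨List.finRange n, [] ++ Fin.ofNat n (n - 1) :: Fin.ofNat n 0 ::
        (pairSeg n 0 (n / 2 - 1) ++ oddLetter n)⟩ : RauzyTable n) =
        ⟨List.finRange n, (Fin.ofNat n (n - 1) :: Fin.ofNat n 0 ::
          pairSeg n 0 (n / 2 - 1)) ++ [Fin.ofNat n (n - 2)]⟩ := by
      simp [oddLetter, hpar]
    rw [e2] at h1
    have h2 := leads_true (T₁ := (List.range' 0 (n - 2)).map (Fin.ofNat n)) (T₂ := [])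
      (B := Fin.ofNat n (n - 1) :: Fin.ofNat n 0 :: pairSeg n 0 (n / 2 - 1))
      (w := Fin.ofNat n (n - 2)) (l := Fin.ofNat n (n - 1)) (by
        simp only [List.mem_map, List.mem_range'_1, not_exists, not_and]
        intro t ht
        exact ofNat_ne (by omega) (by omega) (by omega)) (ofNat_ne (by omega) (by omega) (by omega))
    rw [show (Fin.ofNat n (n - 2) :: Fin.ofNat n (n - 1) :: ([] : List (Fin n))) =
      Fin.ofNat n (n - 2) :: ([] ++ [Fin.ofNat n (n - 1)]) by simp, ← htop] at h2
    have h3 := leads_false (T := (List.range' 0 (n - 2)).map (Fin.ofNat n) ++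
      [Fin.ofNat n (n - 2)]) (B₁ := []) (B₂ := Fin.ofNat n 0 :: pairSeg n 0 (n / 2 - 1))
      (w := Fin.ofNat n (n - 1)) (l := Fin.ofNat n (n - 2)) (by simp)
      (ofNat_ne (by omega) (by omega) (by omega))
    rw [← htop'] at h3
    have e4 : (⟨List.finRange n, [] ++ Fin.ofNat n (n - 1) :: Fin.ofNat n (n - 2) ::
        (Fin.ofNat n 0 :: pairSeg n 0 (n / 2 - 1))⟩ : RauzyTable n) =
        fickTable n (n / 2 - 1) := by
      simp [fickTable, pairSeg, oddLetter, hpar]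
    rw [e4] at h3
    have h := ((h1.append h2).append h3).append hend
    have e3 : fickCycle n c a = [false] ++ [true] ++ [false] ++
        ((List.range (n / 2 - 1)).reverse.flatMap
        (fun i => fickBlock n a (2 * (i + 1))) ++ List.replicate (c * (n - 1)) true) := by
      simp [fickCycle, hpar]
    rw [e3]
    refine h.congr fun x => ?_
    have hS : tailSum x = ∑ t ∈ Finset.Ico 1 (2 * (n / 2 - 1) + 1), x (Fin.ofNat n t) +
        x (Fin.ofNat n (n - 2)) + x (Fin.ofNat n (n - 1)) := by
      rw [show 2 * (n / 2 - 1) + 1 = n - 2 by omega, ← Finset.sum_Ico_succ_top (by omega),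
        show n - 2 + 1 = n - 1 by omega, ← Finset.sum_Ico_succ_top (by omega),
        show n - 1 + 1 = n by omega]
      rfl
    have l2 : fickEndAct c a (n / 2 - 1) x (Fin.ofNat n (n - 2)) = x (Fin.ofNat n (n - 2)) := by
      unfold fickEndAct
      rw [hv _ (by omega), if_neg (by omega), if_neg (by omega), if_neg (by omega)]
    have d1 : Fin.ofNat n (n - 1) ≠ Fin.ofNat n (n - 2) :=
      ofNat_ne (by omega) (by omega) (by omega)
    have d2 : Fin.ofNat n 0 ≠ Fin.ofNat n (n - 2) := ofNat_ne (by omega) (by omega) (by omega)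
    have d3 : Fin.ofNat n 0 ≠ Fin.ofNat n (n - 1) := ofNat_ne (by omega) (by omega) (by omega)
    ext q
    have hq : Fin.ofNat n q.val = q := by ext; simp
    simp only [Function.comp]
    by_cases qz : q.val = n - 1
    · have e : q = Fin.ofNat n (n - 1) := by rw [← qz, hq]
      subst e
      rw [Function.update_self]
      simp only [Function.update_of_ne d1, Function.update_self, Function.update_of_ne d2,
        Function.update_of_ne d3, l0, l1, l2]
      unfold fickAct
      rw [if_neg (by omega), if_pos qz]
      linear_combination -hS
    rw [Function.update_of_ne (by intro h; apply qz; rw [h, hv _ (by omega)])]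
    by_cases qy : q.val = n - 2
    · have e : q = Fin.ofNat n (n - 2) := by rw [← qy, hq]
      subst e
      rw [Function.update_self]
      simp only [Function.update_of_ne d1.symm, Function.update_self, l1, l2]
      unfold fickAct
      rw [if_neg (by omega), if_neg qz, if_pos (by omega), if_neg (by omega)]
      linear_combination -hS
    · rw [Function.update_of_ne (by intro h; apply qy; rw [h, hv _ (by omega)]),
        Function.update_of_ne (by intro h; apply qz; rw [h, hv _ (by omega)])]
      have := q.isLt
      unfold fickEndAct fickAct
      split_ifs <;> first | contradiction | omega | rfl

end RauzyTable

/-! ### Products of decaying perturbations of a fixed operator. -/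

section Perturbation

variable {X : Type*} [NormedAddCommGroup X] [NormedSpace ℝ X]

/-- The product `(B + ε 0 • E) (B + ε 1 • E) ⋯ (B + ε (m - 1) • E)`. -/
noncomputable def perturbedProd (B E : X →L[ℝ] X) (ε : ℕ → ℝ) : ℕ → X →L[ℝ] X
  | 0 => 1
  | m + 1 => perturbedProd B E ε m * (B + ε m • E)

theorem perturbedProd_succ_apply (B E : X →L[ℝ] X) (ε : ℕ → ℝ) (m : ℕ) (x : X) :
    perturbedProd B E ε (m + 1) x =
      perturbedProd B E ε m (B x) + ε m • perturbedProd B E ε m (E x) := by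
  simp [perturbedProd]

variable {B E : X →L[ℝ] X} {ε : ℕ → ℝ} {p K ε₀ : ℝ}

/-- Treating all `k` together is what makes the induction on `m` work: splitting off the last factor
turns one step in `m` into one step in `k`, plus an error. The error is at most `K (1/2)^(m+1)
p^(m+1+k)`, and the constants `K (2 - (1/2)^m)` absorb this geometric series. -/
theorem norm_perturbedProd_mul_pow_le (hp : 2 ≤ p) (hK : 0 ≤ K) (hB : ∀ k, ‖B ^ k‖ ≤ K * p ^ k)
    (hε : ∀ m, 0 ≤ ε m) (hε' : ∀ m, ε m ≤ ε₀ * (p ^ (2 * m))⁻¹) (hε₀ : 4 * K * ‖E‖ * ε₀ ≤ 1)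
    (m k : ℕ) :
    ‖perturbedProd B E ε m * B ^ k‖ ≤ K * (2 - (1 / 2) ^ m) * p ^ (m + k) := by
  have hε₀' : 0 ≤ ε₀ := by simpa using (hε 0).trans (hε' 0)
  induction m generalizing k with
  | zero => simpa [perturbedProd, show (2 : ℝ) - 1 = 1 by norm_num] using hB k
  | succ m ih =>
    have h1 := ih (k + 1)
    have h2 : ‖perturbedProd B E ε m‖ ≤ 2 * K * p ^ m := by
      have := ih 0
      simp only [pow_zero, mul_one, add_zero] at this
      refine this.trans ?_
      have : (0 : ℝ) ≤ (1 / 2) ^ m := by positivity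
      have h3 : 0 ≤ p ^ m := by positivity
      nlinarith [mul_nonneg (mul_nonneg hK this) h3]
    have e : perturbedProd B E ε (m + 1) * B ^ k =
        perturbedProd B E ε m * B ^ (k + 1) + ε m • (perturbedProd B E ε m * E * B ^ k) := by
      rw [perturbedProd, mul_add, add_mul, pow_succ', mul_assoc, mul_smul_comm, smul_mul_assoc]
    have h4 : ‖perturbedProd B E ε m * E * B ^ k‖ ≤ 2 * K * p ^ m * ‖E‖ * (K * p ^ k) := by
      refine (norm_mul_le _ _).trans (mul_le_mul ?_ (hB k) (norm_nonneg _) (by positivity))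
      exact (norm_mul_le _ _).trans (mul_le_mul_of_nonneg_right h2 (norm_nonneg _))
    have h5 : ε m ≤ ε₀ * (1 / 2) ^ m := by
      refine (hε' m).trans (mul_le_mul_of_nonneg_left ?_ hε₀')
      rw [one_div, inv_pow]
      apply inv_anti₀ (by positivity)
      calc (2 : ℝ) ^ m ≤ p ^ m := by gcongr
        _ ≤ p ^ (2 * m) := pow_le_pow_right₀ (by linarith) (by omega)
    have h6 : ‖ε m • (perturbedProd B E ε m * E * B ^ k)‖ ≤
        ε₀ * (1 / 2) ^ m * (2 * K * p ^ m * ‖E‖ * (K * p ^ k)) := by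
      rw [norm_smul, Real.norm_of_nonneg (hε m)]
      exact mul_le_mul h5 h4 (norm_nonneg _) (by positivity)
    rw [e]
    refine (norm_add_le _ _).trans ((add_le_add h1 h6).trans ?_)
    have h7 : ε₀ * (1 / 2) ^ m * (2 * K * p ^ m * ‖E‖ * (K * p ^ k)) =
        (4 * K * ‖E‖ * ε₀) * (K * (1 / 2) ^ (m + 1) * p ^ (m + k)) := by
      rw [pow_add, pow_succ]; ring
    have h8 : (4 * K * ‖E‖ * ε₀) * (K * (1 / 2) ^ (m + 1) * p ^ (m + k)) ≤
        1 * (K * (1 / 2) ^ (m + 1) * p ^ (m + 1 + k)) := by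
      apply mul_le_mul hε₀ _ (by positivity) zero_le_one
      exact mul_le_mul_of_nonneg_left (pow_le_pow_right₀ (by linarith) (by omega)) (by positivity)
    rw [h7]
    refine (add_le_add le_rfl h8).trans (le_of_eq ?_)
    rw [show m + (k + 1) = m + 1 + k by ring, pow_succ]
    ring

theorem norm_perturbedProd_le (hp : 2 ≤ p) (hK : 0 ≤ K) (hB : ∀ k, ‖B ^ k‖ ≤ K * p ^ k)
    (hε : ∀ m, 0 ≤ ε m) (hε' : ∀ m, ε m ≤ ε₀ * (p ^ (2 * m))⁻¹) (hε₀ : 4 * K * ‖E‖ * ε₀ ≤ 1)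
    (m : ℕ) : ‖perturbedProd B E ε m‖ ≤ 2 * K * p ^ m := by
  have := norm_perturbedProd_mul_pow_le hp hK hB hε hε' hε₀ m 0
  simp only [pow_zero, mul_one, add_zero] at this
  refine this.trans ?_
  have h1 : (0 : ℝ) ≤ (1 / 2) ^ m := by positivity
  have h3 : 0 ≤ p ^ m := by positivity
  nlinarith [mul_nonneg (mul_nonneg hK h1) h3]

/-- The decay `p^(-2m)` of `ε m` against the growth `p^m` of the product leaves `p^(-m)`, hence a
summable sequence. -/
theorem norm_smul_perturbedProd_apply_le (hp : 2 ≤ p) (hK : 0 ≤ K)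
    (hB : ∀ k, ‖B ^ k‖ ≤ K * p ^ k)
    (hε : ∀ m, 0 ≤ ε m) (hε' : ∀ m, ε m ≤ ε₀ * (p ^ (2 * m))⁻¹) (hε₀ : 4 * K * ‖E‖ * ε₀ ≤ 1)
    (m : ℕ) (x : X) : ‖ε m • perturbedProd B E ε m x‖ ≤ 2 * K * ε₀ * ‖x‖ * (1 / 2) ^ m := by
  have hε₀' : 0 ≤ ε₀ := by simpa using (hε 0).trans (hε' 0)
  rw [norm_smul, Real.norm_of_nonneg (hε m)]
  have h1 := (ContinuousLinearMap.le_opNorm (perturbedProd B E ε m) x).trans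
    (mul_le_mul_of_nonneg_right (norm_perturbedProd_le hp hK hB hε hε' hε₀ m) (norm_nonneg _))
  have hpm : 0 < p ^ m := by positivity
  have h2 : (p ^ m)⁻¹ ≤ (1 / 2) ^ m := by
    rw [one_div, inv_pow]
    exact inv_anti₀ (by positivity) (by gcongr)
  calc ε m * ‖perturbedProd B E ε m x‖
      ≤ (ε₀ * (p ^ (2 * m))⁻¹) * (2 * K * p ^ m * ‖x‖) :=
        mul_le_mul (hε' m) h1 (norm_nonneg _) (by positivity)
    _ = 2 * K * ε₀ * ‖x‖ * (p ^ m)⁻¹ := by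
        rw [two_mul m, pow_add]; field_simp
    _ ≤ _ := mul_le_mul_of_nonneg_left h2 (by positivity)

theorem tendsto_smul_perturbedProd_apply (hp : 2 ≤ p) (hK : 0 ≤ K)
    (hB : ∀ k, ‖B ^ k‖ ≤ K * p ^ k)
    (hε : ∀ m, 0 ≤ ε m) (hε' : ∀ m, ε m ≤ ε₀ * (p ^ (2 * m))⁻¹) (hε₀ : 4 * K * ‖E‖ * ε₀ ≤ 1)
    (x : X) : Tendsto (fun m => ε m • perturbedProd B E ε m x) atTop (𝓝 0) := by
  apply squeeze_zero_norm (norm_smul_perturbedProd_apply_le hp hK hB hε hε' hε₀ · x)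
  have := (tendsto_pow_atTop_nhds_zero_of_lt_one (r := (1 / 2 : ℝ)) (by norm_num)
    (by norm_num)).const_mul (2 * K * ε₀ * ‖x‖)
  simpa using this

/-- As `B w = l • w`, consecutive terms differ only by `l^(-(m+1)) ε_m P_m (E w)`, so the sequence
is Cauchy. The distance from `w` to the limit is proportional to `ε₀` and can be made small. -/
theorem exists_tendsto_perturbedProd_eigenvector [CompleteSpace X] (hp : 2 ≤ p) (hK : 0 ≤ K)
    (hB : ∀ k, ‖B ^ k‖ ≤ K * p ^ k)
    (hε : ∀ m, 0 ≤ ε m) (hε' : ∀ m, ε m ≤ ε₀ * (p ^ (2 * m))⁻¹) (hε₀ : 4 * K * ‖E‖ * ε₀ ≤ 1)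
    {l : ℝ} (hl : 1 ≤ l) {w : X} (hw : B w = l • w) :
    ∃ v, Tendsto (fun m => (l ^ m)⁻¹ • perturbedProd B E ε m w) atTop (𝓝 v) ∧
      ‖w - v‖ ≤ 4 * K * ε₀ * ‖E w‖ := by
  have hl0 : l ≠ 0 := by positivity
  have hd : ∀ m, dist ((l ^ m)⁻¹ • perturbedProd B E ε m w)
      ((l ^ (m + 1))⁻¹ • perturbedProd B E ε (m + 1) w) ≤ 2 * K * ε₀ * ‖E w‖ * (1 / 2) ^ m := by
    intro m
    rw [dist_comm, dist_eq_norm, perturbedProd_succ_apply, hw]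
    have e : (l ^ (m + 1))⁻¹ • (perturbedProd B E ε m (l • w) + ε m • perturbedProd B E ε m (E w))
        - (l ^ m)⁻¹ • perturbedProd B E ε m w =
        (l ^ (m + 1))⁻¹ • (ε m • perturbedProd B E ε m (E w)) := by
      rw [map_smul, smul_add, smul_smul, pow_succ, mul_inv, mul_assoc, inv_mul_cancel₀ hl0]
      simp
    rw [e, norm_smul]
    refine le_trans ?_ (norm_smul_perturbedProd_apply_le hp hK hB hε hε' hε₀ m (E w))
    apply mul_le_of_le_one_left (norm_nonneg _)
    rw [norm_inv, norm_pow, Real.norm_of_nonneg (by linarith)]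
    exact inv_le_one_of_one_le₀ (one_le_pow₀ hl)
  have hc := cauchySeq_of_le_geometric _ _ (by norm_num : (1 / 2 : ℝ) < 1) hd
  obtain ⟨v, hv⟩ := cauchySeq_tendsto_of_complete hc
  refine ⟨v, hv, ?_⟩
  have := dist_le_of_le_geometric_of_tendsto₀ _ _ (by norm_num : (1 / 2 : ℝ) < 1) hd hv
  simp only [pow_zero, inv_one, one_smul, perturbedProd, one_apply_eq_self,
    dist_eq_norm] at this
  exact this.trans (le_of_eq (by ring))

/-- Only `B x` matters for the asymptotics of `P_{m+1} x`, since `ε_m P_m (E x)` vanishes in the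
limit. This reduces basis vectors to combinations of eigenvectors. -/
theorem tendsto_perturbedProd_succ_apply (hp : 2 ≤ p) (hK : 0 ≤ K)
    (hB : ∀ k, ‖B ^ k‖ ≤ K * p ^ k)
    (hε : ∀ m, 0 ≤ ε m) (hε' : ∀ m, ε m ≤ ε₀ * (p ^ (2 * m))⁻¹) (hε₀ : 4 * K * ‖E‖ * ε₀ ≤ 1)
    {l : ℝ} (hl : 1 ≤ l) {x v : X}
    (hx : Tendsto (fun m => (l ^ m)⁻¹ • perturbedProd B E ε m (B x)) atTop (𝓝 v)) :
    Tendsto (fun m => (l ^ m)⁻¹ • perturbedProd B E ε (m + 1) x) atTop (𝓝 v) := by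
  have h := tendsto_smul_perturbedProd_apply hp hK hB hε hε' hε₀ (E x)
  have h2 : Tendsto (fun m => (l ^ m)⁻¹ • (ε m • perturbedProd B E ε m (E x))) atTop (𝓝 0) := by
    apply squeeze_zero_norm _ (tendsto_zero_iff_norm_tendsto_zero.1 h)
    intro m
    rw [norm_smul]
    apply mul_le_of_le_one_left (norm_nonneg _)
    rw [norm_inv, norm_pow, Real.norm_of_nonneg (by linarith)]
    exact inv_le_one_of_one_le₀ (one_le_pow₀ hl)
  simpa [perturbedProd_succ_apply] using hx.add h2

/-- The relation is `B (B - 1) (B - p) = 0`. It keeps the powers in the form `s (B² - B) + B`, where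
`s` becomes `p s + 1` at each step and thus stays below `p^k`. -/
theorem norm_pow_le_of_cubic (hp : 2 ≤ p) (h : B ^ 3 = (p + 1) • B ^ 2 - p • B) :
    ∀ k, ‖B ^ k‖ ≤ (1 + ‖B‖ + ‖B ^ 2‖ + ‖B‖) * p ^ k := by
  have key : ∀ k : ℕ, ∃ s : ℝ, 0 ≤ s ∧ s ≤ p ^ k - 1 ∧ B ^ (k + 1) = s • (B ^ 2 - B) + B := by
    intro k
    induction k with
    | zero => exact ⟨0, le_rfl, by simp, by simp⟩
    | succ k ih =>
      obtain ⟨s, h0, h1, h2⟩ := ih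
      refine ⟨p * s + 1, by positivity, ?_, ?_⟩
      · rw [pow_succ]; nlinarith [one_le_pow₀ (n := k) (show 1 ≤ p by linarith)]
      · rw [pow_succ, h2, add_mul, smul_mul_assoc, sub_mul, ← pow_succ, h, ← sq]
        module
  intro k
  rcases k with _ | k
  · have h1 : ‖(1 : X →L[ℝ] X)‖ ≤ 1 := ContinuousLinearMap.norm_id_le
    simp only [pow_zero, mul_one]
    linarith [norm_nonneg B, norm_nonneg (B ^ 2)]
  · obtain ⟨s, h0, h1, h2⟩ := key k
    rw [h2]
    have hpk : 1 ≤ p ^ k := one_le_pow₀ (by linarith)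
    have hpk' : p ^ k ≤ p ^ (k + 1) := pow_le_pow_right₀ (by linarith) (by omega)
    have h3 : ‖s • (B ^ 2 - B) + B‖ ≤ s * (‖B ^ 2‖ + ‖B‖) + ‖B‖ := by
      refine (norm_add_le _ _).trans (add_le_add ?_ le_rfl)
      rw [norm_smul, Real.norm_of_nonneg h0]
      exact mul_le_mul_of_nonneg_left (norm_sub_le _ _) h0
    refine h3.trans ?_
    have a1 := norm_nonneg B
    have a2 := norm_nonneg (B ^ 2)
    have h4 : s * (‖B ^ 2‖ + ‖B‖) ≤ p ^ (k + 1) * (‖B ^ 2‖ + ‖B‖) :=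
      mul_le_mul_of_nonneg_right (by linarith) (by positivity)
    have h5 : 1 * ‖B‖ ≤ p ^ (k + 1) * ‖B‖ := mul_le_mul_of_nonneg_right (by linarith) a1
    nlinarith

end Perturbation

/-! ### The dominant part of the matrix: spectrum, eigenvectors and limits of the columns. -/

theorem mem_fickIndices {n : ℕ} (hn : 4 ≤ n) (j : Fin n) : j ∈ fickIndices n ↔
    (j.val % 2 = 0 ∧ 2 ≤ j.val ∧ j.val < 2 * (n / 2) - 1) ∨ j.val = n - 1 := by
  simp only [fickIndices, Finset.mem_filter, Finset.mem_univ, true_and]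
  omega

section Dominant

variable {n : ℕ} [NeZero n]

theorem tailSum_add (x y : Fin n → ℝ) : tailSum (x + y) = tailSum x + tailSum y := by
  simp [tailSum, Finset.sum_add_distrib]

theorem tailSum_smul (r : ℝ) (x : Fin n → ℝ) : tailSum (r • x) = r * tailSum x := by
  simp [tailSum, Finset.mul_sum]

theorem ofNat_val (q : Fin n) : Fin.ofNat n q.val = q := by ext; simp

theorem val_ofNat {t : ℕ} (ht : t < n) : (Fin.ofNat n t).val = t := by
  simp [Nat.mod_eq_of_lt ht]

/-- The dominant part of the matrix of Fickenscher's cycle, divided by `c`. -/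
noncomputable def fickMain (n : ℕ) [NeZero n] (p : ℝ) : (Fin n → ℝ) →L[ℝ] (Fin n → ℝ) :=
  LinearMap.toContinuousLinearMap
    { toFun := fun x j => if j.val = 0 ∨ j.val = n - 1 then tailSum x
        else if j.val % 2 = 1 then 0 else p * (x (Fin.ofNat n (j.val - 1)) + x j)
      map_add' := fun x y => by
        ext j
        simp only [tailSum_add, Pi.add_apply]
        split_ifs <;> ring
      map_smul' := fun r x => by
        ext j
        simp only [tailSum_smul, Pi.smul_apply, smul_eq_mul, RingHom.id_apply]
        split_ifs <;> ring }

theorem fickMain_apply (p : ℝ) (x : Fin n → ℝ) (j : Fin n) :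
    fickMain n p x j = if j.val = 0 ∨ j.val = n - 1 then tailSum x
        else if j.val % 2 = 1 then 0 else p * (x (Fin.ofNat n (j.val - 1)) + x j) := rfl

/-- The bounded part of the matrix of Fickenscher's cycle. -/
noncomputable def fickRest (n : ℕ) [NeZero n] : (Fin n → ℝ) →L[ℝ] (Fin n → ℝ) :=
  LinearMap.toContinuousLinearMap
    { toFun := fun x j => if j.val = 0 then x 0 else if j.val = n - 1 then x 0 + tailSum x
        else if j.val % 2 = 1 then
          tailSum x + x j + if j.val + 1 < n - 1 then x (Fin.ofNat n (j.val + 1)) else 0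
        else x j
      map_add' := fun x y => by
        ext j
        simp only [tailSum_add, Pi.add_apply]
        split_ifs <;> ring
      map_smul' := fun r x => by
        ext j
        simp only [tailSum_smul, Pi.smul_apply, smul_eq_mul, RingHom.id_apply]
        split_ifs <;> ring }

theorem fickRest_apply (x : Fin n → ℝ) (j : Fin n) :
    fickRest n x j = if j.val = 0 then x 0 else if j.val = n - 1 then x 0 + tailSum x
        else if j.val % 2 = 1 then
          tailSum x + x j + if j.val + 1 < n - 1 then x (Fin.ofNat n (j.val + 1)) else 0
        else x j := rfl

/-- Taking `a = p * c` makes all large entries proportional to `c`; after division by `c` they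
depend on `p` only. -/
theorem fickAct_eq {c p : ℝ} (hc : c ≠ 0) (x : Fin n → ℝ) :
    fickAct c (p * c) x = c • (fickMain n p + c⁻¹ • fickRest n) x := by
  ext j
  simp only [add_apply, smul_apply, Pi.smul_apply,
    Pi.add_apply, fickMain_apply, fickRest_apply, smul_eq_mul, mul_add, mul_inv_cancel_left₀ hc]
  unfold fickAct
  split_ifs <;> first | (exfalso; omega) | ring

/-- The vector with ones at the first and the last letter. -/
noncomputable def endsVec (n : ℕ) (j : Fin n) : ℝ := if j.val = 0 ∨ j.val = n - 1 then 1 else 0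

theorem tailSum_eq_sum (x : Fin n → ℝ) : tailSum x = ∑ j, x j - x 0 := by
  have h1 : ∑ j, x j = ∑ t ∈ Finset.range n, x (Fin.ofNat n t) := by
    rw [Finset.sum_range]
    exact Finset.sum_congr rfl fun j _ => by rw [ofNat_val]
  have h2 : ∑ t ∈ Finset.range n, x (Fin.ofNat n t) = x (Fin.ofNat n 0) + tailSum x := by
    rw [Finset.range_eq_Ico, Finset.sum_eq_sum_Ico_succ_bot (Nat.pos_of_neZero n)]
    rfl
  rw [h1, h2]
  simp

theorem tailSum_single {j : Fin n} (h : j.val ≠ 0) : tailSum (Pi.single j (1 : ℝ)) = 1 := by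
  have h0 : (0 : Fin n) ≠ j := fun e => h (by rw [← e]; simp)
  rw [tailSum_eq_sum, Pi.single_eq_of_ne h0]
  simp

theorem tailSum_endsVec (hn : 2 ≤ n) : tailSum (endsVec n) = 1 := by
  have h : endsVec n = Pi.single 0 1 + Pi.single (Fin.ofNat n (n - 1)) 1 := by
    ext j
    have e1 : j = 0 ↔ j.val = 0 := Fin.val_eq_zero_iff.symm
    have e2 : j = Fin.ofNat n (n - 1) ↔ j.val = n - 1 := by
      rw [Fin.ext_iff, val_ofNat (by omega)]
    simp only [endsVec, Pi.add_apply, Pi.single_apply, e1, e2]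
    split_ifs <;> first | (exfalso; omega) | norm_num
  have h' : (Fin.ofNat n (n - 1)).val ≠ 0 := by rw [val_ofNat (by omega)]; omega
  rw [h, tailSum_add, tailSum_single h', tailSum_eq_sum]
  simp

theorem fickMain_endsVec (hn : 2 ≤ n) (p : ℝ) : fickMain n p (endsVec n) = endsVec n := by
  ext j
  rw [fickMain_apply, tailSum_endsVec hn]
  unfold endsVec
  have := j.isLt
  split_ifs <;> try rfl
  · rename_i h1 h2 h3
    rw [val_ofNat (by omega)] at h3
    omega
  · simp

/-- Vectors in the range of `B` vanish at the odd inner letters, so away from the two ends `B`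
multiplies them by `p`. Thus `(B - p) B` has values in the line of `endsVec n`, which `B - 1` kills.
-/
theorem fickMain_cubic (hn : 2 ≤ n) (p : ℝ) :
    fickMain n p ^ 3 = (p + 1) • fickMain n p ^ 2 - p • fickMain n p := by
  have key : ∀ x, fickMain n p (fickMain n p x) = p • fickMain n p x +
      (tailSum (fickMain n p x) - p * tailSum x) • endsVec n := by
    intro x
    ext j
    have hj := j.isLt
    rw [fickMain_apply p (fickMain n p x) j]
    simp only [Pi.add_apply, Pi.smul_apply, smul_eq_mul, endsVec]
    by_cases h1 : j.val = 0 ∨ j.val = n - 1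
    · rw [if_pos h1, if_pos h1, fickMain_apply p x j, if_pos h1]; ring
    · rw [if_neg h1, if_neg h1, fickMain_apply p x j, if_neg h1]
      by_cases h2 : j.val % 2 = 1
      · simp [h2]
      · rw [if_neg h2, if_neg h2, fickMain_apply, val_ofNat (by omega), if_neg (by omega),
          if_pos (by omega)]
        ring
  ext1 x
  have e3 : (fickMain n p ^ 3) x = fickMain n p (fickMain n p (fickMain n p x)) := rfl
  have e2 : (fickMain n p ^ 2) x = fickMain n p (fickMain n p x) := rfl
  rw [sub_apply, smul_apply, smul_apply, e3, e2]
  conv_lhs => rw [key x]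
  rw [map_add, map_smul, map_smul, fickMain_endsVec hn]
  rw [eq_sub_of_add_eq' (key x).symm]
  module

/-- The index in `fickIndices n` of the limit of the `j`-th column. -/
def fickTarget (n : ℕ) [NeZero n] (j : Fin n) : Fin n :=
  if j.val = 0 ∨ 2 * (n / 2) - 1 ≤ j.val then Fin.ofNat n (n - 1)
  else Fin.ofNat n (2 * ((j.val + 1) / 2))

theorem fickTarget_mem (hn : 4 ≤ n) (j : Fin n) : fickTarget n j ∈ fickIndices n := by
  rw [mem_fickIndices hn]
  unfold fickTarget
  split_ifs with h
  · rw [val_ofNat (by omega)]; omega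
  · rw [val_ofNat (by omega)]; omega

theorem fickTarget_of_mem (hn : 4 ≤ n) {j : Fin n} (hj : j ∈ fickIndices n) :
    fickTarget n j = j := by
  rw [mem_fickIndices hn] at hj
  ext
  unfold fickTarget
  split_ifs with h
  · rw [val_ofNat (by omega)]; omega
  · rw [val_ofNat (by omega)]; omega

theorem fickMain_single_zero (hn : 4 ≤ n) (p : ℝ) {j : Fin n} (hj : j.val = 0) :
    fickMain n p (Pi.single j 1) = 0 := by
  have e : j = 0 := by ext; simpa using hj
  subst e
  ext q
  rw [fickMain_apply, tailSum_eq_sum]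
  have hq := q.isLt
  by_cases h1 : q.val = 0 ∨ q.val = n - 1
  · rw [if_pos h1]; simp
  · rw [if_neg h1]
    split_ifs with h2
    · rfl
    · rw [Pi.single_eq_of_ne, Pi.single_eq_of_ne]
      · simp
      · intro h; apply h1; left; simpa using congrArg Fin.val h
      · intro h
        have := congrArg Fin.val h
        rw [val_ofNat (by omega)] at this
        simp at this
        omega

/-- These indices are the last letter and, for odd `n`, the unpaired letter `n - 2`. Neither
contributes to an inner even letter, so only `tailSum` at the two ends remains. -/
theorem fickMain_single_last (hn : 4 ≤ n) (p : ℝ) {j : Fin n} (hj : 2 * (n / 2) - 1 ≤ j.val) :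
    fickMain n p (Pi.single j 1) = endsVec n := by
  ext q
  rw [fickMain_apply, tailSum_single (by omega), endsVec]
  have hq := q.isLt
  have hj' := j.isLt
  by_cases h1 : q.val = 0 ∨ q.val = n - 1
  · rw [if_pos h1, if_pos h1]
  · rw [if_neg h1, if_neg h1]
    split_ifs with h2
    · rfl
    · rw [Pi.single_eq_of_ne, Pi.single_eq_of_ne]
      · simp
      · intro h; have := congrArg Fin.val h; omega
      · intro h
        have := congrArg Fin.val h
        rw [val_ofNat (by omega)] at this
        omega

/-- Both letters of a pair feed the even one with the same weight `p`, so `B` has equal columns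
there. This is why only one index per pair is kept. -/
theorem fickMain_single_pair (hn : 4 ≤ n) (p : ℝ) {j : Fin n}
    (hj : ¬ (j.val = 0 ∨ 2 * (n / 2) - 1 ≤ j.val)) :
    fickMain n p (Pi.single j 1) = p • Pi.single (fickTarget n j) 1 + endsVec n := by
  ext q
  rw [fickMain_apply, tailSum_single (by omega)]
  have ht : (fickTarget n j).val = 2 * ((j.val + 1) / 2) := by
    rw [fickTarget, if_neg hj, val_ofNat (by omega)]
  have hq := q.isLt
  have hj' := j.isLt
  simp only [Pi.add_apply, Pi.smul_apply, Pi.single_apply, smul_eq_mul, endsVec, Fin.ext_iff, ht]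
  by_cases h1 : q.val = 0 ∨ q.val = n - 1
  · rw [if_pos h1, if_neg (by omega), if_pos h1]; ring
  · rw [if_neg h1, if_neg h1, val_ofNat (by omega)]
    split_ifs <;> first | (exfalso; omega) | norm_num

/-- The eigenvectors of the dominant part. -/
noncomputable def fickEigenvec (n : ℕ) (p : ℝ) (j : Fin n) : Fin n → ℝ :=
  if j.val = n - 1 then endsVec n else Pi.single j 1 + (p - 1)⁻¹ • endsVec n

/-- The eigenvalues of the dominant part. -/
noncomputable def fickEigenval (n : ℕ) (p : ℝ) (j : Fin n) : ℝ :=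
  if j.val = n - 1 then 1 else p

/-- Since `B` maps `e_j` to `p e_j + endsVec n` and fixes `endsVec n`, the vector `e_j + t • endsVec
n` has eigenvalue `p` exactly if `1 + t = p t`, that is `t = (p - 1)⁻¹`. -/
theorem fickMain_fickEigenvec (hn : 4 ≤ n) {p : ℝ} (hp : 2 ≤ p) {j : Fin n}
    (hj : j ∈ fickIndices n) :
    fickMain n p (fickEigenvec n p j) = fickEigenval n p j • fickEigenvec n p j := by
  unfold fickEigenvec fickEigenval
  have h := (mem_fickIndices hn j).1 hj
  split_ifs with h'
  · rw [fickMain_endsVec (by omega), one_smul]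
  · rw [map_add, map_smul, fickMain_endsVec (by omega), fickMain_single_pair hn p (by omega),
      fickTarget_of_mem hn hj, smul_add, smul_smul, add_assoc]
    congr 1
    nth_rewrite 1 [← one_smul ℝ (endsVec n)]
    rw [← add_smul]
    congr 1
    have : p - 1 ≠ 0 := by linarith
    field_simp
    ring

omit [NeZero n] in
-- `endsVec n` vanishes at all indices of the set but the last one. Those coordinates isolate the
-- other coefficients, and the last coordinate then isolates its own.
theorem linearIndependent_fickEigenvec (hn : 4 ≤ n) (p : ℝ) :
    LinearIndependent ℝ (fun j : fickIndices n => fickEigenvec n p j) := by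
  rw [Fintype.linearIndependent_iff]
  intro g hg
  have h1 : ∀ i : fickIndices n, i.1.val ≠ n - 1 → g i = 0 := by
    intro i hi
    have hm := (mem_fickIndices hn i.1).1 i.2
    have hE : endsVec n i.1 = 0 := if_neg (by omega)
    have := congrFun hg i.1
    rw [Finset.sum_apply, Finset.sum_eq_single i] at this
    · simpa [fickEigenvec, hi, hE] using this
    · intro b _ hb
      have hb' : i.1 ≠ b.1 := fun e => hb (Subtype.ext e.symm)
      simp only [Pi.smul_apply, smul_eq_mul, fickEigenvec]
      split_ifs
      · simp [hE]
      · simp [hE, hb']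
    · simp
  intro i
  by_cases hi : i.1.val = n - 1
  · have := congrFun hg i.1
    rw [Finset.sum_apply, Finset.sum_eq_single i] at this
    · simpa [fickEigenvec, hi, endsVec] using this
    · intro b _ hb
      rw [h1 b]
      · simp
      · intro e
        exact hb (Subtype.ext (Fin.ext (by omega)))
    · simp
  · exact h1 i hi

theorem exists_tendsto_perturbedProd_fick (hn : 4 ≤ n) {p : ℝ} (hp : 2 ≤ p) :
    ∃ C : ℝ, 0 < C ∧ ∀ c : ℕ → ℝ, C ≤ c 0 → (∀ i, c i = c 0 * p ^ (2 * i)) →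
      ∃ V : Fin n → Fin n → ℝ, LinearIndependent ℝ (fun j : fickIndices n => V j) ∧
        ∃ s : ℕ → Fin n → ℝ, (∀ m i, 0 < s m i) ∧
          ∀ i, Tendsto (fun m => s m i • perturbedProd (fickMain n p) (fickRest n)
            (fun i => (c i)⁻¹) m (Pi.single i 1)) atTop (𝓝 (V (fickTarget n i))) := by
  set B := fickMain n p
  set E := fickRest n
  obtain ⟨K, hK, hB⟩ : ∃ K : ℝ, 0 ≤ K ∧ ∀ k, ‖B ^ k‖ ≤ K * p ^ k :=
    ⟨_, by positivity, norm_pow_le_of_cubic hp (fickMain_cubic (by omega) p)⟩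
  -- Independence of the eigenvectors persists within a distance `δ`, which is the tolerance allowed
  -- for the limits.
  have hopen := isOpen_setOfPred_linearIndependent (𝕜 := ℝ) (ι := fickIndices n) (E := Fin n → ℝ)
  obtain ⟨δ, hδ, hball⟩ := Metric.isOpen_iff.1 hopen _ (linearIndependent_fickEigenvec hn p)
  set D := ∑ j, ‖E (fickEigenvec n p j)‖ with hD
  have hD0 : 0 ≤ D := Finset.sum_nonneg fun _ _ => norm_nonneg _
  -- With `ε₀ = (c 0)⁻¹`, the first term yields `4 K ‖E‖ ε₀ ≤ 1`, and the second puts the limits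
  -- within `δ` of the eigenvectors; adding `1` makes the inequality strict.
  refine ⟨4 * K * ‖E‖ + 4 * K * D * δ⁻¹ + 1, by positivity, fun c hc hci => ?_⟩
  have hc0 : 0 < c 0 := lt_of_lt_of_le (by positivity) hc
  have hp0 : 0 < p := by linarith
  have hε : ∀ m, 0 ≤ (c m)⁻¹ := fun m => by rw [hci]; positivity
  have hε' : ∀ m, (c m)⁻¹ ≤ (c 0)⁻¹ * (p ^ (2 * m))⁻¹ := fun m => by rw [hci m, mul_inv]
  have hε₀ : 4 * K * ‖E‖ * (c 0)⁻¹ ≤ 1 := by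
    rw [← div_eq_mul_inv, div_le_one hc0]
    have : 0 ≤ 4 * K * D * δ⁻¹ := by positivity
    linarith
  have hl : ∀ j, 1 ≤ fickEigenval n p j := fun j => by
    unfold fickEigenval; split_ifs <;> linarith
  have hex : ∀ j : Fin n, ∃ v, j ∈ fickIndices n →
      Tendsto (fun m => (fickEigenval n p j ^ m)⁻¹ • perturbedProd B E (fun i => (c i)⁻¹) m
        (fickEigenvec n p j)) atTop (𝓝 v) ∧ ‖fickEigenvec n p j - v‖ < δ := by
    intro j
    by_cases hj : j ∈ fickIndices n
    · obtain ⟨v, hv, hv'⟩ := exists_tendsto_perturbedProd_eigenvector hp hK hB hε hε' hε₀ (hl j)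
        (fickMain_fickEigenvec hn hp hj)
      refine ⟨v, fun _ => ⟨hv, hv'.trans_lt ?_⟩⟩
      have h1 : ‖E (fickEigenvec n p j)‖ ≤ D :=
        Finset.single_le_sum (f := fun j => ‖E (fickEigenvec n p j)‖)
          (fun _ _ => norm_nonneg _) (Finset.mem_univ j)
      have h2 : 4 * K * (c 0)⁻¹ * ‖E (fickEigenvec n p j)‖ ≤ 4 * K * (c 0)⁻¹ * D :=
        mul_le_mul_of_nonneg_left h1 (by positivity)
      refine h2.trans_lt ?_
      rw [show 4 * K * (c 0)⁻¹ * D = (4 * K * D) / c 0 by ring, div_lt_iff₀ hc0]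
      have h3 : 4 * K * D * δ⁻¹ < c 0 := by
        have : 0 ≤ 4 * K * ‖E‖ := by positivity
        linarith
      calc 4 * K * D = δ * (4 * K * D * δ⁻¹) := by field_simp
        _ < δ * c 0 := by gcongr
    · exact ⟨0, fun h => absurd h hj⟩
  choose V hV using hex
  refine ⟨V, ?_, ?_⟩
  · refine hball (?_ : _ ∈ Metric.ball _ _)
    rw [Metric.mem_ball, dist_comm, dist_pi_lt_iff hδ]
    intro j
    rw [dist_eq_norm]
    exact (hV j j.2).2
  set P := perturbedProd B E (fun i => (c i)⁻¹) with hP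
  set z : Fin n := Fin.ofNat n (n - 1) with hz
  have hzv : z.val = n - 1 := val_ofNat (by omega)
  have hzm : z ∈ fickIndices n := (mem_fickIndices hn z).2 (Or.inr hzv)
  have hends : Tendsto (fun m => P m (endsVec n)) atTop (𝓝 (V z)) := by
    simpa [fickEigenval, fickEigenvec, hzv] using (hV z hzm).1
  -- Normalizations of the columns. `B` kills the first basis vector and `E` sends it to `endsVec
  -- n`, so that column is `(c (m-1))⁻¹ P_{m-1} (endsVec n)`. The columns of eigenvalue `1` need no
  -- factor, and the others grow like `p^m`. The value at `m = 0` only has to be positive.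
  set s : ℕ → Fin n → ℝ := fun m i => if i.val = 0 then c (m - 1) else
    if 2 * (n / 2) - 1 ≤ i.val then 1 else (p ^ (m - 1 + 1))⁻¹ with hs
  refine ⟨s, fun m i => ?_, fun i => ?_⟩
  · simp only [hs]
    split_ifs
    · rw [hci]; positivity
    · positivity
    · positivity
  rw [← tendsto_add_atTop_iff_nat 1]
  by_cases h0 : i.val = 0
  · have e : ∀ m, s (m + 1) i • P (m + 1) (Pi.single i 1) = P m (endsVec n) := by
      intro m
      have hE : E (Pi.single i 1) = endsVec n := by
        have e : i = 0 := by ext; simpa using h0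
        subst e
        ext q
        have hq := q.isLt
        have t0 : tailSum (Pi.single (0 : Fin n) (1 : ℝ)) = 0 := by simp [tailSum_eq_sum]
        rw [fickRest_apply, t0, endsVec]
        by_cases h1 : q.val = 0
        · simp [h1]
        by_cases h2 : q.val = n - 1
        · rw [if_neg h1, if_pos h2, if_pos (Or.inr h2)]; simp
        rw [if_neg h1, if_neg h2, if_neg (show ¬ (q.val = 0 ∨ q.val = n - 1) by omega)]
        have h3 : q ≠ 0 := fun e => h1 (by rw [e]; simp)
        have h4 : q.val + 1 < n - 1 → Fin.ofNat n (q.val + 1) ≠ 0 := by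
          intro h5 e
          have := congrArg Fin.val e
          rw [val_ofNat (by omega)] at this
          simp at this
        split_ifs with h5 h6
        · rw [Pi.single_eq_of_ne (h4 h6), Pi.single_eq_of_ne h3]; simp
        · simp [h3]
        · simp [h3]
      rw [hP, perturbedProd_succ_apply, hE, fickMain_single_zero hn p h0, map_zero, zero_add,
        smul_smul]
      simp only [hs, h0, if_true, Nat.add_sub_cancel]
      rw [mul_inv_cancel₀, one_smul]
      rw [hci]; positivity
    rw [show fickTarget n i = z by simp [fickTarget, h0, hz]]
    exact hends.congr fun m => (e m).symm
  by_cases h1 : 2 * (n / 2) - 1 ≤ i.val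
  · rw [show fickTarget n i = z by simp [fickTarget, h1, hz]]
    have h := tendsto_perturbedProd_succ_apply (l := 1) (x := Pi.single i 1) hp hK hB hε hε' hε₀
      le_rfl (v := V z) (by rw [fickMain_single_last hn p h1]; simpa using hends)
    have e : ∀ m, s m i = 1 := fun m => by
      simp only [hs]
      rw [if_neg h0, if_pos h1]
    simpa [e] using h
  · set r := fickTarget n i with hr
    have hrm : r ∈ fickIndices n := fickTarget_mem hn i
    have hrv : r.val = 2 * ((i.val + 1) / 2) := by
      rw [hr, fickTarget, if_neg (by omega), val_ofNat (by omega)]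
    have hrz : r.val ≠ n - 1 := by omega
    have hVr := (hV r hrm).1
    simp only [fickEigenval, fickEigenvec, hrz, if_false] at hVr
    have hzero : Tendsto (fun m => (p ^ m)⁻¹ • P m (endsVec n)) atTop (𝓝 0) := by
      have := (tendsto_pow_atTop_nhds_zero_of_lt_one (r := p⁻¹) (by positivity)
        (inv_lt_one_of_one_lt₀ (by linarith))).smul hends
      simpa using this
    -- `B e_i` is `p` times an eigenvector of eigenvalue `p` minus a multiple of `endsVec n`, and
    -- the latter disappears after division by `p^m`.
    have hb : Tendsto (fun m => (p ^ m)⁻¹ • P m (B (Pi.single i 1))) atTop (𝓝 (p • V r)) := by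
      have h2 := (hVr.const_smul p).sub (hzero.const_smul (p - 1)⁻¹)
      rw [smul_zero, sub_zero] at h2
      refine h2.congr fun m => ?_
      have e : B (Pi.single i 1) = p • (Pi.single r 1 + (p - 1)⁻¹ • endsVec n) -
          (p - 1)⁻¹ • endsVec n := by
        rw [fickMain_single_pair hn p (by omega), ← hr]
        have : p - 1 ≠ 0 := by linarith
        have e2 : p * (p - 1)⁻¹ - (p - 1)⁻¹ = 1 := by field_simp
        rw [smul_add, smul_smul, add_sub_assoc, ← sub_smul, e2, one_smul]
      rw [e, map_sub, map_smul, map_smul, smul_sub, smul_comm p, smul_comm (p - 1)⁻¹]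
    have h := (tendsto_perturbedProd_succ_apply hp hK hB hε hε' hε₀ (by linarith) hb).const_smul
      p⁻¹
    rw [smul_smul, inv_mul_cancel₀ hp0.ne', one_smul] at h
    refine h.congr fun m => ?_
    simp only [hs, h0, h1, if_false, Nat.add_sub_cancel]
    rw [smul_smul, pow_succ, mul_inv, mul_comm p⁻¹]

end Dominant

/-! ### Products of the cycle matrices and their normalized limits. -/

section FickenscherCycles

open RauzyTable

/-- The concatenation of the first `m` cycles. -/
def fickPath (n : ℕ) (c a : ℕ → ℕ) (m : ℕ) : List Bool :=
  (List.range m).flatMap (fun i => fickCycle n (c i) (a i))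

/-- The product of the matrices of the first `m` cycles. -/
noncomputable def fickProd (n : ℕ) (c a : ℕ → ℕ) (m : ℕ) : Matrix (Fin n) (Fin n) ℝ :=
  (RauzyTable.ofPerm (fickPerm n)).pathMatrix (fickPath n c a m)

/-- The vectors that stay nonnegative along all the cycles. -/
def fickCone (n : ℕ) (c a : ℕ → ℕ) : Set (Fin n → ℝ) :=
  {u | ∀ m, ∃ x : Fin n → ℝ, (∀ i, 0 ≤ x i) ∧ u = (fickProd n c a m).mulVec x}

section Products

variable {n : ℕ} [NeZero n]

theorem fickPath_succ (n : ℕ) (c a : ℕ → ℕ) (m : ℕ) :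
    fickPath n c a (m + 1) = fickPath n c a m ++ fickCycle n (c m) (a m) := by
  simp [fickPath, List.range_succ]

theorem fickPath_add (n : ℕ) (c a : ℕ → ℕ) (M m : ℕ) :
    fickPath n c a (M + m) =
      fickPath n c a M ++ fickPath n (fun i => c (M + i)) (fun i => a (M + i)) m := by
  simp [fickPath, List.range_add, List.flatMap_map]

theorem tableAfter_fickPath (hn : 4 ≤ n) (c a : ℕ → ℕ) (m : ℕ) :
    tableAfter (fickPath n c a m) (ofPerm (fickPerm n)) = ofPerm (fickPerm n) := by
  induction m with
  | zero => rfl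
  | succ m ih =>
    rw [fickPath_succ, tableAfter_append, ih]
    exact (leads_fickCycle n hn _ _).2.1

theorem goodPath_fickPath (hn : 4 ≤ n) (c a : ℕ → ℕ) (m : ℕ) :
    GoodPath (fickPath n c a m) (ofPerm (fickPerm n)) := by
  induction m with
  | zero => trivial
  | succ m ih =>
    rw [fickPath_succ, goodPath_append, tableAfter_fickPath hn]
    exact ⟨ih, (leads_fickCycle n hn _ _).1⟩

theorem fickTheta_mulVec (hn : 4 ≤ n) (c a : ℕ) (x : Fin n → ℝ) :
    (fickTheta n c a).mulVec x = fickAct c a x := (leads_fickCycle n hn c a).2.2 x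

theorem fickProd_zero (n : ℕ) (c a : ℕ → ℕ) : fickProd n c a 0 = 1 := rfl

theorem fickProd_add (hn : 4 ≤ n) (c a : ℕ → ℕ) (M m : ℕ) : fickProd n c a (M + m) =
    fickProd n c a M * fickProd n (fun i => c (M + i)) (fun i => a (M + i)) m := by
  rw [fickProd, fickPath_add, pathMatrix_append, tableAfter_fickPath hn]
  rfl

theorem fickProd_succ (hn : 4 ≤ n) (c a : ℕ → ℕ) (m : ℕ) :
    fickProd n c a (m + 1) = fickProd n c a m * fickTheta n (c m) (a m) := by
  rw [fickProd, fickPath_succ, pathMatrix_append, tableAfter_fickPath hn]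
  rfl

theorem fickProd_one (hn : 4 ≤ n) (c a : ℕ → ℕ) :
    fickProd n c a 1 = fickTheta n (c 0) (a 0) := by
  rw [fickProd_succ hn, fickProd_zero, one_mul]

omit [NeZero n] in
theorem fickProd_mulVec_nonneg (c a : ℕ → ℕ) (m : ℕ) {x : Fin n → ℝ} (hx : ∀ i, 0 ≤ x i) :
    ∀ i, 0 ≤ (fickProd n c a m).mulVec x i := pathMatrix_mulVec_nonneg _ _ hx

theorem lengthsAfter_fickProd (hn : 4 ≤ n) (c a : ℕ → ℕ) (m : ℕ) (x : Fin n → ℝ) :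
    lengthsAfter (fickPath n c a m) (ofPerm (fickPerm n)) ((fickProd n c a m).mulVec x) = x :=
  (goodPath_fickPath hn c a m).lengthsAfter_mulVec x

theorem fickProd_lengthsAfter (hn : 4 ≤ n) (c a : ℕ → ℕ) (m : ℕ) (x : Fin n → ℝ) :
    (fickProd n c a m).mulVec (lengthsAfter (fickPath n c a m) (ofPerm (fickPerm n)) x) = x :=
  (goodPath_fickPath hn c a m).mulVec_lengthsAfter x

theorem fickProd_injective (hn : 4 ≤ n) (c a : ℕ → ℕ) (m : ℕ) :
    Function.Injective (fickProd n c a m).mulVec :=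
  Function.LeftInverse.injective (lengthsAfter_fickProd hn c a m)

theorem fickProd_mulVec_eq (hn : 4 ≤ n) {p : ℝ} {c a : ℕ → ℕ} (hc : ∀ i, 0 < c i)
    (ha : ∀ i, (a i : ℝ) = p * c i) (m : ℕ) (x : Fin n → ℝ) :
    (fickProd n c a m).mulVec x = (∏ i ∈ Finset.range m, (c i : ℝ)) •
      perturbedProd (fickMain n p) (fickRest n) (fun i => ((c i : ℝ))⁻¹) m x := by
  induction m generalizing x with
  | zero => simp [fickProd_zero, perturbedProd]
  | succ m ih =>
    have hcm : (c m : ℝ) ≠ 0 := by exact_mod_cast (hc m).ne'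
    rw [fickProd_succ hn, ← Matrix.mulVec_mulVec, fickTheta_mulVec hn, ha, fickAct_eq hcm, ih,
      map_smul, smul_smul, Finset.prod_range_succ]
    rfl

theorem fickAct_nonneg {c a : ℝ} (hc : 0 ≤ c) (ha : 0 ≤ a) {x : Fin n → ℝ} (hx : ∀ i, 0 ≤ x i)
    (j : Fin n) : 0 ≤ fickAct c a x j := by
  have hS : 0 ≤ tailSum x := Finset.sum_nonneg fun _ _ => hx _
  have h0 := hx 0
  have hj := hx j
  have h1 := hx (Fin.ofNat n (j.val + 1))
  have h2 := hx (Fin.ofNat n (j.val - 1))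
  unfold fickAct
  split_ifs <;> positivity

/-- The first and last entries alone add up to `2 x_0 + (2c + 1) tailSum x`. This doubling is the
source of all contraction in the induction. -/
theorem two_mul_sum_le_sum_fickAct (hn : 4 ≤ n) {c a : ℝ} (hc : 1 ≤ c) (ha : 0 ≤ a)
    {x : Fin n → ℝ} (hx : ∀ i, 0 ≤ x i) : 2 * ∑ i, x i ≤ ∑ i, fickAct c a x i := by
  have hS : 0 ≤ tailSum x := Finset.sum_nonneg fun _ _ => hx _
  have hz : (Fin.ofNat n (n - 1)).val = n - 1 := val_ofNat (by omega)
  have hne : (0 : Fin n) ≠ Fin.ofNat n (n - 1) := by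
    intro e
    have := congrArg Fin.val e
    rw [hz] at this
    simp at this
    omega
  have h1 : ∑ i ∈ {0, Fin.ofNat n (n - 1)}, fickAct c a x i ≤ ∑ i, fickAct c a x i :=
    Finset.sum_le_sum_of_subset_of_nonneg (Finset.subset_univ _)
      fun i _ _ => fickAct_nonneg (by linarith) ha hx i
  rw [Finset.sum_pair hne] at h1
  have e1 : fickAct c a x 0 = x 0 + c * tailSum x := by simp [fickAct]
  have e2 : fickAct c a x (Fin.ofNat n (n - 1)) = x 0 + (c + 1) * tailSum x := by
    rw [fickAct, if_neg (by omega), if_pos hz]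
  rw [e1, e2] at h1
  have e3 := tailSum_eq_sum x
  nlinarith

theorem two_pow_mul_sum_le (hn : 4 ≤ n) {c a : ℕ → ℕ} (hc : ∀ i, 0 < c i) (m : ℕ)
    {x : Fin n → ℝ} (hx : ∀ i, 0 ≤ x i) :
    2 ^ m * ∑ i, x i ≤ ∑ i, (fickProd n c a m).mulVec x i := by
  induction m generalizing x with
  | zero => simp [fickProd_zero]
  | succ m ih =>
    have hcm : (1 : ℝ) ≤ c m := by exact_mod_cast hc m
    rw [fickProd_succ hn, ← Matrix.mulVec_mulVec, fickTheta_mulVec hn]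
    refine le_trans ?_ (ih (fickAct_nonneg (by positivity) (by positivity) hx))
    rw [pow_succ, mul_assoc]
    exact mul_le_mul_of_nonneg_left (two_mul_sum_le_sum_fickAct hn hcm (by positivity) hx)
      (by positivity)

omit [NeZero n] in
theorem sum_pos_of_ne_zero {x : Fin n → ℝ} (hx : ∀ i, 0 ≤ x i) (h : x ≠ 0) : 0 < ∑ i, x i := by
  refine lt_of_le_of_ne (Finset.sum_nonneg fun i _ => hx i) fun e => h ?_
  ext i
  exact (Finset.sum_eq_zero_iff_of_nonneg fun i _ => hx i).1 e.symm i (Finset.mem_univ i)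

/-- The vector divided by the sum of its entries. -/
noncomputable def normalizeSum (x : Fin n → ℝ) : Fin n → ℝ := (∑ i, x i)⁻¹ • x

omit [NeZero n] in
theorem normalizeSum_smul {r : ℝ} (hr : r ≠ 0) (x : Fin n → ℝ) :
    normalizeSum (r • x) = normalizeSum x := by
  simp only [normalizeSum, Pi.smul_apply, smul_eq_mul, ← Finset.mul_sum, smul_smul, mul_inv]
  congr 1
  field_simp

/-- Intermediate normalizations are positive scalars and cancel in the last one. The first cycle is
peeled off because `fickBarProd` recurses on the outermost factor. -/
theorem fickBarProd_eq (hn : 4 ≤ n) {c a : ℕ → ℕ} (hc : ∀ i, 0 < c i) (m : ℕ) {x : Fin n → ℝ}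
    (hx : ∀ i, 0 ≤ x i) (hx1 : ∑ i, x i = 1) :
    fickBarProd n m c a x = normalizeSum ((fickProd n c a m).mulVec x) := by
  induction m generalizing c a with
  | zero => simp [fickBarProd, fickProd_zero, normalizeSum, hx1]
  | succ m ih =>
    have h := two_pow_mul_sum_le (a := fun i => a (i + 1)) hn (fun i => hc (i + 1)) m hx
    have hr : (∑ i, (fickProd n (fun i => c (i + 1)) (fun i => a (i + 1)) m).mulVec x i)⁻¹ ≠ 0 := by
      rw [hx1] at h
      have : (0 : ℝ) < 2 ^ m * 1 := by positivity
      exact (inv_pos.2 (this.trans_le h)).ne'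
    rw [fickBarProd, ih (fun i => hc (i + 1)), fickThetaBar, add_comm m 1, fickProd_add hn,
      fickProd_one hn, ← Matrix.mulVec_mulVec]
    simp only [add_comm 1]
    change normalizeSum ((fickTheta n (c 0) (a 0)).mulVec (_ • _)) = _
    rw [Matrix.mulVec_smul, normalizeSum_smul hr]

end Products

/-- The perturbation argument needs a large initial parameter. Since `c` is unbounded it applies
after `M` cycles, and the injective matrix `Q` of those cycles transports the limits while
preserving their independence. -/
theorem exists_limits_fickProd {n : ℕ} [NeZero n] (hn : 4 ≤ n) {p : ℕ} (hp : 2 ≤ p) {c a : ℕ → ℕ}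
    (hc : ∀ i, 0 < c i) (hcs : ∀ i, c (i + 1) = p ^ 2 * c i) (ha : ∀ i, a i = p * c i) :
    ∃ V : Fin n → Fin n → ℝ, LinearIndependent ℝ (fun j : fickIndices n => V j) ∧
        ∃ s : ℕ → Fin n → ℝ, (∀ m i, 0 < s m i) ∧
          ∀ i, Tendsto (fun m => s m i • (fickProd n c a m).mulVec (Pi.single i 1)) atTop
            (𝓝 (V (fickTarget n i))) := by
  have hpR : (2 : ℝ) ≤ p := by exact_mod_cast hp
  obtain ⟨C, hC, h⟩ := exists_tendsto_perturbedProd_fick hn hpR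
  have hci : ∀ M i, (c (M + i) : ℝ) = c M * (p : ℝ) ^ (2 * i) := by
    intro M i
    induction i with
    | zero => simp
    | succ i ih =>
      rw [← Nat.add_assoc, hcs]
      push_cast
      rw [ih]; ring
  obtain ⟨M, hM⟩ : ∃ M, C ≤ c M := by
    obtain ⟨M, hM⟩ := pow_unbounded_of_one_lt C (show (1 : ℝ) < p by linarith)
    refine ⟨M, hM.le.trans ?_⟩
    have h0 := hci 0 M
    rw [Nat.zero_add] at h0
    rw [h0]
    have h1 : (1 : ℝ) ≤ c 0 := by exact_mod_cast hc 0
    have h2 : (p : ℝ) ^ M ≤ (p : ℝ) ^ (2 * M) := pow_le_pow_right₀ (by linarith) (by omega)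
    have h3 : (0 : ℝ) ≤ (p : ℝ) ^ (2 * M) := by positivity
    nlinarith
  obtain ⟨V, hV, s, hs, hlim⟩ := h (fun i => (c (M + i) : ℝ)) (by simpa using hM)
    (fun i => by simpa using hci M i)
  set Q := fickProd n c a M with hQ
  have hcM : ∀ i, 0 < (fun i => c (M + i)) i := fun i => hc _
  have haM : ∀ i, (((fun i => a (M + i)) i : ℕ) : ℝ) = p * ((fun i => c (M + i)) i : ℕ) := fun i => by
    simp only [ha]; push_cast; ring
  have hprod : ∀ m, 0 < ∏ i ∈ Finset.range m, (c (M + i) : ℝ) := fun m =>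
    Finset.prod_pos fun i _ => by exact_mod_cast hc _
  -- For `m < M` the difference `m - M` is `0`; these values are positive and do not influence the
  -- limit.
  refine ⟨fun j => Q.mulVec (V j), ?_, fun m i => s (m - M) i *
    (∏ i ∈ Finset.range (m - M), (c (M + i) : ℝ))⁻¹, fun m i => ?_, fun i => ?_⟩
  · refine hV.map' Q.mulVecLin (LinearMap.ker_eq_bot.2 ?_)
    exact fickProd_injective hn c a M
  · exact mul_pos (hs _ _) (inv_pos.2 (hprod _))
  · rw [← tendsto_add_atTop_iff_nat M]
    have hcont : Continuous Q.mulVec := Q.mulVecLin.continuous_of_finiteDimensional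
    refine ((hcont.tendsto _).comp (hlim i)).congr fun m => ?_
    simp only [Function.comp, Nat.add_sub_cancel]
    rw [add_comm m M, fickProd_add hn, ← Matrix.mulVec_mulVec, fickProd_mulVec_eq hn hcM haM,
      Matrix.mulVec_smul, Matrix.mulVec_smul, smul_smul, mul_assoc, inv_mul_cancel₀ (hprod m).ne',
      mul_one]

theorem tendsto_normalizeSum {n : ℕ} {f : ℕ → Fin n → ℝ} {x : Fin n → ℝ}
    (h : Tendsto f atTop (𝓝 x)) (hx : ∑ i, x i ≠ 0) :
    Tendsto (fun m => normalizeSum (f m)) atTop (𝓝 (normalizeSum x)) := by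
  have h1 : Tendsto (fun m => ∑ i, f m i) atTop (𝓝 (∑ i, x i)) :=
    tendsto_finsetSum _ fun i _ => (tendsto_pi_nhds.1 h) i
  exact (h1.inv₀ hx).smul h

theorem exists_limits_fickBarProd {n : ℕ} [NeZero n] (hn : 4 ≤ n) {p : ℕ} (hp : 2 ≤ p)
    {c a : ℕ → ℕ}
    (hc : ∀ i, 0 < c i) (hcs : ∀ i, c (i + 1) = p ^ 2 * c i) (ha : ∀ i, a i = p * c i) :
    ∃ v : Fin n → Fin n → ℝ, LinearIndependent ℝ (fun j : fickIndices n => v j) ∧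
      (∀ j ∈ fickIndices n, (∀ i, 0 ≤ v j i) ∧ ∑ i, v j i = 1) ∧
      ∀ i, Tendsto (fun m => fickBarProd n m c a (Pi.single i 1)) atTop
            (𝓝 (v (fickTarget n i))) := by
  obtain ⟨V, hV, s, hs, hlim⟩ := exists_limits_fickProd hn hp hc hcs ha
  have hsingle : ∀ i j : Fin n, 0 ≤ (Pi.single i 1 : Fin n → ℝ) j := fun i j => by
    rw [Pi.single_apply]; split_ifs <;> norm_num
  have hV0 : ∀ j ∈ fickIndices n, ∀ i, 0 ≤ V j i := by
    intro j hj i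
    have := hlim j
    rw [fickTarget_of_mem hn hj] at this
    refine ge_of_tendsto' ((tendsto_pi_nhds.1 this) i) fun m => ?_
    exact mul_nonneg (hs m j).le (fickProd_mulVec_nonneg c a m (hsingle j) i)
  -- Independence excludes the zero vector, so the sum is positive and normalization is continuous
  -- at the limit.
  have hVs : ∀ j ∈ fickIndices n, 0 < ∑ i, V j i := fun j hj =>
    sum_pos_of_ne_zero (hV0 j hj) (hV.ne_zero ⟨j, hj⟩)
  refine ⟨fun j => normalizeSum (V j), ?_, fun j hj => ⟨fun i => ?_, ?_⟩, fun i => ?_⟩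
  · exact hV.units_smul (w := fun j => Units.mk0 _ (inv_pos.2 (hVs j j.2)).ne')
  · exact mul_nonneg (inv_pos.2 (hVs j hj)).le (hV0 j hj i)
  · simp only [normalizeSum, Pi.smul_apply, smul_eq_mul, ← Finset.mul_sum]
    exact inv_mul_cancel₀ (hVs j hj).ne'
  · refine (tendsto_normalizeSum (hlim i) (hVs _ (fickTarget_mem hn i)).ne').congr fun m => ?_
    rw [normalizeSum_smul (hs m i).ne', fickBarProd_eq hn hc m (hsingle i) (by simp)]

theorem RauzyTable.continuous_lengthsAfter {n : ℕ} (ts : List Bool) (π : RauzyTable n) :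
    Continuous (lengthsAfter ts π) := by
  induction ts generalizing π with
  | nil => exact continuous_id
  | cons t ts ih =>
    refine (ih (π.move t)).comp ?_
    unfold newLengths
    split
    · exact continuous_id.update _ (by fun_prop)
    · exact continuous_id

/-! ### The cone of vectors that stay nonnegative along all cycles. -/

section Cone

variable {n : ℕ} [NeZero n]

theorem mem_fickCone_iff (hn : 4 ≤ n) {c a : ℕ → ℕ} {u : Fin n → ℝ} : u ∈ fickCone n c a ↔
    ∀ m i, 0 ≤ lengthsAfter (fickPath n c a m) (ofPerm (fickPerm n)) u i := by
  constructor
  · intro h m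
    obtain ⟨x, hx, rfl⟩ := h m
    rwa [lengthsAfter_fickProd hn]
  · intro h m
    exact ⟨_, h m, (fickProd_lengthsAfter hn c a m u).symm⟩

/-- For `m ≥ M`, undoing the first `M` cycles turns a column of the `m`-fold product into a column
of the remaining product, which is nonnegative. Undoing is continuous, so the limit inherits the
sign. -/
theorem mem_fickCone_of_tendsto (hn : 4 ≤ n) {c a : ℕ → ℕ} {r : ℕ → ℝ} (hr : ∀ m, 0 ≤ r m)
    {i : Fin n} {v : Fin n → ℝ}
    (h : Tendsto (fun m => r m • (fickProd n c a m).mulVec (Pi.single i 1)) atTop (𝓝 v)) :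
    v ∈ fickCone n c a := by
  rw [mem_fickCone_iff hn]
  intro M j
  have h1 := ((continuous_lengthsAfter (fickPath n c a M) (ofPerm (fickPerm n))).tendsto _).comp h
  refine ge_of_tendsto ((tendsto_pi_nhds.1 h1) j) ?_
  filter_upwards [eventually_ge_atTop M] with m hm
  obtain ⟨k, rfl⟩ := Nat.exists_eq_add_of_le hm
  simp only [Function.comp]
  rw [fickProd_add hn, ← Matrix.mulVec_mulVec, ← Matrix.mulVec_smul, lengthsAfter_fickProd hn]
  refine mul_nonneg (hr _) (fickProd_mulVec_nonneg _ _ _ (fun q => ?_) j)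
  rw [Pi.single_apply]; split_ifs <;> norm_num

theorem mem_fickCone_shift (hn : 4 ≤ n) {c a : ℕ → ℕ} {M : ℕ} {x : Fin n → ℝ}
    (h : (fickProd n c a M).mulVec x ∈ fickCone n c a) :
    x ∈ fickCone n (fun i => c (M + i)) (fun i => a (M + i)) := by
  intro m
  obtain ⟨y, hy, e⟩ := h (M + m)
  refine ⟨y, hy, fickProd_injective hn c a M ?_⟩
  rw [e, fickProd_add hn, Matrix.mulVec_mulVec]

theorem fickAct_ends_pos {c a : ℝ} (hn : 4 ≤ n) (hc : 0 < c) {x : Fin n → ℝ} (hx : ∀ i, 0 ≤ x i)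
    (h : 0 < ∑ i, x i) {j : Fin n} (hj : j.val = 0 ∨ j.val = n - 1) : 0 < fickAct c a x j := by
  have hS : 0 ≤ tailSum x := Finset.sum_nonneg fun _ _ => hx _
  have e := tailSum_eq_sum x
  have h0 := hx 0
  have h1 : 0 < x 0 + c * tailSum x := by
    rcases h0.lt_or_eq with h2 | h2
    · positivity
    · have : 0 < tailSum x := by linarith
      positivity
  unfold fickAct
  by_cases h2 : j.val = 0
  · rw [if_pos h2]; exact h1
  · rw [if_neg h2, if_pos (by omega)]; linarith

/-- Three cycles suffice. The innermost makes the two end entries positive, the next one all odd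
entries through `tailSum`, and the outermost the even entries too, through `a * x_{j-1}`. -/
theorem fickCone_pos (hn : 4 ≤ n) {c a : ℕ → ℕ} (hc : ∀ i, 0 < c i) (ha : ∀ i, 0 < a i)
    {u : Fin n → ℝ} (h : u ∈ fickCone n c a) (hu : u ≠ 0) : ∀ i, 0 < u i := by
  obtain ⟨x, hx, rfl⟩ := h 3
  have hx0 : 0 < ∑ i, x i := sum_pos_of_ne_zero hx fun e => hu (by rw [e, Matrix.mulVec_zero])
  have e3 : (fickProd n c a 3).mulVec x =
      fickAct (c 0) (a 0) (fickAct (c 1) (a 1) (fickAct (c 2) (a 2) x)) := by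
    rw [fickProd_succ hn, fickProd_succ hn, fickProd_one hn, ← Matrix.mulVec_mulVec,
      ← Matrix.mulVec_mulVec]
    simp only [fickTheta_mulVec hn]
  rw [e3]
  have hcR : ∀ i, (0 : ℝ) < c i := fun i => by exact_mod_cast hc i
  have haR : ∀ i, (0 : ℝ) < a i := fun i => by exact_mod_cast ha i
  set y := fickAct (c 2 : ℝ) (a 2) x
  have hy : ∀ i, 0 ≤ y i := fickAct_nonneg (hcR 2).le (haR 2).le hx
  have hlast : (Fin.ofNat n (n - 1)).val = n - 1 := val_ofNat (by omega)
  have hyl : 0 < y (Fin.ofNat n (n - 1)) := fickAct_ends_pos hn (hcR 2) hx hx0 (Or.inr hlast)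
  have hyS : 0 < tailSum y := by
    refine hyl.trans_le (Finset.single_le_sum (f := fun t => y (Fin.ofNat n t))
      (fun _ _ => hy _) (Finset.mem_Ico.2 ⟨by omega, by omega⟩))
  have hys : 0 < ∑ i, y i := hyl.trans_le (Finset.single_le_sum (f := y)
      (fun _ _ => hy _) (Finset.mem_univ _))
  set z := fickAct (c 1 : ℝ) (a 1) y with hz
  have hz0 : ∀ i, 0 ≤ z i := fickAct_nonneg (hcR 1).le (haR 1).le hy
  have hzodd : ∀ i : Fin n, i.val % 2 = 1 → 0 < z i := by
    intro i hi
    by_cases h1 : i.val = n - 1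
    · exact fickAct_ends_pos hn (hcR 1) hy hys (Or.inr h1)
    · rw [hz]
      unfold fickAct
      rw [if_neg (by omega), if_neg h1, if_pos hi]
      have a1 := hy i
      have a2 := hy (Fin.ofNat n (i.val + 1))
      split_ifs <;> linarith
  have hzS : 0 < tailSum z := by
    have h1 : (Fin.ofNat n 1).val = 1 := val_ofNat (by omega)
    refine (hzodd (Fin.ofNat n 1) (by rw [h1])).trans_le
      (Finset.single_le_sum (f := fun t => z (Fin.ofNat n t))
      (fun _ _ => hz0 _) (Finset.mem_Ico.2 ⟨by omega, by omega⟩))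
  have hzs : 0 < ∑ i, z i := by
    have e := tailSum_eq_sum z
    have := hz0 0
    linarith
  intro i
  have hi := i.isLt
  by_cases h1 : i.val = 0 ∨ i.val = n - 1
  · exact fickAct_ends_pos hn (hcR 0) hz0 hzs h1
  · unfold fickAct
    rw [if_neg (by omega), if_neg (by omega)]
    have a1 := hz0 i
    split_ifs with h2 h3
    · have a2 := hz0 (Fin.ofNat n (i.val + 1))
      linarith
    · linarith
    · have h4 : (Fin.ofNat n (i.val - 1)).val = i.val - 1 := val_ofNat (by omega)
      have a2 := hzodd (Fin.ofNat n (i.val - 1)) (by rw [h4]; omega)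
      have a3 := mul_pos (haR 0) a2
      have a4 := mul_nonneg (haR 0).le a1
      nlinarith

theorem follows_of_mem_fickCone (hn : 4 ≤ n) {c a : ℕ → ℕ} (hc : ∀ i, 0 < c i) (ha : ∀ i, 0 < a i)
    {u : Fin n → ℝ} (h : u ∈ fickCone n c a) (hu : u ≠ 0) : FollowsFickCycles n c a u := by
  intro m
  have hx := mem_fickCone_shift (M := m) (x := lengthsAfter (fickPath n c a m)
    (ofPerm (fickPerm n)) u) hn (by rwa [fickProd_lengthsAfter hn])
  have hpos := fickCone_pos hn (fun i => hc _) (fun i => ha _) hx fun e => hu (by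
    rw [← fickProd_lengthsAfter hn c a m u, e, Matrix.mulVec_zero])
  have := ((goodPath_fickPath hn c a m).follows_mulVec hpos).1
  rw [← fickProd, fickProd_lengthsAfter hn] at this
  exact this

/-- For each `m`, `u` is a nonnegative combination of the normalized columns. These have sum `1`, so
the coefficients add up to the sum of `u` and stay in a compact set. In the limit along a
subsequence the columns become the `v j`, and coefficients with the same target are added. -/
theorem exists_eq_sum_of_mem_fickCone (hn : 4 ≤ n) {c a : ℕ → ℕ} (hc : ∀ i, 0 < c i)
    {v : Fin n → Fin n → ℝ} (hv : ∀ i, Tendsto (fun m => fickBarProd n m c a (Pi.single i 1)) atTop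
            (𝓝 (v (fickTarget n i)))) {u : Fin n → ℝ} (hu : u ∈ fickCone n c a) :
    ∃ t : fickIndices n → ℝ, (∀ j, 0 ≤ t j) ∧ u = ∑ j, t j • v j := by
  have hsingle : ∀ i j : Fin n, 0 ≤ (Pi.single i 1 : Fin n → ℝ) j := fun i j => by
    rw [Pi.single_apply]; split_ifs <;> norm_num
  set q : ℕ → Fin n → Fin n → ℝ := fun m i => fickBarProd n m c a (Pi.single i 1) with hq
  have hS : ∀ m i, 0 < ∑ j, (fickProd n c a m).mulVec (Pi.single i 1) j := fun m i => by
    refine lt_of_lt_of_le ?_ (two_pow_mul_sum_le hn hc m (hsingle i))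
    simp
  have hqe : ∀ m i, q m i = (∑ j, (fickProd n c a m).mulVec (Pi.single i 1) j)⁻¹ •
      (fickProd n c a m).mulVec (Pi.single i 1) := fun m i =>
    fickBarProd_eq hn hc m (hsingle i) (by simp)
  have hq1 : ∀ m i, ∑ j, q m i j = 1 := fun m i => by
    rw [hqe]
    simp only [Pi.smul_apply, smul_eq_mul, ← Finset.mul_sum]
    exact inv_mul_cancel₀ (hS m i).ne'
  have hX : ∀ m, ∃ X : Fin n → ℝ, (∀ i, 0 ≤ X i) ∧ u = ∑ i, X i • q m i := by
    intro m
    obtain ⟨x, hx, e⟩ := hu m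
    refine ⟨fun i => x i * ∑ j, (fickProd n c a m).mulVec (Pi.single i 1) j,
      fun i => mul_nonneg (hx i) (hS m i).le, ?_⟩
    have e2 : x = ∑ i, x i • Pi.single i (1 : ℝ) := by
      ext j
      simp [Finset.sum_apply, Pi.single_apply]
    rw [e]
    conv_lhs => rw [e2]
    rw [← Matrix.mulVecLin_apply, map_sum]
    refine Finset.sum_congr rfl fun i _ => ?_
    rw [map_smul, Matrix.mulVecLin_apply, hqe, smul_smul, mul_assoc, mul_inv_cancel₀ (hS m i).ne',
      mul_one]
  choose X hX0 hXu using hX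
  have hbound : ∀ m, X m ∈ Set.Icc (0 : Fin n → ℝ) (fun _ => ∑ j, u j) := by
    intro m
    refine ⟨fun i => hX0 m i, fun i => ?_⟩
    have : ∑ j, u j = ∑ i, X m i := by
      conv_lhs => rw [hXu m]
      simp only [Finset.sum_apply, Pi.smul_apply, smul_eq_mul]
      rw [Finset.sum_comm]
      simp only [← Finset.mul_sum, hq1, mul_one]
    rw [this]
    exact Finset.single_le_sum (fun i _ => hX0 m i) (Finset.mem_univ i)
  obtain ⟨Y, hY, φ, hφ, hlim⟩ := isCompact_Icc.tendsto_subseq hbound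
  have e : u = ∑ i, Y i • v (fickTarget n i) := by
    refine tendsto_nhds_unique (f := fun m => ∑ i, X (φ m) i • q (φ m) i) (l := atTop) ?_ ?_
    · simp only [← hXu]; exact tendsto_const_nhds
    · exact tendsto_finsetSum _ fun i _ =>
        ((tendsto_pi_nhds.1 hlim) i).smul ((hv i).comp hφ.tendsto_atTop)
  refine ⟨fun j => ∑ i with fickTarget n i = j, Y i, fun j => Finset.sum_nonneg fun i _ => hY.1 i, ?_⟩
  rw [e, ← Finset.sum_fiberwise_of_maps_to (t := fickIndices n) (g := fickTarget n)
    (fun i _ => fickTarget_mem hn i), ← Finset.sum_coe_sort]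
  refine Finset.sum_congr rfl fun j _ => ?_
  rw [Finset.sum_smul]
  refine Finset.sum_congr rfl fun i hi => ?_
  rw [(Finset.mem_filter.1 hi).2]

/-- The limit vectors span extreme rays of the cone. -/
theorem eq_of_add_eq_limit (hn : 4 ≤ n) {c a : ℕ → ℕ} (hc : ∀ i, 0 < c i)
    {v : Fin n → Fin n → ℝ} (hv : ∀ i, Tendsto (fun m => fickBarProd n m c a (Pi.single i 1)) atTop
            (𝓝 (v (fickTarget n i))))
    (hli : LinearIndependent ℝ (fun j : fickIndices n => v j))
    {j : Fin n} (hj : j ∈ fickIndices n) {u w : Fin n → ℝ} (hu : u ∈ fickCone n c a)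
    (hw : w ∈ fickCone n c a) (h : u + w = v j) : ∃ t : ℝ, u = t • v j := by
  obtain ⟨t, ht, rfl⟩ := exists_eq_sum_of_mem_fickCone hn hc hv hu
  obtain ⟨s, hs, rfl⟩ := exists_eq_sum_of_mem_fickCone hn hc hv hw
  rw [← Finset.sum_add_distrib] at h
  simp only [← add_smul] at h
  -- By independence `t i + s i` is `1` at `j` and `0` elsewhere; as both are nonnegative, `t` is
  -- supported at `j`.
  have h1 : ∑ i : fickIndices n, (t i + s i - if i = ⟨j, hj⟩ then 1 else 0) • v i = 0 := by
    simp only [sub_smul, Finset.sum_sub_distrib, h, ite_smul, one_smul, zero_smul,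
      Finset.sum_ite_eq', Finset.mem_univ, if_true, sub_self]
  have h2 := Fintype.linearIndependent_iff.1 hli _ h1
  refine ⟨t ⟨j, hj⟩, Finset.sum_eq_single _ (fun i _ hi => ?_) (by simp)⟩
  have h3 := h2 i
  rw [if_neg hi] at h3
  rw [show t i = 0 by linarith [ht i, hs i], zero_smul]

theorem card_fickIndices (hn : 4 ≤ n) : (fickIndices n).card = n / 2 := by
  have h : fickIndices n = (Finset.Icc 1 (n / 2)).image
      (fun i => if i = n / 2 then Fin.ofNat n (n - 1) else Fin.ofNat n (2 * i)) := by
    ext j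
    rw [mem_fickIndices hn, Finset.mem_image]
    have hj := j.isLt
    constructor
    · rintro (h | h)
      · refine ⟨j.val / 2, Finset.mem_Icc.2 ⟨by omega, by omega⟩, ?_⟩
        rw [if_neg (by omega), show 2 * (j.val / 2) = j.val by omega, ofNat_val]
      · refine ⟨n / 2, Finset.mem_Icc.2 ⟨by omega, by omega⟩, ?_⟩
        rw [if_pos rfl, ← h, ofNat_val]
    · rintro ⟨i, hi, rfl⟩
      rw [Finset.mem_Icc] at hi
      split_ifs with h
      · right; exact val_ofNat (by omega)
      · left; rw [val_ofNat (by omega)]; omega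
  rw [h, Finset.card_image_of_injOn]
  · simp
  · intro i hi k hk e
    simp only [Finset.coe_Icc, Set.mem_Icc] at hi hk
    have e' := congrArg Fin.val e
    simp only at e'
    split_ifs at e' <;> first | omega | (rw [val_ofNat (by omega), val_ofNat (by omega)] at e'; omega)

end Cone

/-! ### Positions of the intervals and their change in a Rauzy move. -/

section ListPos

variable {n : ℕ}

/-- The left endpoint of the interval of the letter `i` when consecutive intervals of lengths `ℓ`
are placed in the order of the list. -/
def listPos : List (Fin n) → (Fin n → ℝ) → Fin n → ℝ
  | [], _, _ => 0
  | x :: L, ℓ, i => if x = i then 0 else ℓ x + listPos L ℓ i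

theorem listPos_append_of_mem {A B : List (Fin n)} {i : Fin n} (h : i ∈ A) (ℓ : Fin n → ℝ) :
    listPos (A ++ B) ℓ i = listPos A ℓ i := by
  induction A with
  | nil => simp at h
  | cons x A ih =>
    simp only [List.cons_append, listPos]
    split_ifs with hx
    · rfl
    · rw [ih ((List.mem_cons.1 h).resolve_left (Ne.symm hx))]

theorem listPos_append_of_notMem {A B : List (Fin n)} {i : Fin n} (h : i ∉ A) (ℓ : Fin n → ℝ) :
    listPos (A ++ B) ℓ i = (A.map ℓ).sum + listPos B ℓ i := by
  induction A with
  | nil => simp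
  | cons x A ih =>
    simp only [List.mem_cons, not_or] at h
    simp only [List.cons_append, listPos, if_neg (Ne.symm h.1), ih h.2, List.map_cons,
      List.sum_cons]
    ring

theorem listPos_congr {L : List (Fin n)} {ℓ ℓ' : Fin n → ℝ} (h : ∀ x ∈ L, ℓ x = ℓ' x) (i : Fin n) :
    listPos L ℓ i = listPos L ℓ' i := by
  induction L with
  | nil => rfl
  | cons x L ih =>
    simp only [listPos, h x (by simp), ih fun y hy => h y (by simp [hy])]

theorem listPos_cons_self (x : Fin n) (L : List (Fin n)) (ℓ : Fin n → ℝ) :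
    listPos (x :: L) ℓ x = 0 := by simp [listPos]

theorem listPos_cons_of_ne {x i : Fin n} (h : x ≠ i) (L : List (Fin n)) (ℓ : Fin n → ℝ) :
    listPos (x :: L) ℓ i = ℓ x + listPos L ℓ i := by simp [listPos, h]

theorem listPos_nonneg {ℓ : Fin n → ℝ} (hℓ : ∀ i, 0 ≤ ℓ i) (L : List (Fin n)) (i : Fin n) :
    0 ≤ listPos L ℓ i := by
  induction L with
  | nil => rfl
  | cons x L ih =>
    unfold listPos
    split_ifs
    · rfl
    · exact add_nonneg (hℓ x) ih

/-- A list that contains every letter exactly once. -/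
def IsOrder (L : List (Fin n)) : Prop := L.Nodup ∧ ∀ i, i ∈ L

theorem IsOrder.sum_map {L : List (Fin n)} (h : IsOrder L) (ℓ : Fin n → ℝ) :
    (L.map ℓ).sum = ∑ i, ℓ i := by
  rw [← List.sum_toFinset _ h.1]
  congr 1
  ext i
  simp [h.2 i]

theorem listPos_add_le {L : List (Fin n)} {ℓ : Fin n → ℝ} (hℓ : ∀ i, 0 ≤ ℓ i) {i : Fin n}
    (hi : i ∈ L) : listPos L ℓ i + ℓ i ≤ (L.map ℓ).sum := by
  induction L with
  | nil => simp at hi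
  | cons x L ih =>
    simp only [listPos, List.map_cons, List.sum_cons]
    have hs : 0 ≤ (L.map ℓ).sum := List.sum_nonneg fun y hy => by
      obtain ⟨z, -, rfl⟩ := List.mem_map.1 hy
      exact hℓ z
    split_ifs with hx
    · subst hx; linarith
    · have := ih ((List.mem_cons.1 hi).resolve_left (Ne.symm hx))
      linarith

theorem exists_mem_listPos {L : List (Fin n)} {ℓ : Fin n → ℝ} (hL : L.Nodup) {x : ℝ} (hx : 0 ≤ x)
    (hx' : x < (L.map ℓ).sum) : ∃ i ∈ L, listPos L ℓ i ≤ x ∧ x < listPos L ℓ i + ℓ i := by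
  induction L generalizing x with
  | nil => simp at hx'; linarith
  | cons y L ih =>
    rw [List.nodup_cons] at hL
    simp only [List.map_cons, List.sum_cons] at hx'
    by_cases h : x < ℓ y
    · exact ⟨y, by simp, by simpa [listPos] using hx, by simpa [listPos] using h⟩
    · obtain ⟨i, hi, h1, h2⟩ := ih hL.2 (x := x - ℓ y) (by linarith) (by linarith)
      have hne : y ≠ i := fun e => hL.1 (e ▸ hi)
      refine ⟨i, by simp [hi], ?_, ?_⟩ <;> rw [listPos_cons_of_ne hne] <;> linarith

theorem listPos_disjoint {L : List (Fin n)} {ℓ : Fin n → ℝ} (hℓ : ∀ i, 0 ≤ ℓ i) {i j : Fin n}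
    (hi : i ∈ L) (hj : j ∈ L) (hij : i ≠ j) :
    listPos L ℓ i + ℓ i ≤ listPos L ℓ j ∨ listPos L ℓ j + ℓ j ≤ listPos L ℓ i := by
  induction L with
  | nil => simp at hi
  | cons y L ih =>
    have a1 := listPos_nonneg hℓ L i
    have a2 := listPos_nonneg hℓ L j
    by_cases hyi : y = i
    · subst hyi
      rw [listPos_cons_self, listPos_cons_of_ne hij]; left; linarith
    by_cases hyj : y = j
    · subst hyj
      rw [listPos_cons_self, listPos_cons_of_ne hyi]; right; linarith
    rw [listPos_cons_of_ne hyi, listPos_cons_of_ne hyj]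
    rcases ih ((List.mem_cons.1 hi).resolve_left (Ne.symm hyi))
      ((List.mem_cons.1 hj).resolve_left (Ne.symm hyj)) with h | h
    · left; linarith
    · right; linarith

/-- How the positions change in a Rauzy move in which `w` wins and `l` loses: `w` is the last letter
of the first row and `l` the last letter of the second row. -/
structure PosStep (la lb la' lb' : (Fin n → ℝ) → Fin n → ℝ) (w l : Fin n) : Prop where
  ne : w ≠ l
  winnerRow : ∀ x i, la' (Function.update x w (x w - x l)) i = la x i
  loserRow : ∀ x i, i ≠ l → lb' (Function.update x w (x w - x l)) i = lb x i
  loser : ∀ x, lb' (Function.update x w (x w - x l)) l = lb x w + x w - x l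
  winner_end : ∀ x, la x w + x w = ∑ i, x i
  loser_end : ∀ x, lb x l + x l = ∑ i, x i

theorem sum_update_sub {w l : Fin n} (x : Fin n → ℝ) :
    ∑ i, Function.update x w (x w - x l) i = ∑ i, x i - x l := by
  rw [Finset.sum_update_of_mem (Finset.mem_univ w),
    ← Finset.add_sum_erase Finset.univ x (Finset.mem_univ w), Finset.sdiff_singleton_eq_erase]
  ring

/-- In its own row the winner is last, so shortening it moves no left endpoint. In the other row the
loser fills the gap that the shortened winner leaves, so the letters behind it stay in place. -/
theorem posStep_of_lists {A B D : List (Fin n)} {w l : Fin n} (hB : IsOrder (B ++ [w]))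
    (hA : IsOrder (A ++ w :: (D ++ [l]))) :
    PosStep (listPos (B ++ [w])) (listPos (A ++ w :: (D ++ [l]))) (listPos (B ++ [w]))
      (listPos (A ++ w :: l :: D)) w l := by
  have hA1 := hA.1
  have hB1 := hB.1
  simp only [List.nodup_append, List.nodup_cons, List.mem_cons, List.mem_append, not_or] at hA1 hB1
  have hwA : w ∉ A := fun h => hA1.2.2 w h w (Or.inl rfl) rfl
  have hlA : l ∉ A := fun h => hA1.2.2 l h l (by simp) rfl
  have hwD : w ∉ D := hA1.2.1.1.1
  have hlD : l ∉ D := fun h => hA1.2.1.2.2.2 l h l (by simp) rfl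
  have hwl : w ≠ l := fun h => hA1.2.1.1.2.1 h
  have hwB : w ∉ B := fun h => hB1.2.2 w h w (by simp) rfl
  have hcongr : ∀ (L : List (Fin n)) (x : Fin n → ℝ), w ∉ L → ∀ y ∈ L,
      Function.update x w (x w - x l) y = x y := by
    intro L x hL y hy
    rw [Function.update_of_ne]
    rintro rfl
    exact hL hy
  refine ⟨hwl, fun x i => ?_, fun x i hi => ?_, fun x => ?_, fun x => ?_, fun x => ?_⟩
  · by_cases h : i ∈ B
    · rw [listPos_append_of_mem h, listPos_append_of_mem h, listPos_congr (hcongr B x hwB)]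
    · rw [listPos_append_of_notMem h, listPos_append_of_notMem h,
        List.map_congr_left (hcongr B x hwB)]
      have : i = w := by
        have := hB.2 i
        simp only [List.mem_append, List.mem_singleton] at this
        exact this.resolve_left h
      rw [this, listPos_cons_self, listPos_cons_self]
  · by_cases h : i ∈ A
    · rw [listPos_append_of_mem h, listPos_append_of_mem h, listPos_congr (hcongr A x hwA)]
    · rw [listPos_append_of_notMem h, listPos_append_of_notMem h,
        List.map_congr_left (hcongr A x hwA)]
      by_cases hw : w = i
      · rw [hw, listPos_cons_self, listPos_cons_self]
      · rw [listPos_cons_of_ne hw, listPos_cons_of_ne hw, listPos_cons_of_ne (Ne.symm hi)]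
        have hD : i ∈ D := by
          have := hA.2 i
          simp only [List.mem_append, List.mem_cons, List.not_mem_nil, or_false] at this
          tauto
        rw [listPos_append_of_mem hD, listPos_congr (hcongr D x hwD), Function.update_self,
          Function.update_of_ne hwl.symm]
        ring
  · rw [listPos_append_of_notMem hlA, listPos_append_of_notMem hwA,
      List.map_congr_left (hcongr A x hwA), listPos_cons_of_ne hwl, listPos_cons_self,
      listPos_cons_self, Function.update_self]
    ring
  · rw [listPos_append_of_notMem hwB, listPos_cons_self, ← hB.sum_map]
    simp
  · rw [listPos_append_of_notMem hlA, listPos_cons_of_ne hwl, listPos_append_of_notMem hlD,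
      listPos_cons_self, ← hA.sum_map]
    simp
    ring

theorem IsOrder.rotate {A D : List (Fin n)} {w l : Fin n} (h : IsOrder (A ++ w :: (D ++ [l]))) :
    IsOrder (A ++ w :: l :: D) := by
  have hp : (A ++ w :: (D ++ [l])).Perm (A ++ w :: l :: D) :=
    ((List.perm_append_singleton l D).cons w).append_left A
  exact ⟨hp.nodup_iff.1 h.1, fun i => hp.mem_iff.1 (h.2 i)⟩

theorem IsOrder.eq_append_cons {L : List (Fin n)} (h : IsOrder L) {w l : Fin n}
    (hl : L.getLast? = some l) (hwl : w ≠ l) : ∃ A D, L = A ++ w :: (D ++ [l]) := by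
  obtain ⟨L', rfl⟩ := List.getLast?_eq_some_iff.1 hl
  have hw : w ∈ L' := by
    have := h.2 w
    simp only [List.mem_append, List.mem_singleton] at this
    exact this.resolve_right hwl
  obtain ⟨A, D, rfl⟩ := List.append_of_mem hw
  exact ⟨A, D, by simp⟩

/-- Both rows of the table contain every letter exactly once. -/
def RauzyTable.IsValid (π : RauzyTable n) : Prop := IsOrder π.top ∧ IsOrder π.bot

theorem RauzyTable.IsValid.move_false {π : RauzyTable n} (h : π.IsValid) {w l : Fin n}
    (hw : π.winner false = some w) (hl : π.loser false = some l) (hwl : w ≠ l) :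
    (π.move false).IsValid ∧ PosStep (listPos π.top) (listPos π.bot) (listPos (π.move false).top)
      (listPos (π.move false).bot) w l := by
  obtain ⟨T, B⟩ := π
  obtain ⟨hT, hB⟩ := h
  obtain ⟨A, D, rfl⟩ := hB.eq_append_cons (w := w) hl hwl
  obtain ⟨T', rfl⟩ := List.getLast?_eq_some_iff.1 hw
  have hA1 := hB.1
  simp only [List.nodup_append, List.nodup_cons, List.mem_cons, List.mem_append, not_or] at hA1
  have hwA : w ∉ A := fun h => hA1.2.2 w h w (Or.inl rfl) rfl
  rw [show (move false ⟨T' ++ [w], A ++ w :: (D ++ [l])⟩) = ⟨T' ++ [w], A ++ w :: l :: D⟩ from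
    (leads_false hwA hwl).2.1]
  exact ⟨⟨hT, hB.rotate⟩, posStep_of_lists hT hB⟩

theorem RauzyTable.IsValid.move_true {π : RauzyTable n} (h : π.IsValid) {w l : Fin n}
    (hw : π.winner true = some w) (hl : π.loser true = some l) (hwl : w ≠ l) :
    (π.move true).IsValid ∧ PosStep (listPos π.bot) (listPos π.top) (listPos (π.move true).bot)
      (listPos (π.move true).top) w l := by
  obtain ⟨T, B⟩ := π
  obtain ⟨hT, hB⟩ := h
  obtain ⟨A, D, rfl⟩ := hT.eq_append_cons (w := w) hl hwl
  obtain ⟨B', rfl⟩ := List.getLast?_eq_some_iff.1 hw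
  have hA1 := hT.1
  simp only [List.nodup_append, List.nodup_cons, List.mem_cons, List.mem_append, not_or] at hA1
  have hwA : w ∉ A := fun h => hA1.2.2 w h w (Or.inl rfl) rfl
  rw [show (move true ⟨A ++ w :: (D ++ [l]), B' ++ [w]⟩) = ⟨A ++ w :: l :: D, B' ++ [w]⟩ from
    (leads_true hwA hwl).2.1]
  exact ⟨⟨hT.rotate, hB⟩, posStep_of_lists hB hT⟩

end ListPos

/-! ### Conjugacies of two interval exchanges through one Rauzy move. -/

section Conj

variable {n : ℕ}

/-- `F` maps the top intervals of lengths `ℓ` onto those of lengths `u`, and conjugates the two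
interval exchanges up to an error `ε`. -/
structure IsApproxConj (lt lb : (Fin n → ℝ) → Fin n → ℝ) (ℓ u : Fin n → ℝ) (ε : ℝ) (F : ℝ → ℝ) :
    Prop where
  total : F (∑ i, ℓ i) = ∑ i, u i
  left : ∀ i, F (lt ℓ i) = lt u i
  right : ∀ i, F (lt ℓ i + ℓ i) = lt u i + u i
  near : ∀ i t, 0 ≤ t → t ≤ ℓ i → |(F (lt ℓ i + t) - lt u i) - (F (lb ℓ i + t) - lb u i)| ≤ ε

/-- The extension of `F` from `[0, S]`, translated from the right of `p`. -/
noncomputable def translateExtend (S p : ℝ) (F : ℝ → ℝ) (y : ℝ) : ℝ :=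
  if y ≤ S then F y else F S + (F (p + (y - S)) - F p)

theorem translateExtend_of_le {S p : ℝ} {F : ℝ → ℝ} {y : ℝ} (h : y ≤ S) : translateExtend S p F y = F y :=
  if_pos h

theorem translateExtend_of_ge {S p : ℝ} {F : ℝ → ℝ} {y : ℝ} (h : S ≤ y) :
    translateExtend S p F y = F S + (F (p + (y - S)) - F p) := by
  unfold translateExtend
  split_ifs with h'
  · rw [le_antisymm h' h]; simp
  · rfl

theorem continuous_translateExtend {S p : ℝ} {F : ℝ → ℝ} (h : Continuous F) :
    Continuous (translateExtend S p F) := by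
  unfold translateExtend
  refine Continuous.if_le h (by fun_prop) continuous_id continuous_const ?_
  intro y hy
  simp [hy]

theorem monotone_translateExtend {S p : ℝ} {F : ℝ → ℝ} (h : Monotone F) :
    Monotone (translateExtend S p F) := by
  intro x y hxy
  rcases le_total y S with h1 | h1
  · rw [translateExtend_of_le h1, translateExtend_of_le (hxy.trans h1)]; exact h hxy
  rcases le_total x S with h2 | h2
  · rw [translateExtend_of_le h2, translateExtend_of_ge h1]
    have := h h2
    have := h (show p ≤ p + (y - S) by linarith)
    linarith
  · rw [translateExtend_of_ge h2, translateExtend_of_ge h1]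
    have := h (show p + (x - S) ≤ p + (y - S) by linarith)
    linarith

variable {lt lb lt' lb' : (Fin n → ℝ) → Fin n → ℝ} {w l : Fin n} {ℓ u ℓ' u' : Fin n → ℝ}

/-- The removed piece at the right end is the image of the top interval of `l`, so `F` must have the
same increments on both; hence the base point `lt' ℓ' l`. Each closeness condition is then either
exact or a single condition of the induced exchange, so `ε` does not accumulate. -/
theorem IsApproxConj.extend_false (h : PosStep lt lb lt' lb' w l)
    (hℓ' : Function.update ℓ w (ℓ w - ℓ l) = ℓ') (hu' : Function.update u w (u w - u l) = u')
    (hpos : ∀ i, 0 ≤ ℓ' i) (hT : ∀ i, lt' ℓ' i + ℓ' i ≤ ∑ i, ℓ' i)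
    (hB : ∀ i, lb' ℓ' i + ℓ' i ≤ ∑ i, ℓ' i) {ε : ℝ} (hε : 0 ≤ ε) {F : ℝ → ℝ}
    (hF : IsApproxConj lt' lb' ℓ' u' ε F) :
    IsApproxConj lt lb ℓ u ε (translateExtend (∑ i, ℓ' i) (lt' ℓ' l) F) := by
  obtain ⟨htot, hleft, hright, hnear⟩ := hF
  have hne := h.ne
  have lw : ℓ' w = ℓ w - ℓ l := by rw [← hℓ', Function.update_self]
  have uw : u' w = u w - u l := by rw [← hu', Function.update_self]
  have li : ∀ i, i ≠ w → ℓ' i = ℓ i := fun i hi => by rw [← hℓ', Function.update_of_ne hi]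
  have ui : ∀ i, i ≠ w → u' i = u i := fun i hi => by rw [← hu', Function.update_of_ne hi]
  have sl : ∑ i, ℓ' i = ∑ i, ℓ i - ℓ l := by rw [← hℓ']; exact sum_update_sub ℓ
  have su : ∑ i, u' i = ∑ i, u i - u l := by rw [← hu']; exact sum_update_sub u
  have tl : ∀ i, lt' ℓ' i = lt ℓ i := fun i => by rw [← hℓ']; exact h.winnerRow ℓ i
  have tu : ∀ i, lt' u' i = lt u i := fun i => by rw [← hu']; exact h.winnerRow u i
  have bl : ∀ i, i ≠ l → lb' ℓ' i = lb ℓ i := fun i hi => by rw [← hℓ']; exact h.loserRow ℓ i hi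
  have bu : ∀ i, i ≠ l → lb' u' i = lb u i := fun i hi => by rw [← hu']; exact h.loserRow u i hi
  have bll : lb' ℓ' l = lb ℓ w + ℓ' w := by rw [lw, ← hℓ', h.loser]; ring
  have bul : lb' u' l = lb u w + u' w := by rw [uw, ← hu', h.loser]; ring
  have wel := h.winner_end ℓ
  have weu := h.winner_end u
  have lel := h.loser_end ℓ
  have leu := h.loser_end u
  have ll := li l hne.symm
  have ul := ui l hne.symm
  set S := ∑ i, ℓ' i with hS
  have e1 : ∀ y, y ≤ S → translateExtend S (lt' ℓ' l) F y = F y := fun y hy => translateExtend_of_le hy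
  have e2 : ∀ s, 0 ≤ s → translateExtend S (lt' ℓ' l) F (S + s) =
      (∑ i, u' i) + (F (lt ℓ l + s) - lt u l) := fun s hs => by
    rw [translateExtend_of_ge (by linarith), htot, hleft, tl, tu]
    simp
  have hl0 : 0 ≤ ℓ l := ll ▸ hpos l
  have hTi : ∀ i, lt ℓ i ≤ S := fun i => by
    have := hT i; have := hpos i; have := tl i; linarith
  have hend : translateExtend S (lt' ℓ' l) F (∑ i, ℓ i) = ∑ i, u i := by
    rw [show ∑ i, ℓ i = S + ℓ l by linarith, e2 _ hl0]
    have := hright l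
    rw [tl, tu, ll, ul] at this
    rw [this]; linarith
  refine ⟨hend, fun i => ?_, fun i => ?_, fun i t ht0 ht => ?_⟩
  · rw [e1 _ (hTi i), ← tl, hleft, tu]
  · by_cases hi : i = w
    · subst hi
      rw [wel, hend, weu]
    · rw [← li i hi, ← tl, e1 _ (hT i), hright, tu, ui i hi]
  · by_cases hil : i = l
    · subst hil
      rw [show lb ℓ i + t = S + t by linarith, e2 t ht0, e1]
      · rw [show F (lt ℓ i + t) - lt u i - (∑ j, u' j + (F (lt ℓ i + t) - lt u i) - lb u i) = 0 by
          linarith]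
        simpa using hε
      · have := hT i; rw [tl] at this; linarith
    by_cases hiw : i = w
    · subst hiw
      by_cases htw : t ≤ ℓ' i
      · have := hnear i t ht0 htw
        rw [tl, tu, bl i hne, bu i hne] at this
        rw [e1, e1]
        · exact this
        · have := hB i; rw [bl i hne] at this; linarith
        · have := hT i; rw [tl] at this; linarith
      -- This part of the winner lies in the removed piece. Pulling it back to the top interval of
      -- `l` turns the condition into the one for `l` in the induced exchange.
      · have hs : 0 ≤ t - ℓ' i := by linarith
        have := hnear l (t - ℓ' i) hs (by linarith)
        rw [tl, tu, bll, bul, show lb ℓ i + ℓ' i + (t - ℓ' i) = lb ℓ i + t by ring] at this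
        rw [show lt ℓ i + t = S + (t - ℓ' i) by linarith, e2 _ hs, e1]
        · rw [show ∑ j, u' j + (F (lt ℓ l + (t - ℓ' i)) - lt u l) - lt u i -
            (F (lb ℓ i + t) - lb u i) = F (lt ℓ l + (t - ℓ' i)) - lt u l -
            (F (lb ℓ i + t) - (lb u i + u' i)) by linarith]
          exact this
        · have := hB l; rw [bll] at this; linarith
    · have := hnear i t ht0 (by rw [li i hiw]; exact ht)
      rw [tl, tu, bl i hil, bu i hil] at this
      rw [e1, e1]
      · exact this
      · have := hB i; rw [bl i hil, li i hiw] at this; linarith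
      · have := hT i; rw [tl, li i hiw] at this; linarith

/-- Here the removed piece is the top interval of `l`, and it is the image of the right part of the
winner's top interval. After the move that part is the top interval of `l`, so the base point is
again `lt' ℓ' l`. -/
theorem IsApproxConj.extend_true (h : PosStep lb lt lb' lt' w l)
    (hℓ' : Function.update ℓ w (ℓ w - ℓ l) = ℓ') (hu' : Function.update u w (u w - u l) = u')
    (hpos : ∀ i, 0 ≤ ℓ' i) (hT : ∀ i, lt' ℓ' i + ℓ' i ≤ ∑ i, ℓ' i)
    (hB : ∀ i, lb' ℓ' i + ℓ' i ≤ ∑ i, ℓ' i) {ε : ℝ} (hε : 0 ≤ ε) {F : ℝ → ℝ}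
    (hF : IsApproxConj lt' lb' ℓ' u' ε F) :
    IsApproxConj lt lb ℓ u ε (translateExtend (∑ i, ℓ' i) (lt' ℓ' l) F) := by
  obtain ⟨htot, hleft, hright, hnear⟩ := hF
  have hne := h.ne
  have lw : ℓ' w = ℓ w - ℓ l := by rw [← hℓ', Function.update_self]
  have uw : u' w = u w - u l := by rw [← hu', Function.update_self]
  have li : ∀ i, i ≠ w → ℓ' i = ℓ i := fun i hi => by rw [← hℓ', Function.update_of_ne hi]
  have ui : ∀ i, i ≠ w → u' i = u i := fun i hi => by rw [← hu', Function.update_of_ne hi]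
  have sl : ∑ i, ℓ' i = ∑ i, ℓ i - ℓ l := by rw [← hℓ']; exact sum_update_sub ℓ
  have su : ∑ i, u' i = ∑ i, u i - u l := by rw [← hu']; exact sum_update_sub u
  have bl : ∀ i, lb' ℓ' i = lb ℓ i := fun i => by rw [← hℓ']; exact h.winnerRow ℓ i
  have bu : ∀ i, lb' u' i = lb u i := fun i => by rw [← hu']; exact h.winnerRow u i
  have tl : ∀ i, i ≠ l → lt' ℓ' i = lt ℓ i := fun i hi => by rw [← hℓ']; exact h.loserRow ℓ i hi
  have tu : ∀ i, i ≠ l → lt' u' i = lt u i := fun i hi => by rw [← hu']; exact h.loserRow u i hi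
  have tll : lt' ℓ' l = lt ℓ w + ℓ' w := by rw [lw, ← hℓ', h.loser]; ring
  have tul : lt' u' l = lt u w + u' w := by rw [uw, ← hu', h.loser]; ring
  have wel := h.winner_end ℓ
  have weu := h.winner_end u
  have lel := h.loser_end ℓ
  have leu := h.loser_end u
  have ll := li l hne.symm
  have ul := ui l hne.symm
  set S := ∑ i, ℓ' i with hS
  have e1 : ∀ y, y ≤ S → translateExtend S (lt' ℓ' l) F y = F y := fun y hy => translateExtend_of_le hy
  have e2 : ∀ s, 0 ≤ s → translateExtend S (lt' ℓ' l) F (S + s) =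
      (∑ i, u' i) + (F (lt' ℓ' l + s) - lt' u' l) := fun s hs => by
    rw [translateExtend_of_ge (by linarith), htot, hleft]
    simp
  have hl0 : 0 ≤ ℓ l := ll ▸ hpos l
  have hend : translateExtend S (lt' ℓ' l) F (∑ i, ℓ i) = ∑ i, u i := by
    rw [show ∑ i, ℓ i = S + ℓ l by linarith, e2 _ hl0]
    have := hright l
    rw [ll, ul] at this
    rw [this]; linarith
  refine ⟨hend, fun i => ?_, fun i => ?_, fun i t ht0 ht => ?_⟩
  · by_cases hi : i = l
    · subst hi
      rw [show lt ℓ i = S by linarith, e1 _ le_rfl, htot]; linarith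
    · rw [← tl i hi, e1, hleft, tu i hi]
      have := hT i; have := hpos i; linarith
  · by_cases hi : i = l
    · subst hi
      rw [lel, hend, leu]
    by_cases hiw : i = w
    · subst hiw
      have := hright l
      rw [tll, tul, ll, ul, uw, lw] at this
      rw [e1, show lt ℓ i + ℓ i = lt ℓ i + (ℓ i - ℓ l) + ℓ l by ring, this]
      · ring
      · have := hT l; rw [tll, ll, lw] at this; linarith
    · rw [← li i hiw, ← tl i hi, e1 _ (hT i), hright, tu i hi, ui i hiw]
  · by_cases hil : i = l
    · subst hil
      have := hnear i t ht0 (by rw [ll]; exact ht)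
      rw [bl, bu] at this
      rw [show lt ℓ i + t = S + t by linarith, e2 t ht0, e1]
      · rw [show ∑ j, u' j + (F (lt' ℓ' i + t) - lt' u' i) - lt u i =
          F (lt' ℓ' i + t) - lt' u' i by linarith]
        exact this
      · have := hB i; rw [bl] at this; linarith
    by_cases hiw : i = w
    · subst hiw
      by_cases htw : t ≤ ℓ' i
      · have := hnear i t ht0 htw
        rw [bl, bu, tl i hne, tu i hne] at this
        rw [e1, e1]
        · exact this
        · have := hB i; rw [bl] at this; linarith
        · have := hT i; rw [tl i hne] at this; linarith
      · have hs : 0 ≤ t - ℓ' i := by linarith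
        rw [show lb ℓ i + t = S + (t - ℓ' i) by linarith, e2 _ hs, e1]
        · rw [tll, show lt ℓ i + ℓ' i + (t - ℓ' i) = lt ℓ i + t by ring,
            show F (lt ℓ i + t) - lt u i - (∑ j, u' j + (F (lt ℓ i + t) - lt' u' l) - lb u i) = 0 by
              linarith]
          simpa using hε
        · have := hT l; rw [tll] at this; linarith
    · have := hnear i t ht0 (by rw [li i hiw]; exact ht)
      rw [bl, bu, tl i hil, tu i hil] at this
      rw [e1, e1]
      · exact this
      · have := hB i; rw [bl, li i hiw] at this; linarith
      · have := hT i; rw [tl i hil, li i hiw] at this; linarith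

/-- With error `0` the identities can be read backwards: they determine `F` at the new endpoints and
force it to be the translated extension on the removed piece. -/
theorem IsApproxConj.restrict_false (h : PosStep lt lb lt' lb' w l)
    (hℓ' : Function.update ℓ w (ℓ w - ℓ l) = ℓ') (hu' : Function.update u w (u w - u l) = u')
    (hpos : ∀ i, 0 ≤ ℓ' i) {F : ℝ → ℝ} (hF : IsApproxConj lt lb ℓ u 0 F) :
    IsApproxConj lt' lb' ℓ' u' 0 F ∧
      ∀ y ≤ ∑ i, ℓ i, F y = translateExtend (∑ i, ℓ' i) (lt' ℓ' l) F y := by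
  obtain ⟨htot, hleft, hright, hnear'⟩ := hF
  have hnear : ∀ i t, 0 ≤ t → t ≤ ℓ i → F (lt ℓ i + t) - lt u i = F (lb ℓ i + t) - lb u i :=
    fun i t h0 h1 => sub_eq_zero.1 (abs_nonpos_iff.1 (hnear' i t h0 h1))
  have hne := h.ne
  have lw : ℓ' w = ℓ w - ℓ l := by rw [← hℓ', Function.update_self]
  have uw : u' w = u w - u l := by rw [← hu', Function.update_self]
  have li : ∀ i, i ≠ w → ℓ' i = ℓ i := fun i hi => by rw [← hℓ', Function.update_of_ne hi]
  have ui : ∀ i, i ≠ w → u' i = u i := fun i hi => by rw [← hu', Function.update_of_ne hi]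
  have sl : ∑ i, ℓ' i = ∑ i, ℓ i - ℓ l := by rw [← hℓ']; exact sum_update_sub ℓ
  have su : ∑ i, u' i = ∑ i, u i - u l := by rw [← hu']; exact sum_update_sub u
  have tl : ∀ i, lt' ℓ' i = lt ℓ i := fun i => by rw [← hℓ']; exact h.winnerRow ℓ i
  have tu : ∀ i, lt' u' i = lt u i := fun i => by rw [← hu']; exact h.winnerRow u i
  have bl : ∀ i, i ≠ l → lb' ℓ' i = lb ℓ i := fun i hi => by rw [← hℓ']; exact h.loserRow ℓ i hi
  have bu : ∀ i, i ≠ l → lb' u' i = lb u i := fun i hi => by rw [← hu']; exact h.loserRow u i hi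
  have bll : lb' ℓ' l = lb ℓ w + ℓ' w := by rw [lw, ← hℓ', h.loser]; ring
  have bul : lb' u' l = lb u w + u' w := by rw [uw, ← hu', h.loser]; ring
  have wel := h.winner_end ℓ
  have weu := h.winner_end u
  have lel := h.loser_end ℓ
  have leu := h.loser_end u
  have ll := li l hne.symm
  have ul := ui l hne.symm
  set S := ∑ i, ℓ' i with hS
  have hl0 : 0 ≤ ℓ l := ll ▸ hpos l
  have hw0 : 0 ≤ ℓ' w := hpos w
  have htot' : F S = ∑ i, u' i := by
    have := hnear l 0 le_rfl hl0
    rw [add_zero, add_zero, hleft, show lb ℓ l = S by linarith] at this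
    linarith
  refine ⟨⟨htot', fun i => ?_, fun i => ?_, fun i t ht0 ht => ?_⟩, fun y hy => ?_⟩
  · rw [tl, hleft, tu]
  · by_cases hi : i = w
    · subst hi
      rw [tl, tu, show lt ℓ i + ℓ' i = S by linarith, htot']; linarith
    · rw [tl, tu, li i hi, ui i hi, hright]
  · rw [tl, tu]
    by_cases hil : i = l
    · subst hil
      have h1 := hnear w (ℓ' w + t) (by linarith) (by linarith)
      have h2 := hnear i t ht0 (by linarith)
      rw [show lt ℓ w + (ℓ' w + t) = lb ℓ i + t by linarith] at h1
      rw [bll, bul, add_assoc, show F (lt ℓ i + t) - lt u i -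
        (F (lb ℓ w + (ℓ' w + t)) - (lb u w + u' w)) = 0 by linarith, abs_zero]
    · have h1 := hnear i t ht0 (by
        by_cases hiw : i = w
        · subst hiw; linarith
        · rw [← li i hiw]; exact ht)
      rw [bl i hil, bu i hil, h1, sub_self, abs_zero]
  · rcases le_total y S with h1 | h1
    · rw [translateExtend_of_le h1]
    · rw [translateExtend_of_ge h1, htot', tl, hleft]
      have h2 := hnear l (y - S) (by linarith) (by linarith)
      rw [show lb ℓ l + (y - S) = y by linarith] at h2
      linarith

theorem IsApproxConj.restrict_true (h : PosStep lb lt lb' lt' w l)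
    (hℓ' : Function.update ℓ w (ℓ w - ℓ l) = ℓ') (hu' : Function.update u w (u w - u l) = u')
    (hpos : ∀ i, 0 ≤ ℓ' i) {F : ℝ → ℝ} (hF : IsApproxConj lt lb ℓ u 0 F) :
    IsApproxConj lt' lb' ℓ' u' 0 F ∧
      ∀ y ≤ ∑ i, ℓ i, F y = translateExtend (∑ i, ℓ' i) (lt' ℓ' l) F y := by
  obtain ⟨htot, hleft, hright, hnear'⟩ := hF
  have hnear : ∀ i t, 0 ≤ t → t ≤ ℓ i → F (lt ℓ i + t) - lt u i = F (lb ℓ i + t) - lb u i :=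
    fun i t h0 h1 => sub_eq_zero.1 (abs_nonpos_iff.1 (hnear' i t h0 h1))
  have hne := h.ne
  have lw : ℓ' w = ℓ w - ℓ l := by rw [← hℓ', Function.update_self]
  have uw : u' w = u w - u l := by rw [← hu', Function.update_self]
  have li : ∀ i, i ≠ w → ℓ' i = ℓ i := fun i hi => by rw [← hℓ', Function.update_of_ne hi]
  have ui : ∀ i, i ≠ w → u' i = u i := fun i hi => by rw [← hu', Function.update_of_ne hi]
  have sl : ∑ i, ℓ' i = ∑ i, ℓ i - ℓ l := by rw [← hℓ']; exact sum_update_sub ℓ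
  have su : ∑ i, u' i = ∑ i, u i - u l := by rw [← hu']; exact sum_update_sub u
  have bl : ∀ i, lb' ℓ' i = lb ℓ i := fun i => by rw [← hℓ']; exact h.winnerRow ℓ i
  have bu : ∀ i, lb' u' i = lb u i := fun i => by rw [← hu']; exact h.winnerRow u i
  have tl : ∀ i, i ≠ l → lt' ℓ' i = lt ℓ i := fun i hi => by rw [← hℓ']; exact h.loserRow ℓ i hi
  have tu : ∀ i, i ≠ l → lt' u' i = lt u i := fun i hi => by rw [← hu']; exact h.loserRow u i hi
  have tll : lt' ℓ' l = lt ℓ w + ℓ' w := by rw [lw, ← hℓ', h.loser]; ring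
  have tul : lt' u' l = lt u w + u' w := by rw [uw, ← hu', h.loser]; ring
  have wel := h.winner_end ℓ
  have weu := h.winner_end u
  have lel := h.loser_end ℓ
  have leu := h.loser_end u
  have ll := li l hne.symm
  have ul := ui l hne.symm
  set S := ∑ i, ℓ' i with hS
  have hl0 : 0 ≤ ℓ l := ll ▸ hpos l
  have hw0 : 0 ≤ ℓ' w := hpos w
  have htot' : F S = ∑ i, u' i := by
    rw [show S = lt ℓ l by linarith, hleft]; linarith
  have key : ∀ t, 0 ≤ t → t ≤ ℓ l →
      F (lt ℓ w + ℓ' w + t) - (lt u w + u' w) = F (lt ℓ l + t) - lt u l := by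
    intro t h0 h1
    have h2 := hnear w (ℓ' w + t) (by linarith) (by linarith)
    rw [show lb ℓ w + (ℓ' w + t) = lt ℓ l + t by linarith, ← add_assoc] at h2
    linarith
  have hleft' : F (lt ℓ w + ℓ' w) = lt u w + u' w := by
    have := key 0 le_rfl hl0
    rw [add_zero, add_zero, hleft] at this
    linarith
  refine ⟨⟨htot', fun i => ?_, fun i => ?_, fun i t ht0 ht => ?_⟩, fun y hy => ?_⟩
  · by_cases hi : i = l
    · subst hi
      rw [tll, tul, hleft']
    · rw [tl i hi, tu i hi, hleft]
  · by_cases hi : i = l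
    · subst hi
      rw [tll, tul, ll, ul, show lt ℓ w + ℓ' w + ℓ i = lt ℓ w + ℓ w by linarith, hright]
      linarith
    by_cases hiw : i = w
    · subst hiw
      rw [tl i hi, tu i hi, hleft']
    · rw [tl i hi, tu i hi, li i hiw, ui i hiw, hright]
  · rw [bl, bu]
    by_cases hil : i = l
    · subst hil
      have h2 := hnear i t ht0 (by linarith)
      rw [tll, tul, key t ht0 (by linarith), h2, sub_self, abs_zero]
    · have h1 := hnear i t ht0 (by
        by_cases hiw : i = w
        · subst hiw; linarith
        · rw [← li i hiw]; exact ht)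
      rw [tl i hil, tu i hil, h1, sub_self, abs_zero]
  · rcases le_total y S with h1 | h1
    · rw [translateExtend_of_le h1]
    · have h2 := key (y - S) (by linarith) (by linarith)
      rw [show lt ℓ l + (y - S) = y by linarith] at h2
      rw [translateExtend_of_ge h1, htot', tll, hleft']
      linarith

end Conj

/-! ### Conjugacies along a Rauzy path, and piecewise linear approximations. -/

section PathConj

variable {n : ℕ}

/-- The extension of a function from the base of a Rauzy path to the whole interval. -/
noncomputable def extendPath : List Bool → RauzyTable n → (Fin n → ℝ) → (ℝ → ℝ) → (ℝ → ℝ)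
  | [], _, _, F => F
  | t :: ts, π, ℓ, F =>
    match π.loser t with
    | some l => translateExtend (∑ i, π.newLengths t ℓ i)
        (listPos (π.move t).top (π.newLengths t ℓ) l)
        (extendPath ts (π.move t) (π.newLengths t ℓ) F)
    | none => extendPath ts (π.move t) (π.newLengths t ℓ) F

theorem extendPath_cons {t : Bool} {ts : List Bool} {π : RauzyTable n} {l : Fin n}
    (hl : π.loser t = some l) (ℓ : Fin n → ℝ) (F : ℝ → ℝ) :
    extendPath (t :: ts) π ℓ F = translateExtend (∑ i, π.newLengths t ℓ i)
        (listPos (π.move t).top (π.newLengths t ℓ) l)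
        (extendPath ts (π.move t) (π.newLengths t ℓ) F) := by
  rw [extendPath, hl]

theorem extendPath_append (xs ys : List Bool) (π : RauzyTable n) (ℓ : Fin n → ℝ) (F : ℝ → ℝ) :
    extendPath (xs ++ ys) π ℓ F =
      extendPath xs π ℓ (extendPath ys (tableAfter xs π) (lengthsAfter xs π ℓ) F) := by
  induction xs generalizing π ℓ with
  | nil => rfl
  | cons t xs ih => simp only [List.cons_append, extendPath, ih, tableAfter, lengthsAfter]

theorem continuous_extendPath (ts : List Bool) (π : RauzyTable n) (ℓ : Fin n → ℝ) {F : ℝ → ℝ}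
    (hF : Continuous F) : Continuous (extendPath ts π ℓ F) := by
  induction ts generalizing π ℓ with
  | nil => exact hF
  | cons t ts ih =>
    unfold extendPath
    split
    · exact continuous_translateExtend (ih _ _)
    · exact ih _ _

theorem monotone_extendPath (ts : List Bool) (π : RauzyTable n) (ℓ : Fin n → ℝ) {F : ℝ → ℝ}
    (hF : Monotone F) : Monotone (extendPath ts π ℓ F) := by
  induction ts generalizing π ℓ with
  | nil => exact hF
  | cons t ts ih =>
    unfold extendPath
    split
    · exact monotone_translateExtend (ih _ _)
    · exact ih _ _

/-- `IsApproxConj` for the rows of a table. -/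
def RauzyTable.IsConj (π : RauzyTable n) (ℓ u : Fin n → ℝ) (ε : ℝ) (F : ℝ → ℝ) : Prop :=
  IsApproxConj (listPos π.top) (listPos π.bot) ℓ u ε F

theorem RauzyTable.IsValid.move {π : RauzyTable n} (h : π.IsValid) {t : Bool} {w l : Fin n}
    (hw : π.winner t = some w) (hl : π.loser t = some l) (hwl : w ≠ l) : (π.move t).IsValid := by
  cases t
  · exact (h.move_false hw hl hwl).1
  · exact (h.move_true hw hl hwl).1

theorem IsOrder.listPos_add_le {L : List (Fin n)} (h : IsOrder L) {ℓ : Fin n → ℝ}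
    (hℓ : ∀ i, 0 ≤ ℓ i) (i : Fin n) : listPos L ℓ i + ℓ i ≤ ∑ i, ℓ i := by
  rw [← h.sum_map]
  exact _root_.listPos_add_le hℓ (h.2 i)

theorem RauzyTable.IsConj.extend {π : RauzyTable n} (h : π.IsValid) {t : Bool} {w l : Fin n}
    (hw : π.winner t = some w) (hl : π.loser t = some l) (hwl : w ≠ l) {ℓ u : Fin n → ℝ}
    (hpos : ∀ i, 0 ≤ π.newLengths t ℓ i) {ε : ℝ} (hε : 0 ≤ ε) {F : ℝ → ℝ}
    (hF : (π.move t).IsConj (π.newLengths t ℓ) (π.newLengths t u) ε F) :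
    π.IsConj ℓ u ε (translateExtend (∑ i, π.newLengths t ℓ i)
        (listPos (π.move t).top (π.newLengths t ℓ) l) F) := by
  have hv := h.move hw hl hwl
  cases t
  · exact IsApproxConj.extend_false (h.move_false hw hl hwl).2 (newLengths_eq hw hl ℓ).symm
      (newLengths_eq hw hl u).symm hpos (hv.1.listPos_add_le hpos) (hv.2.listPos_add_le hpos) hε hF
  · exact IsApproxConj.extend_true (h.move_true hw hl hwl).2 (newLengths_eq hw hl ℓ).symm
      (newLengths_eq hw hl u).symm hpos (hv.1.listPos_add_le hpos) (hv.2.listPos_add_le hpos) hε hF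

theorem RauzyTable.IsConj.restrict {π : RauzyTable n} (h : π.IsValid) {t : Bool} {w l : Fin n}
    (hw : π.winner t = some w) (hl : π.loser t = some l) (hwl : w ≠ l) {ℓ u : Fin n → ℝ}
    (hpos : ∀ i, 0 ≤ π.newLengths t ℓ i) {F : ℝ → ℝ} (hF : π.IsConj ℓ u 0 F) :
    (π.move t).IsConj (π.newLengths t ℓ) (π.newLengths t u) 0 F ∧
      ∀ y ≤ ∑ i, ℓ i, F y = translateExtend (∑ i, π.newLengths t ℓ i)
        (listPos (π.move t).top (π.newLengths t ℓ) l) F y := by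
  cases t
  · exact IsApproxConj.restrict_false (h.move_false hw hl hwl).2 (newLengths_eq hw hl ℓ).symm
      (newLengths_eq hw hl u).symm hpos hF
  · exact IsApproxConj.restrict_true (h.move_true hw hl hwl).2 (newLengths_eq hw hl ℓ).symm
      (newLengths_eq hw hl u).symm hpos hF

theorem newLengths_pos {π : RauzyTable n} {t : Bool} {ℓ : Fin n → ℝ} (hA : π.Admits t ℓ)
    (hℓ : ∀ i, 0 < ℓ i) : ∀ i, 0 < π.newLengths t ℓ i := by
  have h := Follows.lengthsAfter_pos (ts := [t]) (π := π) (ℓ := ℓ) ⟨hA, trivial⟩ hℓ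
  exact h

theorem RauzyTable.IsConj.extendPath {ts : List Bool} {π : RauzyTable n} (h : π.IsValid)
    {ℓ u : Fin n → ℝ} (hℓ : ∀ i, 0 < ℓ i) (hf : Follows ts π ℓ) {ε : ℝ} (hε : 0 ≤ ε) {F : ℝ → ℝ}
    (hF : (RauzyTable.tableAfter ts π).IsConj (lengthsAfter ts π ℓ) (lengthsAfter ts π u) ε F) :
    π.IsConj ℓ u ε (extendPath ts π ℓ F) := by
  induction ts generalizing π ℓ u with
  | nil => exact hF
  | cons t ts ih =>
    obtain ⟨hA, hf⟩ := hf
    have hpos := newLengths_pos hA hℓ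
    obtain ⟨w, l, hw, hl, hlt⟩ := hA
    have hwl : w ≠ l := fun e => by subst e; exact lt_irrefl _ hlt
    rw [extendPath_cons hl]
    exact IsConj.extend h hw hl hwl (fun i => (hpos i).le) hε (ih (h.move hw hl hwl) hpos hf hF)

theorem abs_translateExtend_sub_le {S p δ s : ℝ} {F G : ℝ → ℝ} (hS : F S = G S) (hp : F p = G p)
    (hp0 : 0 ≤ p) (hs : p + s ≤ S) (h : ∀ y, 0 ≤ y → y ≤ S → |F y - G y| ≤ δ) :
    ∀ y, 0 ≤ y → y ≤ S + s → |translateExtend S p F y - translateExtend S p G y| ≤ δ := by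
  intro y hy0 hy
  rcases le_total y S with h1 | h1
  · rw [translateExtend_of_le h1, translateExtend_of_le h1]; exact h y hy0 h1
  · rw [translateExtend_of_ge h1, translateExtend_of_ge h1, hS, hp]
    have := h (p + (y - S)) (by linarith) (by linarith)
    rwa [show G S + (F (p + (y - S)) - G p) - (G S + (G (p + (y - S)) - G p)) =
      F (p + (y - S)) - G (p + (y - S)) by ring]

/-- `F` and `G` agree at the endpoints used by `translateExtend`, so their difference is copied by
each extension and never enlarged. -/
theorem abs_extendPath_sub_le {ts : List Bool} {π : RauzyTable n} (h : π.IsValid)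
    {ℓ u : Fin n → ℝ} (hℓ : ∀ i, 0 < ℓ i) (hf : Follows ts π ℓ) {ε δ : ℝ} (hε : 0 ≤ ε)
    {F G : ℝ → ℝ}
    (hF : (tableAfter ts π).IsConj (lengthsAfter ts π ℓ) (lengthsAfter ts π u) ε F)
    (hG : (tableAfter ts π).IsConj (lengthsAfter ts π ℓ) (lengthsAfter ts π u) ε G)
    (hFG : ∀ y, 0 ≤ y → y ≤ ∑ i, lengthsAfter ts π ℓ i → |F y - G y| ≤ δ) :
    ∀ y, 0 ≤ y → y ≤ ∑ i, ℓ i → |extendPath ts π ℓ F y - extendPath ts π ℓ G y| ≤ δ := by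
  induction ts generalizing π ℓ u with
  | nil => exact hFG
  | cons t ts ih =>
    obtain ⟨hA, hf⟩ := hf
    have hpos := newLengths_pos hA hℓ
    obtain ⟨w, l, hw, hl, hlt⟩ := hA
    have hwl : w ≠ l := fun e => by subst e; exact lt_irrefl _ hlt
    have hv := h.move hw hl hwl
    rw [extendPath_cons hl, extendPath_cons hl]
    have h1 := IsConj.extendPath hv hpos hf hε hF
    have h2 := IsConj.extendPath hv hpos hf hε hG
    have hsum : ∑ i, ℓ i = ∑ i, π.newLengths t ℓ i + ℓ l := by
      rw [newLengths_eq hw hl, sum_update_sub]; ring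
    rw [hsum]
    refine abs_translateExtend_sub_le (h1.total.trans h2.total.symm)
      ((h1.left l).trans (h2.left l).symm) (listPos_nonneg (fun i => (hpos i).le) _ _) ?_
      (ih hv hpos hf hF hG hFG)
    have h3 := hv.1.listPos_add_le (fun i => (hpos i).le) l
    have h4 : π.newLengths t ℓ l = ℓ l := by
      rw [newLengths_eq hw hl, Function.update_of_ne hwl.symm]
    rwa [h4] at h3

theorem translateExtend_congr {S p s : ℝ} {F G : ℝ → ℝ} (hs0 : 0 ≤ s)
    (hs : p + s ≤ S) (h : ∀ y ≤ S, F y = G y) :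
    ∀ y ≤ S + s, translateExtend S p F y = translateExtend S p G y := by
  intro y hy
  rcases le_total y S with h1 | h1
  · rw [translateExtend_of_le h1, translateExtend_of_le h1]; exact h y h1
  · rw [translateExtend_of_ge h1, translateExtend_of_ge h1, h S le_rfl, h p (by linarith),
      h _ (by linarith)]

theorem RauzyTable.IsConj.restrictPath {ts : List Bool} {π : RauzyTable n} (h : π.IsValid)
    {ℓ u : Fin n → ℝ} (hℓ : ∀ i, 0 < ℓ i) (hf : Follows ts π ℓ) {F : ℝ → ℝ}
    (hF : π.IsConj ℓ u 0 F) :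
    (RauzyTable.tableAfter ts π).IsConj (lengthsAfter ts π ℓ) (lengthsAfter ts π u) 0 F ∧
      ∀ y ≤ ∑ i, ℓ i, F y = _root_.extendPath ts π ℓ F y := by
  induction ts generalizing π ℓ u with
  | nil => exact ⟨hF, fun _ _ => rfl⟩
  | cons t ts ih =>
    obtain ⟨hA, hf⟩ := hf
    have hpos := newLengths_pos hA hℓ
    obtain ⟨w, l, hw, hl, hlt⟩ := hA
    have hwl : w ≠ l := fun e => by subst e; exact lt_irrefl _ hlt
    have hv := h.move hw hl hwl
    obtain ⟨h1, h2⟩ := IsConj.restrict h hw hl hwl (fun i => (hpos i).le) hF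
    obtain ⟨h3, h4⟩ := ih hv hpos hf h1
    refine ⟨h3, fun y hy => ?_⟩
    rw [extendPath_cons hl, h2 y hy]
    have hsum : ∑ i, ℓ i = ∑ i, π.newLengths t ℓ i + ℓ l := by
      rw [newLengths_eq hw hl, sum_update_sub]; ring
    refine translateExtend_congr (hℓ l).le ?_ h4 y (hsum ▸ hy)
    have h5 := hv.1.listPos_add_le (fun i => (hpos i).le) l
    have h6 : π.newLengths t ℓ l = ℓ l := by
      rw [newLengths_eq hw hl, Function.update_of_ne hwl.symm]
    rwa [h6] at h5

theorem abs_sub_le_of_monotone {F G : ℝ → ℝ} (hF : Monotone F) (hG : Monotone G) (hF0 : F 0 = 0)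
    (hG0 : G 0 = 0) {S s : ℝ} (hFS : F S = s) (hGS : G S = s) {y : ℝ} (hy : 0 ≤ y) (hyS : y ≤ S) :
    |F y - G y| ≤ s := by
  have h1 := hF hy
  have h2 := hF hyS
  have h3 := hG hy
  have h4 := hG hyS
  rw [abs_le]
  constructor <;> linarith

theorem extendPath_zero {ts : List Bool} {π : RauzyTable n} {ℓ : Fin n → ℝ} (hℓ : ∀ i, 0 < ℓ i)
    (hf : Follows ts π ℓ) (F : ℝ → ℝ) : extendPath ts π ℓ F 0 = F 0 := by
  induction ts generalizing π ℓ with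
  | nil => rfl
  | cons t ts ih =>
    obtain ⟨hA, hf⟩ := hf
    have hpos := newLengths_pos hA hℓ
    obtain ⟨w, l, hw, hl, hlt⟩ := hA
    rw [extendPath_cons hl, translateExtend_of_le (Finset.sum_nonneg fun i _ => (hpos i).le),
      ih hpos hf]

/-- The piecewise linear function that maps the intervals of lengths `ℓ` onto those of
lengths `u`. -/
noncomputable def piecewiseLinear (L : List (Fin n)) (ℓ u : Fin n → ℝ) (x : ℝ) : ℝ :=
  ∑ i, u i / ℓ i * max 0 (min (x - listPos L ℓ i) (ℓ i))

theorem continuous_piecewiseLinear (L : List (Fin n)) (ℓ u : Fin n → ℝ) :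
    Continuous (piecewiseLinear L ℓ u) := by
  unfold piecewiseLinear
  fun_prop

theorem monotone_piecewiseLinear (L : List (Fin n)) {ℓ u : Fin n → ℝ} (hℓ : ∀ i, 0 < ℓ i)
    (hu : ∀ i, 0 ≤ u i) : Monotone (piecewiseLinear L ℓ u) := by
  intro x y hxy
  refine Finset.sum_le_sum fun i _ => mul_le_mul_of_nonneg_left ?_ (div_nonneg (hu i) (hℓ i).le)
  exact max_le_max le_rfl (min_le_min (by linarith) le_rfl)

theorem piecewiseLinear_zero (L : List (Fin n)) {ℓ u : Fin n → ℝ} (hℓ : ∀ i, 0 < ℓ i) :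
    piecewiseLinear L ℓ u 0 = 0 := by
  refine Finset.sum_eq_zero fun i _ => ?_
  have := listPos_nonneg (fun i => (hℓ i).le) L i
  rw [max_eq_left, mul_zero]
  exact (min_le_left _ _).trans (by linarith)

theorem piecewiseLinear_prefix {A B : List (Fin n)} {ℓ u : Fin n → ℝ} (hℓ : ∀ i, 0 < ℓ i)
    (h : IsOrder (A ++ B)) : piecewiseLinear (A ++ B) ℓ u (A.map ℓ).sum = (A.map u).sum := by
  have hnd := h.1
  rw [List.nodup_append] at hnd
  have e : (A.map u).sum = ∑ i ∈ A.toFinset, u i := (List.sum_toFinset _ hnd.1).symm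
  have e' : ∑ i ∈ A.toFinset, u i = ∑ i, if i ∈ A then u i else 0 := by
    rw [← Finset.sum_filter]
    congr 1
    ext i
    simp
  rw [e, e', piecewiseLinear]
  refine Finset.sum_congr rfl fun i _ => ?_
  split_ifs with hi
  · rw [listPos_append_of_mem hi]
    have h1 := listPos_add_le (fun i => (hℓ i).le) hi
    rw [min_eq_right (by linarith), max_eq_right (hℓ i).le, div_mul_cancel₀ _ (hℓ i).ne']
  · rw [listPos_append_of_notMem hi]
    have h1 := listPos_nonneg (fun i => (hℓ i).le) B i
    rw [max_eq_left, mul_zero]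
    exact (min_le_left _ _).trans (by linarith)

theorem map_prefix_sum_of_increments {L : List (Fin n)} (hL : L.Nodup) {ℓ u : Fin n → ℝ}
    {F : ℝ → ℝ} (h0 : F 0 = 0) (h : ∀ i, F (listPos L ℓ i + ℓ i) = F (listPos L ℓ i) + u i)
    {A B : List (Fin n)} (e : L = A ++ B) : F (A.map ℓ).sum = (A.map u).sum := by
  subst e
  induction A using List.reverseRecOn generalizing B with
  | nil => simpa using h0
  | append_singleton A i ih =>
    have hi : i ∉ A := by
      rw [List.append_assoc, List.nodup_append] at hL
      exact fun hi => hL.2.2 i hi i (by simp) rfl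
    have h1 := h i
    rw [List.append_assoc, listPos_append_of_notMem hi] at h1
    simp only [List.singleton_append, listPos_cons_self, add_zero] at h1
    have h2 := ih (B := [i] ++ B) (by simpa using hL) (by simpa using h)
    rw [h2] at h1
    simpa using h1

theorem isApproxConj_of_prefix {L : List (Fin n)} (hL : IsOrder L) {ℓ u : Fin n → ℝ} {F : ℝ → ℝ}
    (h : ∀ A B, L = A ++ B → F (A.map ℓ).sum = (A.map u).sum) {lb : (Fin n → ℝ) → Fin n → ℝ} {ε : ℝ}
    (hnear : ∀ i t, 0 ≤ t → t ≤ ℓ i →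
      |(F (listPos L ℓ i + t) - listPos L u i) - (F (lb ℓ i + t) - lb u i)| ≤ ε) :
    IsApproxConj (listPos L) lb ℓ u ε F := by
  have hsplit : ∀ i, ∃ A D, L = A ++ i :: D ∧ i ∉ A := by
    intro i
    obtain ⟨A, D, rfl⟩ := List.append_of_mem (hL.2 i)
    have := hL.1
    rw [List.nodup_append] at this
    exact ⟨A, D, rfl, fun hi => this.2.2 i hi i (by simp) rfl⟩
  refine ⟨?_, fun i => ?_, fun i => ?_, hnear⟩
  · rw [← hL.sum_map ℓ, ← hL.sum_map u]
    exact h L [] (by simp)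
  · obtain ⟨A, D, e, hi⟩ := hsplit i
    rw [e, listPos_append_of_notMem hi, listPos_append_of_notMem hi, listPos_cons_self,
      listPos_cons_self, add_zero, add_zero]
    exact h A _ e
  · obtain ⟨A, D, e, hi⟩ := hsplit i
    rw [e, listPos_append_of_notMem hi, listPos_append_of_notMem hi, listPos_cons_self,
      listPos_cons_self, add_zero, add_zero]
    have := h (A ++ [i]) D (by simp [e])
    simpa using this

/-- The estimate is crude: each of the two differences is at most the total `∑ i, u i`. This
suffices because the total tends to `0` along the cycles. -/
theorem isConj_piecewiseLinear {π : RauzyTable n} (h : π.IsValid) {ℓ u : Fin n → ℝ}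
    (hℓ : ∀ i, 0 < ℓ i) (hu : ∀ i, 0 ≤ u i) :
    π.IsConj ℓ u (2 * ∑ i, u i) (piecewiseLinear π.top ℓ u) := by
  have hpre : ∀ A B, π.top = A ++ B →
      piecewiseLinear π.top ℓ u (A.map ℓ).sum = (A.map u).sum := by
    intro A B e
    rw [e]
    exact piecewiseLinear_prefix hℓ (e ▸ h.1)
  have hℓ' := fun i => (hℓ i).le
  have hmono := monotone_piecewiseLinear π.top hℓ hu
  have h0 := piecewiseLinear_zero π.top (u := u) hℓ
  have htot : piecewiseLinear π.top ℓ u (∑ i, ℓ i) = ∑ i, u i := by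
    rw [← h.1.sum_map ℓ, ← h.1.sum_map u]
    exact hpre π.top [] (by simp)
  have key : ∀ L, IsOrder L → ∀ i t, 0 ≤ t → t ≤ ℓ i →
      |piecewiseLinear π.top ℓ u (listPos L ℓ i + t) - listPos L u i| ≤ ∑ i, u i := by
    intro L hL i t ht0 ht
    have a1 := listPos_nonneg hℓ' L i
    have a2 := hL.listPos_add_le hℓ' i
    have a3 := listPos_nonneg hu L i
    have a4 := hL.listPos_add_le hu i
    have a5 := hmono (show 0 ≤ listPos L ℓ i + t by linarith)
    have a6 := hmono (show listPos L ℓ i + t ≤ ∑ i, ℓ i by linarith)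
    have a7 := hu i
    rw [abs_le]
    constructor <;> linarith
  refine isApproxConj_of_prefix h.1 hpre fun i t ht0 ht => ?_
  refine (abs_sub _ _).trans ?_
  have := key π.top h.1 i t ht0 ht
  have := key π.bot h.2 i t ht0 ht
  linarith

end PathConj

/-! ### Existence and uniqueness of conjugacies for vectors of the cone. -/

section FickConj

variable {n : ℕ} [NeZero n]

omit [NeZero n] in
theorem isValid_ofPerm (τ : Equiv.Perm (Fin n)) : (RauzyTable.ofPerm τ).IsValid := by
  refine ⟨⟨List.nodup_finRange n, List.mem_finRange⟩, ?_, fun i => ?_⟩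
  · exact (List.nodup_finRange n).map τ.symm.injective
  · exact List.mem_map.2 ⟨τ i, List.mem_finRange _, by simp⟩

theorem tendsto_sum_lengthsAfter (hn : 4 ≤ n) {c a : ℕ → ℕ} (hc : ∀ i, 0 < c i) {u : Fin n → ℝ}
    (hu : u ∈ fickCone n c a) : Tendsto (fun m => ∑ i, lengthsAfter (fickPath n c a m)
      (ofPerm (fickPerm n)) u i) atTop (𝓝 0) := by
  have h0 := (mem_fickCone_iff hn).1 hu
  refine squeeze_zero (fun m => Finset.sum_nonneg fun i _ => h0 m i)
    (g := fun m => (∑ i, u i) * (1 / 2) ^ m) (fun m => ?_) ?_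
  · have h1 := two_pow_mul_sum_le (a := a) hn hc m (h0 m)
    rw [fickProd_lengthsAfter hn] at h1
    rw [one_div, inv_pow, ← div_eq_mul_inv, le_div_iff₀ (by positivity), mul_comm]
    exact h1
  · have := (tendsto_pow_atTop_nhds_zero_of_lt_one (r := (1 / 2 : ℝ)) (by norm_num)
      (by norm_num)).const_mul (∑ i, u i)
    simpa using this

/-- On the interval induced by `m` cycles both functions lie between `0` and the remaining sum of
`u`. Extending back keeps this bound on their difference, and the sum tends to `0`. -/
theorem isConj_unique (hn : 4 ≤ n) {c a : ℕ → ℕ} (hc : ∀ i, 0 < c i) {α u : Fin n → ℝ}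
    (hα : ∀ i, 0 < α i) (hf : FollowsFickCycles n c a α) (hu : u ∈ fickCone n c a) {F G : ℝ → ℝ}
    (hF : (ofPerm (fickPerm n)).IsConj α u 0 F) (hG : (ofPerm (fickPerm n)).IsConj α u 0 G)
    (hFm : Monotone F) (hGm : Monotone G) (hF0 : F 0 = 0) (hG0 : G 0 = 0) :
    ∀ y, 0 ≤ y → y ≤ ∑ i, α i → F y = G y := by
  intro y hy0 hy
  have hf' : ∀ m, Follows (fickPath n c a m) (ofPerm (fickPerm n)) α := hf
  have hv := isValid_ofPerm (fickPerm n)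
  have key : ∀ m, |F y - G y| ≤
      ∑ i, lengthsAfter (fickPath n c a m) (ofPerm (fickPerm n)) u i := by
    intro m
    obtain ⟨h1, h2⟩ := IsConj.restrictPath hv hα (hf' m) hF
    obtain ⟨h3, h4⟩ := IsConj.restrictPath hv hα (hf' m) hG
    rw [h2 y hy, h4 y hy]
    exact abs_extendPath_sub_le hv hα (hf' m) le_rfl h1 h3
      (fun z hz0 hz => abs_sub_le_of_monotone hFm hGm hF0 hG0 h1.total h3.total hz0 hz) y hy0 hy
  have := ge_of_tendsto' (tendsto_sum_lengthsAfter hn hc hu) key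
  exact sub_eq_zero.1 (abs_nonpos_iff.1 this)

omit [NeZero n] in
-- After restriction the lengths of `u` are increments of the monotone function `F`.
theorem mem_fickCone_of_isConj (hn : 4 ≤ n) {c a : ℕ → ℕ} {α u : Fin n → ℝ}
    (hα : ∀ i, 0 < α i) (hf : FollowsFickCycles n c a α) {F : ℝ → ℝ}
    (hF : (ofPerm (fickPerm n)).IsConj α u 0 F) (hFm : Monotone F) : u ∈ fickCone n c a := by
  have hf' : ∀ m, Follows (fickPath n c a m) (ofPerm (fickPerm n)) α := hf
  have : NeZero n := ⟨by omega⟩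
  rw [mem_fickCone_iff hn]
  intro m i
  have h1 := (IsConj.restrictPath (isValid_ofPerm (fickPerm n)) hα (hf' m) hF).1
  have h2 := Follows.lengthsAfter_pos (hf' m) hα i
  have h3 := h1.left i
  have h4 := h1.right i
  have h5 := hFm (le_add_of_nonneg_right (a := listPos (tableAfter (fickPath n c a m)
    (ofPerm (fickPerm n))).top (lengthsAfter (fickPath n c a m) (ofPerm (fickPerm n)) α) i) h2.le)
  have h6 := h3 ▸ h4 ▸ h5
  linarith

/-- `G m` extends the piecewise linear function of level `m` to the whole interval. Seen from level
`m`, `G (m + k)` is also the extension of a monotone function with the same total, so the two differ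
by at most the remaining sum of `u`. The error of the approximate conjugacy vanishes in the limit.
-/
theorem exists_isConj (hn : 4 ≤ n) {c a : ℕ → ℕ} (hc : ∀ i, 0 < c i) {α u : Fin n → ℝ}
    (hα : ∀ i, 0 < α i) (hα1 : ∑ i, α i = 1)
    (hf : FollowsFickCycles n c a α) (hu : u ∈ fickCone n c a) :
    ∃ F : ℝ → ℝ, Continuous F ∧ Monotone F ∧ F 0 = 0 ∧ (ofPerm (fickPerm n)).IsConj α u 0 F := by
  have hf' : ∀ m, Follows (fickPath n c a m) (ofPerm (fickPerm n)) α := hf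
  set π := ofPerm (fickPerm n) with hπ
  have hv : π.IsValid := isValid_ofPerm (fickPerm n)
  set ℓ : ℕ → Fin n → ℝ := fun m => lengthsAfter (fickPath n c a m) π α with hℓ
  set w : ℕ → Fin n → ℝ := fun m => lengthsAfter (fickPath n c a m) π u with hw
  have hℓpos : ∀ m i, 0 < ℓ m i := fun m => Follows.lengthsAfter_pos (hf' m) hα
  have hwpos : ∀ m i, 0 ≤ w m i := (mem_fickCone_iff hn).1 hu
  have hwlim : Tendsto (fun m => ∑ i, w m i) atTop (𝓝 0) := tendsto_sum_lengthsAfter hn hc hu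
  have hw0 : ∀ m, 0 ≤ ∑ i, w m i := fun m => Finset.sum_nonneg fun i _ => hwpos m i
  have htab : ∀ m, tableAfter (fickPath n c a m) π = π := tableAfter_fickPath hn c a
  set P : ℕ → ℝ → ℝ := fun m => piecewiseLinear π.top (ℓ m) (w m) with hP
  have hPmono : ∀ m, Monotone (P m) := fun m => monotone_piecewiseLinear _ (hℓpos m) (hwpos m)
  have hPconj : ∀ m, π.IsConj (ℓ m) (w m) (2 * ∑ i, w m i) (P m) := fun m =>
    isConj_piecewiseLinear hv (hℓpos m) (hwpos m)
  have hP0 : ∀ m, P m 0 = 0 := fun m => piecewiseLinear_zero _ (hℓpos m)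
  set G : ℕ → ℝ → ℝ := fun m => extendPath (fickPath n c a m) π α (P m) with hG
  have hGconj : ∀ m, π.IsConj α u (2 * ∑ i, w m i) (G m) := fun m =>
    IsConj.extendPath hv hα (hf' m) (by have := hw0 m; positivity) (by rw [htab]; exact hPconj m)
  have hGclose : ∀ m k, ∀ y, 0 ≤ y → y ≤ 1 → |G m y - G (m + k) y| ≤ ∑ i, w m i := by
    intro m k y hy0 hy
    set ys := fickPath n (fun i => c (m + i)) (fun i => a (m + i)) k with hys
    have epath : fickPath n c a (m + k) = fickPath n c a m ++ ys := fickPath_add n c a m k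
    have hfk : Follows (fickPath n c a m ++ ys) π α := epath ▸ hf' (m + k)
    rw [follows_append, htab] at hfk
    have e1 : G (m + k) = extendPath (fickPath n c a m) π α
        (extendPath ys π (ℓ m) (P (m + k))) := by
      simp only [hG]
      rw [epath, extendPath_append, htab]
    have etab : tableAfter ys π = π := tableAfter_fickPath hn _ _ k
    have eℓ : ℓ (m + k) = lengthsAfter ys π (ℓ m) := by
      simp only [hℓ]; rw [epath, lengthsAfter_append, htab]
    have ew : w (m + k) = lengthsAfter ys π (w m) := by
      simp only [hw]; rw [epath, lengthsAfter_append, htab]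
    have h1 : π.IsConj (ℓ m) (w m) (2 * ∑ i, w (m + k) i) (extendPath ys π (ℓ m) (P (m + k))) := by
      refine IsConj.extendPath hv (hℓpos m) hfk.2 (by have := hw0 (m + k); positivity) ?_
      rw [etab, ← eℓ, ← ew]
      exact hPconj (m + k)
    -- The comparison wants one error for both functions; its size is irrelevant, only the exact
    -- endpoint values are used.
    have hε : 0 ≤ 2 * ∑ i, w m i + 2 * ∑ i, w (m + k) i := by
      have := hw0 m
      have := hw0 (m + k)
      positivity
    rw [e1]
    refine abs_extendPath_sub_le (u := u) hv hα (hf' m) hε ?_ ?_ ?_ y hy0 (hα1 ▸ hy)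
    · rw [htab]
      exact ⟨(hPconj m).total, (hPconj m).left, (hPconj m).right, fun i t h0 ht =>
        ((hPconj m).near i t h0 ht).trans (by have := hw0 (m + k); linarith)⟩
    · rw [htab]
      exact ⟨h1.total, h1.left, h1.right, fun i t h0 ht =>
        (h1.near i t h0 ht).trans (by have := hw0 m; linarith)⟩
    · intro z hz0 hz
      refine abs_sub_le_of_monotone (hPmono m) (monotone_extendPath _ _ _ (hPmono _)) (hP0 m) ?_
        (hPconj m).total h1.total hz0 hz
      rw [extendPath_zero (hℓpos m) hfk.2, hP0]
  -- Clamping the argument to `[0, 1]` makes the convergence uniform on all of `ℝ`, so the limit is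
  -- continuous and monotone everywhere.
  set H : ℕ → ℝ → ℝ := fun m y => G m (max 0 (min y 1)) with hH
  have hclamp : ∀ y : ℝ, 0 ≤ max 0 (min y 1) ∧ max 0 (min y 1) ≤ 1 := fun y =>
    ⟨le_max_left _ _, max_le zero_le_one (min_le_right _ _)⟩
  have hHG : ∀ m y, 0 ≤ y → y ≤ 1 → H m y = G m y := fun m y h0 h1 => by
    simp only [hH, min_eq_left h1, max_eq_right h0]
  have hcauchy : ∀ y, CauchySeq fun m => H m y := by
    intro y
    refine cauchySeq_of_le_tendsto_0' (fun m => ∑ i, w m i) (fun m k hmk => ?_) hwlim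
    obtain ⟨k, rfl⟩ := Nat.exists_eq_add_of_le hmk
    exact hGclose m k _ (hclamp y).1 (hclamp y).2
  choose F hF using fun y => cauchySeq_tendsto_of_complete (hcauchy y)
  have hFclose : ∀ m y, |H m y - F y| ≤ ∑ i, w m i := by
    intro m y
    have h1 : Tendsto (fun k => |H m y - H (k + m) y|) atTop (𝓝 |H m y - F y|) :=
      (tendsto_const_nhds.sub ((tendsto_add_atTop_iff_nat m).2 (hF y))).abs
    refine le_of_tendsto' h1 fun k => ?_
    rw [add_comm k m]
    exact hGclose m k _ (hclamp y).1 (hclamp y).2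
  have hunif : TendstoUniformly H F atTop := by
    rw [Metric.tendstoUniformly_iff]
    intro ε hε
    filter_upwards [hwlim.eventually_lt_const hε] with m hm y
    rw [dist_comm, Real.dist_eq]
    exact (hFclose m y).trans_lt hm
  have hFG : ∀ y, 0 ≤ y → y ≤ 1 → Tendsto (fun m => G m y) atTop (𝓝 (F y)) := fun y h0 h1 =>
    (hF y).congr fun m => hHG m y h0 h1
  have hα' := fun i => (hα i).le
  refine ⟨F, ?_, ?_, ?_, ?_, fun i => ?_, fun i => ?_, fun i t ht0 ht => ?_⟩
  · refine hunif.continuous (Frequently.of_forall fun m => ?_)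
    exact (continuous_extendPath _ _ _ (continuous_piecewiseLinear _ _ _)).comp (by fun_prop)
  · intro x y hxy
    refine le_of_tendsto_of_tendsto' (hF x) (hF y) fun m => ?_
    exact monotone_extendPath _ _ _ (hPmono m) (max_le_max le_rfl (min_le_min hxy le_rfl))
  · refine tendsto_nhds_unique (hFG 0 le_rfl zero_le_one) ?_
    refine tendsto_const_nhds.congr fun m => ?_
    simp only [hG]
    rw [extendPath_zero hα (hf' m), hP0]
  · refine tendsto_nhds_unique (hFG _ (by rw [hα1]; norm_num) hα1.le) ?_
    exact tendsto_const_nhds.congr fun m => ((hGconj m).total).symm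
  · have h1 := listPos_nonneg hα' π.top i
    have h2 := hv.1.listPos_add_le hα' i
    refine tendsto_nhds_unique (hFG _ h1 (by linarith [hα i])) ?_
    exact tendsto_const_nhds.congr fun m => ((hGconj m).left i).symm
  · have h1 := listPos_nonneg hα' π.top i
    have h2 := hv.1.listPos_add_le hα' i
    refine tendsto_nhds_unique (hFG _ (by linarith [hα i]) (by linarith)) ?_
    exact tendsto_const_nhds.congr fun m => ((hGconj m).right i).symm
  · have h1 := listPos_nonneg hα' π.top i
    have h2 := hv.1.listPos_add_le hα' i
    have h3 := listPos_nonneg hα' π.bot i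
    have h4 := hv.2.listPos_add_le hα' i
    have h5 := (((hFG (listPos π.top α i + t) (by linarith) (by linarith)).sub_const
      (listPos π.top u i)).sub ((hFG (listPos π.bot α i + t) (by linarith) (by linarith)).sub_const
      (listPos π.bot u i))).abs
    refine le_of_tendsto_of_tendsto' h5 (by simpa using hwlim.const_mul 2) fun m => ?_
    exact (hGconj m).near i t ht0 ht

end FickConj

/-! ### Invariant measures and their distribution functions. -/

section Measures

variable {n : ℕ}

theorem listPos_eq_sum_filter {L : List (Fin n)} (hL : L.Pairwise (· < ·)) (ℓ : Fin n → ℝ)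
    {i : Fin n} (hi : i ∈ L) : listPos L ℓ i = ((L.filter (· < i)).map ℓ).sum := by
  induction L with
  | nil => simp at hi
  | cons x L ih =>
    rw [List.pairwise_cons] at hL
    by_cases hx : x = i
    · subst hx
      have : L.filter (· < x) = [] :=
        List.filter_eq_nil_iff.2 fun y hy => by simpa using (hL.1 y hy).le
      rw [listPos_cons_self, List.filter_cons_of_neg (by simp), this]
      simp
    · have hiL := (List.mem_cons.1 hi).resolve_left (Ne.symm hx)
      rw [listPos_cons_of_ne hx, ih hL.2 hiL, List.filter_cons_of_pos (by simpa using hL.1 i hiL)]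
      simp

theorem listPos_finRange (ℓ : Fin n → ℝ) (i : Fin n) :
    listPos (List.finRange n) ℓ i = leftEnd ℓ i := by
  rw [listPos_eq_sum_filter (List.pairwise_lt_finRange n) ℓ (List.mem_finRange i), leftEnd,
    ← List.sum_toFinset ℓ ((List.nodup_finRange n).filter _)]
  congr 1
  ext j
  simp

theorem listPos_map (σ : Equiv.Perm (Fin n)) (L : List (Fin n)) (ℓ : Fin n → ℝ) (i : Fin n) :
    listPos (L.map σ) ℓ (σ i) = listPos L (fun k => ℓ (σ k)) i := by
  induction L with
  | nil => rfl
  | cons x L ih => simp [listPos, ih]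

theorem listPos_ofPerm_bot (τ : Equiv.Perm (Fin n)) (ℓ : Fin n → ℝ) (i : Fin n) :
    listPos (ofPerm τ).bot ℓ i = leftEnd (fun k => ℓ (τ.symm k)) (τ i) := by
  have := listPos_map τ.symm (List.finRange n) ℓ (τ i)
  rw [Equiv.symm_apply_apply] at this
  rw [ofPerm, this, listPos_finRange]

theorem measurable_iet (α : Fin n → ℝ) (τ : Equiv.Perm (Fin n)) : Measurable (iet α τ) := by
  unfold iet
  refine measurable_id.add (Finset.measurable_fun_sum _ fun i _ => ?_)
  exact measurable_const.indicator measurableSet_Ico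

theorem ietInterval_eq (α : Fin n → ℝ) (τ : Equiv.Perm (Fin n)) (i : Fin n) :
    ietInterval α i = Set.Ico (listPos (ofPerm τ).top α i) (listPos (ofPerm τ).top α i + α i) := by
  rw [ietInterval, ofPerm, listPos_finRange]

section Lengths

variable {α : Fin n → ℝ} {τ : Equiv.Perm (Fin n)}

theorem listPos_index_unique {L : List (Fin n)} (hL : IsOrder L) (hα : ∀ i, 0 < α i) {i j : Fin n}
    {x : ℝ} (hi : x ∈ Set.Ico (listPos L α i) (listPos L α i + α i))
    (hj : x ∈ Set.Ico (listPos L α j) (listPos L α j + α j)) : i = j := by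
  by_contra h
  rcases listPos_disjoint (fun i => (hα i).le) (hL.2 i) (hL.2 j) h with h | h
  · linarith [hi.2, hj.1]
  · linarith [hi.1, hj.2]

theorem iet_of_mem (hα : ∀ i, 0 < α i) {i : Fin n} {x : ℝ}
    (hx : x ∈ Set.Ico (listPos (ofPerm τ).top α i) (listPos (ofPerm τ).top α i + α i)) :
    iet α τ x = x + (listPos (ofPerm τ).bot α i - listPos (ofPerm τ).top α i) := by
  rw [iet, Finset.sum_eq_single i]
  · rw [ietInterval_eq α τ, Set.indicator_of_mem hx, listPos_ofPerm_bot, ofPerm, listPos_finRange]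
  · intro j _ hj
    rw [ietInterval_eq α τ, Set.indicator_of_notMem]
    exact fun hxj => hj (listPos_index_unique (isValid_ofPerm τ).1 hα hxj hx)
  · simp

theorem iet_of_notMem (hα : ∀ i, 0 < α i) {x : ℝ} (hx : x ∉ Set.Ico 0 (∑ i, α i)) :
    iet α τ x = x := by
  have hα' := fun i => (hα i).le
  rw [iet, Finset.sum_eq_zero, add_zero]
  intro j _
  rw [ietInterval_eq α τ, Set.indicator_of_notMem]
  intro h
  refine hx ⟨(listPos_nonneg hα' _ j).trans h.1, h.2.trans_le ?_⟩
  have h1 := listPos_add_le hα' ((isValid_ofPerm τ).1.2 j)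
  rwa [(isValid_ofPerm τ).1.sum_map] at h1

theorem listPos_add_le_sum {L : List (Fin n)} (hL : IsOrder L) (hα : ∀ i, 0 < α i) (i : Fin n) :
    listPos L α i + α i ≤ ∑ i, α i := by
  have h1 := listPos_add_le (fun i => (hα i).le) (hL.2 i)
  rwa [hL.sum_map] at h1

theorem exists_mem_Ico_listPos {L : List (Fin n)} (hL : IsOrder L) {x : ℝ}
    (hx : x ∈ Set.Ico 0 (∑ i, α i)) :
    ∃ i, x ∈ Set.Ico (listPos L α i) (listPos L α i + α i) := by
  obtain ⟨i, -, h⟩ := exists_mem_listPos hL.1 hx.1 (by rw [hL.sum_map]; exact hx.2)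
  exact ⟨i, h⟩

theorem iet_preimage_Ico (hα : ∀ i, 0 < α i) (i : Fin n) {t : ℝ} (ht : t ≤ α i) :
    iet α τ ⁻¹' Set.Ico (listPos (ofPerm τ).bot α i) (listPos (ofPerm τ).bot α i + t) =
      Set.Ico (listPos (ofPerm τ).top α i) (listPos (ofPerm τ).top α i + t) := by
  have hv := isValid_ofPerm τ
  ext x
  simp only [Set.mem_preimage]
  constructor
  · intro h
    by_cases hx : x ∈ Set.Ico 0 (∑ i, α i)
    · obtain ⟨j, hj⟩ := exists_mem_Ico_listPos hv.1 hx
      rw [iet_of_mem hα hj] at h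
      have hij : j = i := by
        refine listPos_index_unique (x := x + (listPos (ofPerm τ).bot α j -
          listPos (ofPerm τ).top α j)) hv.2 hα ⟨?_, ?_⟩ ⟨h.1, h.2.trans_le (by linarith)⟩
        · linarith [hj.1]
        · linarith [hj.2]
      subst hij
      constructor
      · linarith [h.1]
      · linarith [h.2]
    · rw [iet_of_notMem hα hx] at h
      refine absurd ⟨(listPos_nonneg (fun i => (hα i).le) _ i).trans h.1, h.2.trans_le ?_⟩ hx
      linarith [listPos_add_le_sum hv.2 hα i]
  · intro h
    rw [iet_of_mem hα ⟨h.1, h.2.trans_le (by linarith)⟩]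
    constructor
    · linarith [h.1]
    · linarith [h.2]

theorem iet_mem_iff (hα : ∀ i, 0 < α i) {x : ℝ} :
    iet α τ x ∈ Set.Ico 0 (∑ i, α i) ↔ x ∈ Set.Ico 0 (∑ i, α i) := by
  have hv := isValid_ofPerm τ
  by_cases hx : x ∈ Set.Ico 0 (∑ i, α i)
  · simp only [hx, iff_true]
    obtain ⟨j, hj⟩ := exists_mem_Ico_listPos hv.1 hx
    rw [iet_of_mem hα hj]
    constructor
    · linarith [hj.1, listPos_nonneg (fun i => (hα i).le) (ofPerm τ).bot j]
    · linarith [hj.2, listPos_add_le_sum hv.2 hα j]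
  · rw [iet_of_notMem hα hx]

end Lengths

theorem map_listPos_of_increments {L : List (Fin n)} (hL : IsOrder L) {ℓ u : Fin n → ℝ}
    {F : ℝ → ℝ} (h0 : F 0 = 0) (h : ∀ i, F (listPos L ℓ i + ℓ i) = F (listPos L ℓ i) + u i)
    (i : Fin n) : F (listPos L ℓ i) = listPos L u i := by
  obtain ⟨A, D, e⟩ := List.append_of_mem (hL.2 i)
  have hi : i ∉ A := by
    have := hL.1
    rw [e, List.nodup_append] at this
    exact fun hi => this.2.2 i hi i (by simp) rfl
  have h1 := map_prefix_sum_of_increments hL.1 h0 h e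
  rw [e, listPos_append_of_notMem hi, listPos_append_of_notMem hi, listPos_cons_self,
    listPos_cons_self, add_zero, add_zero, h1]

theorem measureReal_Iio_eq_add (μ : Measure ℝ) [IsFiniteMeasure μ] {a b : ℝ} (h : a ≤ b) :
    μ.real (Set.Iio b) = μ.real (Set.Iio a) + μ.real (Set.Ico a b) := by
  rw [← measureReal_union _ measurableSet_Ico, Set.Iio_union_Ico_eq_Iio h]
  exact Set.disjoint_left.2 fun x hx hx' => (not_lt.2 hx'.1) hx

theorem measureReal_Iio_of_nonpos {μ : Measure ℝ} (hμ : μ (Set.Ico (0 : ℝ) 1)ᶜ = 0) {y : ℝ}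
    (hy : y ≤ 0) : μ.real (Set.Iio y) = 0 := by
  rw [measureReal_def, measure_mono_null _ hμ, ENNReal.toReal_zero]
  exact fun x hx hx' => (not_lt.2 (hx'.1.trans' hy)) hx

theorem measureReal_Iio_of_one_le {μ : Measure ℝ} [IsFiniteMeasure μ]
    (hμ : μ (Set.Ico (0 : ℝ) 1)ᶜ = 0) {y : ℝ} (hy : 1 ≤ y) :
    μ.real (Set.Iio y) = μ.real (Set.Iio 1) := by
  rw [measureReal_Iio_eq_add μ hy, measureReal_def (s := Set.Ico 1 y), measure_mono_null _ hμ]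
  · simp
  · exact fun x hx hx' => (not_lt.2 hx.1) hx'.2

theorem ext_of_measureReal_Iio {μ ν : Measure ℝ} [IsFiniteMeasure μ] [IsFiniteMeasure ν]
    (hμ : μ (Set.Ico (0 : ℝ) 1)ᶜ = 0) (hν : ν (Set.Ico (0 : ℝ) 1)ᶜ = 0)
    (h : ∀ y, 0 ≤ y → y ≤ 1 → μ.real (Set.Iio y) = ν.real (Set.Iio y)) : μ = ν := by
  have h' : ∀ y, μ.real (Set.Iio y) = ν.real (Set.Iio y) := by
    intro y
    rcases le_total y 0 with h0 | h0
    · rw [measureReal_Iio_of_nonpos hμ h0, measureReal_Iio_of_nonpos hν h0]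
    rcases le_total y 1 with h1 | h1
    · exact h y h0 h1
    · rw [measureReal_Iio_of_one_le hμ h1, measureReal_Iio_of_one_le hν h1,
        h 1 zero_le_one le_rfl]
  refine Measure.ext_of_Ico μ ν fun a b hab => ?_
  rw [← measureReal_eq_measureReal_iff]
  have h1 := measureReal_Iio_eq_add μ hab.le
  have h2 := measureReal_Iio_eq_add ν hab.le
  rw [h' a, h' b] at h1
  linarith

variable {α : Fin n → ℝ} {τ : Equiv.Perm (Fin n)}

/-- The distribution function of an invariant measure conjugates the interval exchange to the one
whose lengths are the measures of the intervals. -/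
theorem IsInvariantProb.isConj (hα : ∀ i, 0 < α i) {μ : Measure ℝ}
    (h : IsInvariantProb (iet α τ) μ) :
    (ofPerm τ).IsConj α (fun i => μ.real (ietInterval α i)) 0 (fun y => μ.real (Set.Iio y)) := by
  obtain ⟨hp, hs, hT⟩ := h
  have hv := isValid_ofPerm τ
  have h0 : μ.real (Set.Iio (0 : ℝ)) = 0 := measureReal_Iio_of_nonpos hs le_rfl
  have hIco : ∀ i t, t ≤ α i →
      μ.real (Set.Ico (listPos (ofPerm τ).bot α i) (listPos (ofPerm τ).bot α i + t)) =
      μ.real (Set.Ico (listPos (ofPerm τ).top α i) (listPos (ofPerm τ).top α i + t)) := by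
    intro i t ht
    rw [← hT.measureReal_preimage measurableSet_Ico.nullMeasurableSet, iet_preimage_Ico hα i ht]
  have ht : ∀ i, μ.real (Set.Iio (listPos (ofPerm τ).top α i + α i)) =
      μ.real (Set.Iio (listPos (ofPerm τ).top α i)) + μ.real (ietInterval α i) := fun i => by
    rw [ietInterval_eq α τ, measureReal_Iio_eq_add μ (le_add_of_nonneg_right (hα i).le)]
  have hb : ∀ i, μ.real (Set.Iio (listPos (ofPerm τ).bot α i + α i)) =
      μ.real (Set.Iio (listPos (ofPerm τ).bot α i)) + μ.real (ietInterval α i) := fun i => by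
    rw [ietInterval_eq α τ, ← hIco i _ le_rfl,
      measureReal_Iio_eq_add μ (le_add_of_nonneg_right (hα i).le)]
  refine isApproxConj_of_prefix hv.1 (fun A B e => ?_) fun i t h1 h2 => ?_
  · exact map_prefix_sum_of_increments (F := fun y => μ.real (Set.Iio y)) hv.1.1 h0 ht e
  -- By invariance a bottom interval has the measure of the corresponding top interval, so the
  -- distribution function maps the positions of both rows correctly.
  · have e1 := map_listPos_of_increments (F := fun y => μ.real (Set.Iio y)) hv.1 h0 ht i
    have e2 := map_listPos_of_increments (F := fun y => μ.real (Set.Iio y)) hv.2 h0 hb i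
    beta_reduce at e1 e2
    rw [← e1, ← e2, measureReal_Iio_eq_add μ (le_add_of_nonneg_right h1),
      measureReal_Iio_eq_add μ (le_add_of_nonneg_right h1), hIco i t h2]
    simp

theorem measure_restrict_Iio {F : ℝ → ℝ} (hF : Continuous F) (hF0 : F 0 = 0)
    (S : StieltjesFunction ℝ) (hS : ∀ x, S x = F x) {y : ℝ} (h1 : y ≤ 1) :
    (S.measure.restrict (Set.Ico 0 1)) (Set.Iio y) = ENNReal.ofReal (F y) := by
  have e : Set.Iio y ∩ Set.Ico 0 1 = Set.Ico 0 y := by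
    ext x
    simp only [Set.mem_inter_iff, Set.mem_Iio, Set.mem_Ico]
    constructor
    · tauto
    · exact fun h => ⟨h.2, h.1, h.2.trans_le h1⟩
  have hSF : (S : ℝ → ℝ) = F := funext hS
  rw [Measure.restrict_apply measurableSet_Iio, e, StieltjesFunction.measure_Ico, hSF,
    hF.continuousWithinAt.leftLim_eq, hF.continuousWithinAt.leftLim_eq, hF0, sub_zero]

/-- The measure is the Stieltjes measure of `F` on `[0, 1)`. The push-forward gives an initial piece
of a bottom interval the increment of `F` on the matching top piece; by the exact conjugacy this is
the increment at the bottom, so both distribution functions coincide. -/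
theorem exists_isInvariantProb_of_isConj (hα : ∀ i, 0 < α i) (hα1 : ∑ i, α i = 1) {u : Fin n → ℝ}
    (hu1 : ∑ i, u i = 1) {F : ℝ → ℝ} (hF : Continuous F) (hFm : Monotone F)
    (hF0 : F 0 = 0) (h : (ofPerm τ).IsConj α u 0 F) :
    ∃ μ : Measure ℝ, IsInvariantProb (iet α τ) μ ∧
      ∀ i, μ (ietInterval α i) = ENNReal.ofReal (u i) := by
  have hv := isValid_ofPerm τ
  have hF1 : F 1 = 1 := by rw [← hα1, h.total, hu1]; exact hα1.symm
  have hα' := fun i => (hα i).le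
  let S : StieltjesFunction ℝ := ⟨F, hFm, fun x => hF.continuousWithinAt⟩
  have hIio : ∀ y, y ≤ 1 → (S.measure.restrict (Set.Ico 0 1)) (Set.Iio y) = ENNReal.ofReal (F y) :=
    fun y hy => measure_restrict_Iio hF hF0 S (fun _ => rfl) hy
  set μ := S.measure.restrict (Set.Ico 0 1) with hμ
  have hs : μ (Set.Ico (0 : ℝ) 1)ᶜ = 0 := by
    rw [hμ, Measure.restrict_apply measurableSet_Ico.compl]
    simp
  have hp : IsProbabilityMeasure μ := by
    constructor
    rw [← Set.Iio_union_Ici (a := (1 : ℝ)), measure_union _ measurableSet_Ici, hIio 1 le_rfl, hF1,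
      measure_mono_null _ hs]
    · simp
    · exact fun x hx hx' => (not_lt.2 (Set.mem_Ici.1 hx)) hx'.2
    · exact Set.disjoint_left.2 fun x hx hx' => (not_lt.2 (Set.mem_Ici.1 hx')) hx
  have hreal : ∀ y, 0 ≤ y → y ≤ 1 → μ.real (Set.Iio y) = F y := fun y h0 hy => by
    rw [measureReal_def, hIio y hy, ENNReal.toReal_ofReal (hF0 ▸ hFm h0)]
  have htop : ∀ i t, 0 ≤ t → t ≤ α i →
      μ.real (Set.Ico (listPos (ofPerm τ).top α i) (listPos (ofPerm τ).top α i + t)) =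
        F (listPos (ofPerm τ).bot α i + t) - listPos (ofPerm τ).bot u i := by
    intro i t h0 ht
    have h1 := listPos_nonneg hα' (ofPerm τ).top i
    have h2 := listPos_add_le_sum hv.1 hα i
    have h3 := measureReal_Iio_eq_add μ
      (le_add_of_nonneg_right (a := listPos (ofPerm τ).top α i) h0)
    rw [hreal _ (by linarith) (by linarith), hreal _ h1 (by linarith), h.left] at h3
    have h4 := abs_nonpos_iff.1 (h.near i t h0 ht)
    linarith
  have hfull : ∀ i, F (listPos (ofPerm τ).bot α i + α i) - listPos (ofPerm τ).bot u i = u i := by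
    intro i
    have h4 := abs_nonpos_iff.1 (h.near i (α i) (hα i).le le_rfl)
    rw [h.right] at h4
    linarith
  have hmeas := measurable_iet α τ
  have hinv : μ.map (iet α τ) = μ := by
    have := Measure.isProbabilityMeasure_map (μ := μ) hmeas.aemeasurable
    have hs' : μ.map (iet α τ) (Set.Ico (0 : ℝ) 1)ᶜ = 0 := by
      rw [Measure.map_apply hmeas measurableSet_Ico.compl, ← hα1]
      rw [← hα1] at hs
      convert hs using 2
      ext x
      exact not_congr (iet_mem_iff hα)
    have hIco : ∀ i t, t ≤ α i → (μ.map (iet α τ)).real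
        (Set.Ico (listPos (ofPerm τ).bot α i) (listPos (ofPerm τ).bot α i + t)) =
        μ.real (Set.Ico (listPos (ofPerm τ).top α i) (listPos (ofPerm τ).top α i + t)) := by
      intro i t ht
      rw [measureReal_def, Measure.map_apply hmeas measurableSet_Ico, iet_preimage_Ico hα i ht,
        measureReal_def]
    have hleft : ∀ i, (μ.map (iet α τ)).real (Set.Iio (listPos (ofPerm τ).bot α i)) =
        listPos (ofPerm τ).bot u i := by
      refine map_listPos_of_increments (F := fun y => (μ.map (iet α τ)).real (Set.Iio y)) hv.2
        (measureReal_Iio_of_nonpos hs' le_rfl) fun i => ?_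
      rw [measureReal_Iio_eq_add _ (le_add_of_nonneg_right (hα i).le), hIco i _ le_rfl,
        htop i _ (hα i).le le_rfl, hfull]
    refine ext_of_measureReal_Iio hs' hs fun y h0 h1 => ?_
    -- The point `1` lies in no bottom interval; there both values are the total mass.
    rcases h1.eq_or_lt with rfl | h1
    · have e : ∀ ν : Measure ℝ, IsProbabilityMeasure ν → ν (Set.Ico (0 : ℝ) 1)ᶜ = 0 →
          ν.real (Set.Iio 1) = 1 := by
        intro ν hν hν0
        have h2 : ν.real (Set.Iio 1)ᶜ = 0 := by
          rw [measureReal_def, measure_mono_null _ hν0, ENNReal.toReal_zero]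
          exact Set.compl_subset_compl.2 fun x hx => hx.2
        rw [probReal_compl_eq_one_sub measurableSet_Iio] at h2
        linarith
      rw [e _ this hs', e _ hp hs]
    · obtain ⟨i, hi⟩ := exists_mem_Ico_listPos (α := α) hv.2 (x := y) ⟨h0, hα1 ▸ h1⟩
      have h2 : 0 ≤ y - listPos (ofPerm τ).bot α i := sub_nonneg.2 hi.1
      have h3 : y - listPos (ofPerm τ).bot α i ≤ α i := by linarith [hi.2]
      have h4 := measureReal_Iio_eq_add (μ.map (iet α τ)) hi.1
      have h5 := hIco i _ h3
      rw [htop i _ h2 h3, add_sub_cancel] at h5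
      rw [h4, h5, hleft, hreal y h0 h1.le]
      ring
  refine ⟨μ, ⟨hp, hs, hmeas, hinv⟩, fun i => ?_⟩
  rw [ietInterval_eq α τ, ← ENNReal.ofReal_toReal (measure_ne_top μ _), ← measureReal_def,
    htop i _ (hα i).le le_rfl, hfull]

end Measures

/-! ### Extreme rays give ergodic measures. -/

section Ergodicity

variable {n : ℕ}

theorem monotone_measureReal_Iio (μ : Measure ℝ) [IsFiniteMeasure μ] :
    Monotone fun y => μ.real (Set.Iio y) := fun _ _ h => measureReal_mono (Set.Iio_subset_Iio h)

theorem measureReal_Iio_one {μ : Measure ℝ} [IsProbabilityMeasure μ]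
    (hμ : μ (Set.Ico (0 : ℝ) 1)ᶜ = 0) : μ.real (Set.Iio 1) = 1 := by
  have h : μ.real (Set.Iio 1)ᶜ = 0 := by
    rw [measureReal_def, measure_mono_null _ hμ, ENNReal.toReal_zero]
    exact Set.compl_subset_compl.2 fun x hx => hx.2
  rw [probReal_compl_eq_one_sub measurableSet_Iio] at h
  linarith

theorem IsInvariantProb.sum_eq_one {α : Fin n → ℝ} {τ : Equiv.Perm (Fin n)} (hα : ∀ i, 0 < α i)
    (hα1 : ∑ i, α i = 1) {μ : Measure ℝ} (h : IsInvariantProb (iet α τ) μ) :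
    ∑ i, μ.real (ietInterval α i) = 1 := by
  have := h.1
  rw [← (h.isConj hα).total, hα1, measureReal_Iio_one h.2.1]

theorem IsInvariantProb.mem_fickCone (hn : 4 ≤ n) {c a : ℕ → ℕ} {α : Fin n → ℝ}
    (hα : ∀ i, 0 < α i) (hf : FollowsFickCycles n c a α) {μ : Measure ℝ}
    (h : IsInvariantProb (iet α (fickPerm n)) μ) :
    (fun i => μ.real (ietInterval α i)) ∈ fickCone n c a := by
  have := h.1
  exact mem_fickCone_of_isConj hn hα hf (h.isConj hα) (monotone_measureReal_Iio μ)

theorem IsInvariantProb.eq_of_measure_interval_eq (hn : 4 ≤ n) {c a : ℕ → ℕ} (hc : ∀ i, 0 < c i)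
    {α : Fin n → ℝ} (hα : ∀ i, 0 < α i) (hα1 : ∑ i, α i = 1) (hf : FollowsFickCycles n c a α)
    {μ ν : Measure ℝ} (hμ : IsInvariantProb (iet α (fickPerm n)) μ)
    (hν : IsInvariantProb (iet α (fickPerm n)) ν)
    (h : ∀ i, μ.real (ietInterval α i) = ν.real (ietInterval α i)) : μ = ν := by
  have : NeZero n := ⟨by omega⟩
  have := hμ.1
  have := hν.1
  have hν' := hν.isConj hα
  rw [← funext h] at hν'
  refine ext_of_measureReal_Iio hμ.2.1 hν.2.1 fun y h0 h1 => ?_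
  exact isConj_unique hn hc hα hf (hμ.mem_fickCone hn hα hf) (hμ.isConj hα) hν'
    (monotone_measureReal_Iio μ) (monotone_measureReal_Iio ν)
    (measureReal_Iio_of_nonpos hμ.2.1 le_rfl) (measureReal_Iio_of_nonpos hν.2.1 le_rfl) y h0
    (hα1 ▸ h1)

theorem smul_mem_fickCone {c a : ℕ → ℕ} {r : ℝ} (hr : 0 ≤ r) {u : Fin n → ℝ}
    (hu : u ∈ fickCone n c a) : r • u ∈ fickCone n c a := by
  intro m
  obtain ⟨x, hx, rfl⟩ := hu m
  exact ⟨r • x, fun i => mul_nonneg hr (hx i), (Matrix.mulVec_smul _ _ _).symm⟩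

theorem IsInvariantProb.cond {T : ℝ → ℝ} {μ : Measure ℝ} (h : IsInvariantProb T μ) {s : Set ℝ}
    (hs : MeasurableSet s) (hTs : T ⁻¹' s = s) (h0 : μ s ≠ 0) :
    IsInvariantProb T (ProbabilityTheory.cond μ s) := by
  have := h.1
  refine ⟨ProbabilityTheory.cond_isProbabilityMeasure h0, ?_, ?_⟩
  · exact ProbabilityTheory.cond_absolutelyContinuous h.2.1
  · have h1 := h.2.2.restrict_preimage hs
    rw [hTs] at h1
    exact h1.smul_measure _

/-- The conditional measures on an invariant set and on its complement are invariant, so their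
interval vectors lie in the cone, and weighted by the masses they add up to `v j`. Extremality and
`IsInvariantProb.eq_of_measure_interval_eq` identify the conditional measure with `μ`. -/
theorem IsInvariantProb.ergodic [NeZero n] (hn : 4 ≤ n) {c a : ℕ → ℕ} (hc : ∀ i, 0 < c i)
    {v : Fin n → Fin n → ℝ} (hv : ∀ i, Tendsto (fun m => fickBarProd n m c a (Pi.single i 1)) atTop
      (𝓝 (v (fickTarget n i))))
    (hli : LinearIndependent ℝ (fun j : fickIndices n => v j)) {j : Fin n} (hj : j ∈ fickIndices n)
    {α : Fin n → ℝ} (hα : ∀ i, 0 < α i) (hα1 : ∑ i, α i = 1) (hf : FollowsFickCycles n c a α)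
    {μ : Measure ℝ} (hμ : IsInvariantProb (iet α (fickPerm n)) μ)
    (h : ∀ i, μ.real (ietInterval α i) = v j i) : Ergodic (iet α (fickPerm n)) μ := by
  have := hμ.1
  refine ⟨hμ.2.2, ⟨fun s hs hTs => ?_⟩⟩
  rw [eventuallyConst_set', ae_eq_empty, ae_eq_univ]
  by_contra! hcon
  obtain ⟨h0, h0c⟩ := hcon
  have h1 := hμ.cond hs hTs h0
  have h2 := hμ.cond hs.compl (by rw [Set.preimage_compl, hTs]) h0c
  set μ₁ := ProbabilityTheory.cond μ s
  set μ₂ := ProbabilityTheory.cond μ sᶜ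
  obtain ⟨t, ht⟩ := eq_of_add_eq_limit hn hc hv hli hj
    (smul_mem_fickCone (measureReal_nonneg (μ := μ) (s := s)) (h1.mem_fickCone hn hα hf))
    (smul_mem_fickCone (measureReal_nonneg (μ := μ) (s := sᶜ)) (h2.mem_fickCone hn hα hf)) (by
      ext i
      simp only [Pi.add_apply, Pi.smul_apply, smul_eq_mul]
      have hcond : ∀ {r : Set ℝ}, MeasurableSet r → μ r ≠ 0 →
          μ.real r * (ProbabilityTheory.cond μ r).real (ietInterval α i) =
            μ.real (ietInterval α i ∩ r) := fun {r} hr hr0 => by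
        rw [mul_comm, measureReal_def, measureReal_def, measureReal_def, ← ENNReal.toReal_mul,
          ProbabilityTheory.cond_mul_eq_inter hr, Set.inter_comm]
      rw [← h i, hcond hs h0, hcond hs.compl h0c]
      exact measureReal_inter_add_sdiff hs)
  have hp : μ.real s ≠ 0 := by
    rw [measureReal_def]
    exact ENNReal.toReal_ne_zero.2 ⟨h0, measure_ne_top _ _⟩
  -- Both interval vectors have sum `1`, which fixes the proportionality factor.
  have hpt : μ.real s = t := by
    have := congrArg (fun x : Fin n → ℝ => ∑ i, x i) ht
    simp only [Pi.smul_apply, smul_eq_mul, ← Finset.mul_sum] at this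
    rwa [h1.sum_eq_one hα hα1, ← funext h, hμ.sum_eq_one hα hα1, mul_one, mul_one] at this
  have heq : μ₁ = μ := h1.eq_of_measure_interval_eq hn hc hα hα1 hf hμ fun i => by
    have := congrFun ht i
    simp only [Pi.smul_apply, smul_eq_mul, ← hpt, ← h i] at this
    exact mul_left_cancel₀ hp this
  -- Conditioning on `s` gives `sᶜ` mass `0`, and the conditional measure is `μ`.
  refine h0c ?_
  rw [← heq, ProbabilityTheory.cond_apply hs]
  simp

end Ergodicity

end FickenscherCycles

/-! ### Assembly of the theorem. -/

theorem theorem1 (n p : ℕ) (hn : 4 ≤ n) (hp : n + 1 ≤ p) (c a : ℕ → ℕ) (hc : 0 < c 0)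
    (hca : ∀ i, c (i + 1) = p * a i) (hac : ∀ i, p * a i = p ^ 2 * c i) :
    -- the index set `{3, 5, …, 2⌊n/2⌋ - 1, n}` has `⌊n/2⌋` elements
    (fickIndices n).card = n / 2 ∧
    -- there are interval exchanges defined by these parameters
    (∃ α : Fin n → ℝ, (∀ i, 0 < α i) ∧ ∑ i, α i = 1 ∧ FollowsFickCycles n c a α) ∧
    -- the limits of the normalized products exist
    ∃ v : Fin n → Fin n → ℝ,
      (∀ j ∈ fickIndices n,
        Tendsto (fun m => fickBarProd n m c a (Pi.single j 1)) atTop (𝓝 (v j))) ∧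
      -- and they give distinct ergodic measures of each such interval exchange
      ∀ α : Fin n → ℝ, (∀ i, 0 < α i) → ∑ i, α i = 1 → FollowsFickCycles n c a α →
        NonUniquelyErgodic (iet α (fickPerm n)) ∧
        ∃ lam : Fin n → Measure ℝ,
          (∀ j ∈ fickIndices n,
            IsInvariantProb (iet α (fickPerm n)) (lam j) ∧
            Ergodic (iet α (fickPerm n)) (lam j) ∧
            (∀ i, lam j (ietInterval α i) = ENNReal.ofReal (v j i)) ∧
            ∀ μ : Measure ℝ, IsInvariantProb (iet α (fickPerm n)) μ →
              (∀ i, μ (ietInterval α i) = ENNReal.ofReal (v j i)) → μ = lam j) ∧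
          Set.InjOn lam (fickIndices n : Set (Fin n)) := by
  have : NeZero n := ⟨by omega⟩
  have hp0 : 0 < p := by omega
  have ha : ∀ i, a i = p * c i := fun i =>
    Nat.eq_of_mul_eq_mul_left hp0 (by rw [hac, pow_two, mul_assoc])
  have hcs : ∀ i, c (i + 1) = p ^ 2 * c i := fun i => by rw [hca, hac]
  have hcpos : ∀ i, 0 < c i := fun i => by
    induction i with
    | zero => exact hc
    | succ i ih => rw [hcs]; positivity
  have hapos : ∀ i, 0 < a i := fun i => by rw [ha]; exact Nat.mul_pos hp0 (hcpos i)
  obtain ⟨v, hli, hprob, hlim⟩ := exists_limits_fickBarProd hn (by omega) hcpos hcs ha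
  have hlim' : ∀ j ∈ fickIndices n,
      Tendsto (fun m => fickBarProd n m c a (Pi.single j 1)) atTop (𝓝 (v j)) := fun j hj => by
    have := hlim j
    rwa [fickTarget_of_mem hn hj] at this
  have hsingle : ∀ j i : Fin n, 0 ≤ (Pi.single j 1 : Fin n → ℝ) i := fun j i => by
    rw [Pi.single_apply]; split_ifs <;> norm_num
  have hcone : ∀ j ∈ fickIndices n, v j ∈ fickCone n c a := fun j hj => by
    refine mem_fickCone_of_tendsto hn (i := j)
      (r := fun m => (∑ i, (fickProd n c a m).mulVec (Pi.single j 1) i)⁻¹) (fun m => ?_) ?_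
    · exact inv_nonneg.2 (Finset.sum_nonneg fun i _ =>
        fickProd_mulVec_nonneg c a m (hsingle j) i)
    · refine (hlim' j hj).congr fun m => ?_
      rw [fickBarProd_eq hn hcpos m (hsingle j) (by simp), normalizeSum]
  have hinj : ∀ j ∈ fickIndices n, ∀ k ∈ fickIndices n, v j = v k → j = k := fun j hj k hk h => by
    have := hli.injective (a₁ := ⟨j, hj⟩) (a₂ := ⟨k, hk⟩) h
    exact congrArg Subtype.val this
  have hcard := card_fickIndices hn
  obtain ⟨j₁, hj₁, j₂, hj₂, hne⟩ := Finset.one_lt_card.1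
    (show 1 < (fickIndices n).card by rw [hcard]; omega)
  -- Any limit vector serves as a length vector, being a nonzero point of the cone and hence
  -- positive.
  refine ⟨hcard, ⟨v j₁, ?_, (hprob j₁ hj₁).2, ?_⟩, v, hlim', fun α hα hα1 hf => ?_⟩
  · exact fickCone_pos hn hcpos hapos (hcone j₁ hj₁) fun e => by
      have := (hprob j₁ hj₁).2
      rw [e] at this
      simp at this
  · exact follows_of_mem_fickCone hn hcpos hapos (hcone j₁ hj₁) fun e => by
      have := (hprob j₁ hj₁).2
      rw [e] at this
      simp at this
  -- The membership is placed inside the existential so that a measure can be chosen for every `j`,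
  -- with the default `0` off the index set.
  have hex : ∀ j, ∃ μ : Measure ℝ, j ∈ fickIndices n → IsInvariantProb (iet α (fickPerm n)) μ ∧
      ∀ i, μ (ietInterval α i) = ENNReal.ofReal (v j i) := fun j => by
    by_cases hj : j ∈ fickIndices n
    · obtain ⟨F, hF, hFm, hF0, hconj⟩ := exists_isConj hn hcpos hα hα1 hf (hcone j hj)
      obtain ⟨μ, hμ⟩ := exists_isInvariantProb_of_isConj hα hα1 (hprob j hj).2 hF hFm hF0 hconj
      exact ⟨μ, fun _ => hμ⟩
    · exact ⟨0, fun h => absurd h hj⟩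
  choose lam hlam using hex
  have hreal : ∀ j ∈ fickIndices n, ∀ μ : Measure ℝ,
      (∀ i, μ (ietInterval α i) = ENNReal.ofReal (v j i)) →
      ∀ i, μ.real (ietInterval α i) = v j i := fun j hj μ h i => by
    rw [measureReal_def, h, ENNReal.toReal_ofReal ((hprob j hj).1 i)]
  have hlaminj : Set.InjOn lam (fickIndices n : Set (Fin n)) := fun j hj k hk h => by
    refine hinj j hj k hk (funext fun i => ?_)
    rw [← hreal j hj _ (hlam j hj).2, ← hreal k hk _ (hlam k hk).2, h]
  refine ⟨⟨lam j₁, lam j₂, (hlam j₁ hj₁).1, (hlam j₂ hj₂).1, fun h => hne (hlaminj hj₁ hj₂ h)⟩,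
    lam, fun j hj => ⟨(hlam j hj).1, ?_, (hlam j hj).2, fun μ hμ h => ?_⟩, hlaminj⟩
  · exact (hlam j hj).1.ergodic hn hcpos hlim hli hj hα hα1 hf (hreal j hj _ (hlam j hj).2)
  · refine hμ.eq_of_measure_interval_eq hn hcpos hα hα1 hf (hlam j hj).1 fun i => ?_
    rw [hreal j hj _ h, hreal j hj _ (hlam j hj).2]
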